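/- Let $k$ be a field of characteristic $0$ and let $x=(x_1,x_2,\dots)$, $y=(y_1,y_2,\dots)$ be two independent sequences of formal variables. All identities below are in the ring $k[[x,y]]$ of formal power series in these variables. For a partition $\lambda$ let $s_\lambda$ be the Schur function and let $$\mathfrak M(\lambda)=\frac1Z\,s_\lambda(x)\,s_\lambda(y),\qquad Z=\sum_\lambda s_\lambda(x)\,s_\lambda(y),$$ be the (formal) Schur measure; for a set $E$ of partitions put $\mathfrak M(E)=\sum_{\lambda\in E}\mathfrak M(\lambda)$. Let $\mathfrak S(\lambda)=\{\lambda_i-i+\tfrac12 : i\ge 1\}\subset\mathbb Z+\tfrac12$, and for a finite set $X\subset\mathbb Z+\tfrac12$ let $$\rho(X)=\mathfrak M\big(\{\lambda : X\subset\mathfrak S(\lambda)\}\big).$$ Let $\Lambda^{\frac\infty2}V$ be the infinite wedge space: the $k$-vector space with basis $v_S=\underline{s_1}\wedge\underline{s_2}\wedge\cdots$, indexed by the sets $S=\{s_1>s_2>\dots\}\subset\mathbb Z+\tfrac12$ for which $S\cap\mathbb R_{>0}$ and $\{-\tfrac12,-\tfrac32,\dots\}\setminus S$ are finite, with the bilinear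 form $(\cdot,\cdot)$ for which this basis is orthonormal and the vacuum $v_\emptyset=\underline{-\tfrac12}\wedge\underline{-\tfrac32}\wedge\cdots$. Let $\psi_r f=\underline r\wedge f$, let $\psi_r^*$ be the adjoint of $\psi_r$, and let $\alpha_n=\sum_{r\in\mathbb Z+\frac12}\psi_{r-n}\psi_r^*$ for $n\ne0$. For a sequence $s=(s_1,s_2,\dots)$ of scalars put $\Gamma_\pm(s)=\exp\big(\sum_{n\ge1}s_n\alpha_{\pm n}\big)$. Let $t_n=\frac1n\sum_i x_i^n$, $t_n'=\frac1n\sum_i y_i^n$, and $$G=\Gamma_+(t)\,\Gamma_-(t')^{-1},\qquad \Psi_r=G\,\psi_r\,G^{-1},\qquad \Psi_r^*=G\,\psi_r^*\,G^{-1},$$ as formal power series in $x,y$ whose coefficients are operators in $\Lambda^{\frac\infty2}V$. Then for every finite $X\subset\mathbb Z+\tfrac12$ $$\rho(X)=\det\big[K(a,b)\big]_{a,b\in X},\qquad K(a,b)=\big(\Psi_a\Psi_b^*\,v_\emptyset,v_\emptyset\big).$$ -/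

import Mathlib

namespace SchurMeasure

/-! ### Half-integers and semi-infinite subsets -/

/-- The set `ℤ + 1/2` of half-integers, with the order of `ℚ`. -/
abbrev HalfInt : Type := {q : ℚ // ∃ n : ℤ, q = n + 1 / 2}

/-- The translate `r + n` of a half-integer `r` by an integer `n`. -/
def HalfInt.shift (r : HalfInt) (n : ℤ) : HalfInt :=
  ⟨r.1 + n, by
    obtain ⟨q, m, rfl⟩ := r
    exact ⟨m + n, by push_cast; ring⟩⟩

/-- The negative half-integers `ℤ_{≤ 0} - 1/2 = {-1/2, -3/2, -5/2, …}`. -/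
def negHalf : Set HalfInt := {r | r.1 < 0}

theorem HalfInt.finite_Ico (a b : ℚ) : {r : HalfInt | a ≤ r.1 ∧ r.1 < b}.Finite := by
  have h : (Set.Icc (⌊a⌋ - 1) (⌈b⌉ + 1) : Set ℤ).Finite := Set.finite_Icc _ _
  refine (h.image fun n : ℤ => (⟨(n : ℚ) + 1 / 2, n, rfl⟩ : HalfInt)).subset ?_
  rintro ⟨q, n, rfl⟩ ⟨h1, h2⟩
  refine ⟨n, ⟨?_, ?_⟩, rfl⟩
  · have h3 := Int.floor_le a
    have : (⌊a⌋ : ℚ) < ((n + 1 : ℤ) : ℚ) := by push_cast; simp only at h1; linarith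
    have := Int.cast_lt.mp this
    omega
  · have h3 := Int.le_ceil b
    have : (n : ℚ) < (⌈b⌉ : ℚ) := by simp only at h2; linarith
    have := Int.cast_lt.mp this
    omega

/-- The subsets `S ⊂ ℤ + 1/2` such that `S_+ = S ∖ (ℤ_{≤ 0} - 1/2)` and
`S_- = (ℤ_{≤ 0} - 1/2) ∖ S` are both finite. -/
abbrev Maya : Type := {S : Set HalfInt // (S \ negHalf).Finite ∧ (negHalf \ S).Finite}

namespace Maya

/-- `S ∪ {r}`. -/
def insert (S : Maya) (r : HalfInt) : Maya :=
  ⟨Insert.insert r S.1, by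
    constructor
    · refine (S.2.1.insert r).subset ?_
      rintro s ⟨rfl | h, h'⟩
      · exact Or.inl rfl
      · exact Or.inr ⟨h, h'⟩
    · exact S.2.2.subset fun s hs => ⟨hs.1, fun h => hs.2 (Or.inr h)⟩⟩

/-- `S ∖ {r}`. -/
def erase (S : Maya) (r : HalfInt) : Maya :=
  ⟨S.1 \ {r}, by
    constructor
    · exact S.2.1.subset fun s hs => ⟨hs.1.1, hs.2⟩
    · refine (S.2.2.insert r).subset ?_
      rintro s ⟨h, h'⟩
      by_cases hr : s = r
      · exact Or.inl hr
      · exact Or.inr ⟨h, fun hS => h' ⟨hS, hr⟩⟩⟩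

/-- The vacuum set `{-1/2, -3/2, -5/2, …}`. -/
def vac : Maya := ⟨negHalf, by simp, by simp⟩

theorem finite_above (S : Maya) (r : HalfInt) : {s | s ∈ S.1 ∧ r < s}.Finite := by
  refine (S.2.1.union (HalfInt.finite_Ico r.1 0)).subset ?_
  rintro s ⟨hs, hr⟩
  by_cases h : s.1 < 0
  · exact Or.inr ⟨le_of_lt hr, h⟩
  · exact Or.inl ⟨hs, h⟩

/-- The number of elements of `S` larger than `r` (always finite, by `finite_above`). -/
noncomputable def above (S : Maya) (r : HalfInt) : ℕ := {s | s ∈ S.1 ∧ r < s}.ncard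

end Maya

/-! ### The infinite wedge space and the fermions -/

section Wedge

variable (k : Type*) [Field k]

/-- The infinite wedge space `Λ^{∞/2} V` over `k`: the vector space with basis
`v_S = s₁ ∧ s₂ ∧ s₃ ∧ …`, where `S = {s₁ > s₂ > s₃ > …}`. -/
abbrev Wedge : Type _ := Maya →₀ k

/-- The basis vector `v_S`. -/
noncomputable def vec (S : Maya) : Wedge k := Finsupp.single S 1

/-- The bilinear inner product for which the basis `v_S` is orthonormal. -/
noncomputable def innerProd (v w : Wedge k) : k := v.sum fun S c => c * w S

open Classical in
/-- The exterior multiplication `ψ_r f = r ∧ f`. -/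
noncomputable def psi (r : HalfInt) : Module.End k (Wedge k) :=
  Finsupp.linearCombination k fun S : Maya =>
    if r ∈ S.1 then 0 else (-1 : k) ^ S.above r • vec k (S.insert r)

open Classical in
/-- The operator `ψ*_r`, adjoint to `ψ_r` (see `innerProd_psi_left`). -/
noncomputable def psiStar (r : HalfInt) : Module.End k (Wedge k) :=
  Finsupp.linearCombination k fun S : Maya =>
    if r ∈ S.1 then (-1 : k) ^ S.above r • vec k (S.erase r) else 0

/-- The operators `α_n = ∑_{r ∈ ℤ + 1/2} ψ_{r - n} ψ*_r`, intended for `n ≠ 0`.  On every `v_S`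
only finitely many terms are nonzero, see `finite_alpha`. -/
noncomputable def alpha (n : ℤ) : Module.End k (Wedge k) :=
  Finsupp.linearCombination k fun S : Maya =>
    ∑ᶠ r : HalfInt, psi k (r.shift (-n)) (psiStar k r (vec k S))

variable {k}

open Classical in
theorem psi_vec (r : HalfInt) (S : Maya) : psi k r (vec k S) =
    if r ∈ S.1 then 0 else (-1 : k) ^ S.above r • vec k (S.insert r) := by
  simp [psi, vec]

open Classical in
theorem psiStar_vec (r : HalfInt) (S : Maya) : psiStar k r (vec k S) =
    if r ∈ S.1 then (-1 : k) ^ S.above r • vec k (S.erase r) else 0 := by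
  simp [psiStar, vec]

open Classical in
theorem finite_alpha (n : ℤ) (hn : n ≠ 0) (S : Maya) :
    (Function.support fun r : HalfInt =>
      psi k (r.shift (-n)) (psiStar k r (vec k S))).Finite := by
  have hinj : Function.Injective fun r : HalfInt => r.shift (-n) := by
    intro a b h
    have := congrArg Subtype.val h
    simp only [HalfInt.shift] at this
    exact Subtype.ext (by linarith)
  refine ((S.2.1.union (HalfInt.finite_Ico n 0)).union
    (S.2.2.preimage (f := fun r : HalfInt => r.shift (-n)) hinj.injOn)).subset ?_
  intro r hr
  rw [Function.mem_support, psiStar_vec] at hr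
  split_ifs at hr with h
  · rw [map_smul, psi_vec] at hr
    split_ifs at hr with h'
    · simp at hr
    · have hne : r.shift (-n) ≠ r := by
        intro e
        have := congrArg Subtype.val e
        simp only [HalfInt.shift] at this
        push_cast at this
        exact hn (by exact_mod_cast (by linarith : (n : ℚ) = 0))
      have h2 : r.shift (-n) ∉ S.1 := fun hS => h' ⟨hS, hne⟩
      by_cases h0 : r.1 < 0
      · by_cases h1 : (r.shift (-n)).1 < 0
        · exact Or.inr ⟨h1, h2⟩
        · refine Or.inl (Or.inr ⟨?_, h0⟩)
          simp only [HalfInt.shift] at h1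
          push_cast at h1
          linarith
      · exact Or.inl (Or.inl ⟨h, h0⟩)
  · simp at hr

open Classical in
theorem innerProd_psi_left (r : HalfInt) (v w : Wedge k) :
    innerProd k (psi k r v) w = innerProd k v (psiStar k r w) := by
  have hb : ∀ S T : Maya, innerProd k (psi k r (vec k S)) (vec k T) =
      innerProd k (vec k S) (psiStar k r (vec k T)) := by
    intro S T
    rw [psi_vec, psiStar_vec]
    by_cases hS : r ∈ S.1
    · rw [if_pos hS]
      by_cases hT : r ∈ T.1
      · have hne : T.erase r ≠ S := by
          rintro rfl
          exact hS.2 rfl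
        simp [innerProd, vec, if_pos hT, Finsupp.single_apply, hne]
      · simp [innerProd, if_neg hT]
    · rw [if_neg hS]
      by_cases hT : r ∈ T.1
      · rw [if_pos hT]
        by_cases he : S.insert r = T
        · subst he
          have h1 : (S.insert r).erase r = S := by
            apply Subtype.ext
            ext s
            simp only [Maya.insert, Maya.erase, Set.mem_sdiff, Set.mem_insert_iff,
              Set.mem_singleton_iff]
            constructor
            · rintro ⟨rfl | h, h'⟩
              · exact absurd rfl h'
              · exact h
            · intro h
              exact ⟨Or.inr h, fun e => hS (e ▸ h)⟩
          have h2 : (S.insert r).above r = S.above r := by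
            unfold Maya.above
            congr 1
            ext s
            simp only [Maya.insert, Set.mem_insert_iff, Set.mem_ofPred_eq]
            constructor
            · rintro ⟨rfl | h, h'⟩
              · exact absurd h' (lt_irrefl _)
              · exact ⟨h, h'⟩
            · rintro ⟨h, h'⟩
              exact ⟨Or.inr h, h'⟩
          simp [innerProd, vec, h1, h2]
        · have h1 : T.erase r ≠ S := by
            rintro rfl
            apply he
            apply Subtype.ext
            ext s
            simp only [Maya.insert, Maya.erase, Set.mem_sdiff, Set.mem_insert_iff,
              Set.mem_singleton_iff]
            constructor
            · rintro (rfl | h)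
              · exact hT
              · exact h.1
            · intro h
              by_cases hs : s = r
              · exact Or.inl hs
              · exact Or.inr ⟨h, hs⟩
          simp [innerProd, vec, Finsupp.single_apply, h1, Ne.symm he]
      · rw [if_neg hT]
        have hne : T ≠ S.insert r := by
          rintro rfl
          exact hT (Or.inl rfl)
        simp [innerProd, vec, Finsupp.single_apply, hne]
  have hadd : ∀ a b c : Wedge k, innerProd k (a + b) c = innerProd k a c + innerProd k b c := by
    intro a b c
    exact Finsupp.sum_add_index' (by simp) (by intros; ring)
  have hadd' : ∀ a b c : Wedge k, innerProd k a (b + c) = innerProd k a b + innerProd k a c := by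
    intro a b c
    simp [innerProd, mul_add, Finsupp.sum]
    rw [Finset.sum_add_distrib]
  have hsm : ∀ (t : k) (a b : Wedge k), innerProd k (t • a) b = t * innerProd k a b := by
    intro t a b
    unfold innerProd
    rw [Finsupp.sum_smul_index (by simp), Finsupp.mul_sum]
    simp [mul_assoc]
  have hsm' : ∀ (t : k) (a b : Wedge k), innerProd k a (t • b) = t * innerProd k a b := by
    intro t a b
    unfold innerProd
    rw [Finsupp.mul_sum]
    simp [mul_left_comm]
  have hs : ∀ (S : Maya) (c : k), (Finsupp.single S c : Wedge k) = c • vec k S := by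
    intro S c
    simp [vec]
  induction v using Finsupp.induction_linear with
  | zero => simp [innerProd]
  | add f g hf hg => rw [map_add, hadd, hadd, hf, hg]
  | single S c =>
    induction w using Finsupp.induction_linear with
    | zero => simp [innerProd]
    | add f g hf hg => rw [map_add, hadd', hadd', hf, hg]
    | single T d => rw [hs, hs, map_smul, map_smul, hsm, hsm, hsm', hsm', hb]

end Wedge

/-! ### Formal power series with scalar and operator coefficients -/

section Formal

variable {σ : Type*} {A : Type*} [Semiring A]

/-- The sum of a family of formal power series, computed coefficient by coefficient; meaningful for
families that are locally finite in the sense of `LocallyFinite`. -/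
noncomputable def formalSum {ι : Type*} (f : ι → MvPowerSeries σ A) : MvPowerSeries σ A :=
  fun m => ∑ᶠ i, MvPowerSeries.coeff m (f i)

/-- Every coefficient of `∑ f i` receives only finitely many nonzero contributions. -/
def LocallyFinite {ι : Type*} (f : ι → MvPowerSeries σ A) : Prop :=
  ∀ m, (Function.support fun i => MvPowerSeries.coeff m (f i)).Finite

/-- The exponential `∑_j F^j / j!` of a formal power series without constant term with coefficients
in a `k`-algebra. -/
noncomputable def formalExp (k : Type*) [Field k] [Algebra k A] (F : MvPowerSeries σ A) :
    MvPowerSeries σ A :=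
  formalSum fun j : ℕ => ((j.factorial : k)⁻¹) • F ^ j

theorem coeff_formalSum {ι : Type*} (f : ι → MvPowerSeries σ A) (m : σ →₀ ℕ) :
    MvPowerSeries.coeff m (formalSum f) = ∑ᶠ i, MvPowerSeries.coeff m (f i) := rfl

theorem coeff_ksmul {k : Type*} [Field k] [Algebra k A] (c : k) (F : MvPowerSeries σ A)
    (m : σ →₀ ℕ) : MvPowerSeries.coeff m (c • F) = c • MvPowerSeries.coeff m F := rfl

theorem summable_formalExp (k : Type*) [Field k] [Algebra k A] (F : MvPowerSeries σ A)
    (hF : MvPowerSeries.constantCoeff F = 0) :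
    LocallyFinite fun j : ℕ => ((j.factorial : k)⁻¹) • F ^ j := by
  intro m
  refine (Set.finite_Iic (Finsupp.degree m)).subset ?_
  intro j hj
  by_contra hlt
  apply hj
  have h1 := MvPowerSeries.le_order_pow_of_constantCoeff_eq_zero j hF
  change MvPowerSeries.coeff m (((j.factorial : k)⁻¹) • F ^ j) = 0
  rw [coeff_ksmul, MvPowerSeries.coeff_of_lt_order, smul_zero]
  refine lt_of_lt_of_le ?_ h1
  exact_mod_cast not_le.mp hlt

theorem constantCoeff_formalExp (k : Type*) [Field k] [Algebra k A] (F : MvPowerSeries σ A)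
    (hF : MvPowerSeries.constantCoeff F = 0) :
    MvPowerSeries.constantCoeff (formalExp k F) = 1 := by
  rw [← MvPowerSeries.coeff_zero_eq_constantCoeff_apply, formalExp, coeff_formalSum,
    finsum_eq_single _ 0]
  · simp [MvPowerSeries.coeff_zero_one]
  · intro j hj
    rw [coeff_ksmul, MvPowerSeries.coeff_zero_eq_constantCoeff_apply, map_pow, hF, zero_pow hj,
      smul_zero]

theorem isUnit_formalExp (k : Type*) [Field k] {A : Type*} [Ring A] [Algebra k A]
    (F : MvPowerSeries σ A) (hF : MvPowerSeries.constantCoeff F = 0) :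
    IsUnit (formalExp k F) := by
  rw [MvPowerSeries.isUnit_iff_constantCoeff, constantCoeff_formalExp k F hF]
  exact isUnit_one

end Formal

section Main

variable (k : Type*) [Field k]

/-- The ring `k[[x₀, x₁, …, y₀, y₁, …]]` of formal power series in the parameters. -/
abbrev Scalar : Type _ := MvPowerSeries (ℕ ⊕ ℕ) k

/-- Formal power series in the parameters whose coefficients are operators in the infinite wedge
space. -/
abbrev Operator : Type _ := MvPowerSeries (ℕ ⊕ ℕ) (Module.End k (Wedge k))

/-- The parameters `x₀, x₁, …`. -/
noncomputable def xvar (i : ℕ) : Scalar k := MvPowerSeries.X (Sum.inl i)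

/-- The parameters `y₀, y₁, …`. -/
noncomputable def yvar (i : ℕ) : Scalar k := MvPowerSeries.X (Sum.inr i)

variable {k}

/-! ### The Schur measure -/

/-- The Schur function `s_λ(z₀, z₁, …) = ∑_T ∏_{□ ∈ λ} z_{T(□)}`, the sum being over all
semistandard Young tableaux `T` of shape `λ`. -/
noncomputable def schur (z : ℕ → Scalar k) (lam : YoungDiagram) : Scalar k :=
  formalSum fun T : SemistandardYoungTableau lam => ∏ c ∈ lam.cells, z (T c.1 c.2)

/-- The set `𝔖(λ) = {λ_i - i + 1/2 : i = 1, 2, …}` (rows are counted from `0` in the code). -/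
def frakS (lam : YoungDiagram) : Set HalfInt :=
  {r | ∃ i : ℕ, r.1 = (lam.rowLen i : ℚ) - ((i : ℚ) + 1) + 1 / 2}

variable (k)

/-- `Z = ∑_λ s_λ(x) s_λ(y)`. -/
noncomputable def Z : Scalar k :=
  formalSum fun lam : YoungDiagram => schur (xvar k) lam * schur (yvar k) lam

/-- The weight `𝔐(λ) = Z⁻¹ s_λ(x) s_λ(y)` of a single partition. -/
noncomputable def weight (lam : YoungDiagram) : Scalar k :=
  (Z k)⁻¹ * (schur (xvar k) lam * schur (yvar k) lam)

/-- The Schur measure `𝔐(E) = ∑_{λ ∈ E} 𝔐(λ)` of a set of partitions. -/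
noncomputable def schurMeasure (E : Set YoungDiagram) : Scalar k :=
  formalSum fun lam : E => weight k lam.1

/-- The correlation function `ρ(X) = 𝔐({λ : X ⊂ 𝔖(λ)})`. -/
noncomputable def rho (X : Finset HalfInt) : Scalar k :=
  schurMeasure k {lam | (X : Set HalfInt) ⊆ frakS lam}

variable {k}

/-! ### Vertex operators and the kernel -/

/-- `n⁻¹ ∑_i z_i ^ n` for `n = 1, 2, …`. -/
noncomputable def miwa (z : ℕ → Scalar k) (n : ℕ+) : Scalar k :=
  formalSum fun i : ℕ => ((n : ℕ) : k)⁻¹ • z i ^ (n : ℕ)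

/-- The product `s · B` of a scalar power series `s` and an operator `B`. -/
noncomputable def scalarMul (s : Scalar k) (B : Module.End k (Wedge k)) : Operator k :=
  fun m => MvPowerSeries.coeff m s • B

/-- `∑_{n ≥ 1} s_n α_n`. -/
noncomputable def bosonPlus (s : ℕ+ → Scalar k) : Operator k :=
  formalSum fun n : ℕ+ => scalarMul (s n) (alpha k ((n : ℕ) : ℤ))

/-- `∑_{n ≥ 1} s_n α_{-n}`. -/
noncomputable def bosonMinus (s : ℕ+ → Scalar k) : Operator k :=
  formalSum fun n : ℕ+ => scalarMul (s n) (alpha k (-((n : ℕ) : ℤ)))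

/-- `Γ_+(s) = exp (∑_{n ≥ 1} s_n α_n)`. -/
noncomputable def GammaPlus (s : ℕ+ → Scalar k) : Operator k := formalExp k (bosonPlus s)

/-- `Γ_-(s) = exp (∑_{n ≥ 1} s_n α_{-n})`. -/
noncomputable def GammaMinus (s : ℕ+ → Scalar k) : Operator k := formalExp k (bosonMinus s)

variable (k)

/-- `t_n = n⁻¹ ∑_i x_i ^ n`. -/
noncomputable def tx : ℕ+ → Scalar k := miwa (xvar k)

/-- `t'_n = n⁻¹ ∑_i y_i ^ n`. -/
noncomputable def ty : ℕ+ → Scalar k := miwa (yvar k)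

/-- `G = Γ_+(t) Γ_-(t')⁻¹`.  Both `Γ_-(t')` and `G` are invertible, see `isUnit_GammaMinus_ty` and
`isUnit_G`, so that `Ring.inverse` is the inverse. -/
noncomputable def G : Operator k := GammaPlus (tx k) * Ring.inverse (GammaMinus (ty k))

/-- `Ψ_r = G ψ_r G⁻¹`. -/
noncomputable def Psi (r : HalfInt) : Operator k :=
  G k * MvPowerSeries.C (psi k r) * Ring.inverse (G k)

/-- `Ψ*_r = G ψ*_r G⁻¹`. -/
noncomputable def PsiStar (r : HalfInt) : Operator k :=
  G k * MvPowerSeries.C (psiStar k r) * Ring.inverse (G k)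

variable {k}

/-- The matrix element `(F v, w)`, a formal power series in the parameters. -/
noncomputable def matrixElement (F : Operator k) (v w : Wedge k) : Scalar k :=
  fun m => innerProd k (MvPowerSeries.coeff m F v) w

variable (k)

/-- The kernel `K(a, b) = (Ψ_a Ψ*_b v_∅, v_∅)`. -/
noncomputable def K (a b : HalfInt) : Scalar k :=
  matrixElement (Psi k a * PsiStar k b) (vec k Maya.vac) (vec k Maya.vac)

/-! ### The infinite sums and inverses above are meaningful -/

variable {k}

open Classical in
theorem prod_X (e : ℕ → ℕ ⊕ ℕ) (lam : YoungDiagram) (f : ℕ × ℕ → ℕ) :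
    ∏ c ∈ lam.cells, (MvPowerSeries.X (e (f c)) : Scalar k) =
      MvPowerSeries.monomial (∑ c ∈ lam.cells, Finsupp.single (e (f c)) 1) 1 := by
  simp only [MvPowerSeries.X_def]
  rw [MvPowerSeries.prod_monomial]
  simp

theorem summable_schur (e : ℕ → ℕ ⊕ ℕ) (he : Function.Injective e) (lam : YoungDiagram) :
    LocallyFinite fun T : SemistandardYoungTableau lam =>
      ∏ c ∈ lam.cells, (MvPowerSeries.X (e (T c.1 c.2)) : Scalar k) := by
  intro m
  have hfin : (Set.pi Set.univ fun _ : lam.cells => e ⁻¹' (m.support : Set (ℕ ⊕ ℕ))).Finite :=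
    Set.Finite.pi fun _ => (Finset.finite_toSet _).preimage he.injOn
  refine (hfin.preimage (f := fun (T : SemistandardYoungTableau lam) (c : lam.cells) =>
    T c.1.1 c.1.2) ?_).subset ?_
  · intro T _ T' _ h
    ext i j
    by_cases hc : (i, j) ∈ lam
    · exact congrFun h ⟨(i, j), hc⟩
    · rw [T.zeros hc, T'.zeros hc]
  · intro T hT c _
    rw [Function.mem_support] at hT
    beta_reduce at hT
    rw [prod_X e lam fun c => T c.1 c.2, MvPowerSeries.coeff_monomial] at hT
    split_ifs at hT with h
    · simp only [Set.mem_preimage, Finset.mem_coe, Finsupp.mem_support_iff]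
      rw [h, Finsupp.finsetSum_apply]
      refine (Finset.sum_pos' (fun _ _ => Nat.zero_le _) ⟨c.1, c.2, ?_⟩).ne'
      simp
    · exact absurd rfl hT

theorem coeff_schur (e : ℕ → ℕ ⊕ ℕ) (lam : YoungDiagram) (m : ℕ ⊕ ℕ →₀ ℕ)
    (hm : MvPowerSeries.coeff m (schur (fun i => (MvPowerSeries.X (e i) : Scalar k)) lam) ≠ 0) :
    m.degree = lam.card := by
  by_contra hne
  apply hm
  rw [schur, coeff_formalSum]
  apply finsum_eq_zero_of_forall_eq_zero
  intro T
  rw [prod_X e lam fun c => T c.1 c.2, MvPowerSeries.coeff_monomial, if_neg]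
  rintro rfl
  apply hne
  simp [map_sum, YoungDiagram.card]

theorem finite_card_le (N : ℕ) : {lam : YoungDiagram | lam.card ≤ N}.Finite := by
  have hinj : Function.Injective YoungDiagram.cells := fun a b h => YoungDiagram.ext h
  refine ((Finset.finite_toSet (Finset.range N ×ˢ Finset.range N).powerset).preimage
    hinj.injOn).subset ?_
  intro lam hlam
  simp only [Set.mem_preimage, Finset.coe_powerset, Set.mem_powerset_iff, Set.mem_ofPred_eq, Finset.coe_subset] at hlam ⊢
  rintro ⟨i, j⟩ hc
  have h1 : (Finset.range (i + 1)).card ≤ lam.card :=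
    Finset.card_le_card_of_injOn (fun a => (a, 0))
      (fun a ha => lam.up_left_mem (by simpa [Nat.lt_succ_iff] using ha) (Nat.zero_le _) hc)
      (fun a _ b _ h => by simpa using h)
  have h2 : (Finset.range (j + 1)).card ≤ lam.card :=
    Finset.card_le_card_of_injOn (fun a => (0, a))
      (fun a ha => lam.up_left_mem (Nat.zero_le _) (by simpa [Nat.lt_succ_iff] using ha) hc)
      (fun a _ b _ h => by simpa using h)
  simp only [Finset.card_range] at h1 h2
  simp only [Finset.mem_product, Finset.mem_range]
  omega

theorem coeff_mul_schur (F : Scalar k) (lam : YoungDiagram) (m : ℕ ⊕ ℕ →₀ ℕ)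
    (hm : MvPowerSeries.coeff m (F * (schur (xvar k) lam * schur (yvar k) lam)) ≠ 0) :
    lam.card ≤ m.degree := by
  by_contra hlt
  apply hm
  rw [MvPowerSeries.coeff_mul]
  refine Finset.sum_eq_zero fun p hp => ?_
  rw [MvPowerSeries.coeff_mul, Finset.sum_eq_zero fun q hq => ?_, mul_zero]
  by_contra hne
  have h1 := coeff_schur Sum.inl lam q.1 (left_ne_zero_of_mul hne)
  rw [Finset.HasAntidiagonal.mem_antidiagonal] at hp hq
  have h2 : m.degree = p.1.degree + (q.1.degree + q.2.degree) := by
    rw [← hp, ← hq, map_add, map_add]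
  omega

/-- The sum defining `Z` is locally finite. -/
theorem summable_Z :
    LocallyFinite fun lam : YoungDiagram => schur (xvar k) lam * schur (yvar k) lam := by
  intro m
  refine (finite_card_le m.degree).subset fun lam h => coeff_mul_schur (k := k) 1 lam m ?_
  rwa [one_mul]

/-- The sum defining the measure of any set of partitions is locally finite. -/
theorem summable_schurMeasure (E : Set YoungDiagram) : LocallyFinite fun lam : E => weight k lam.1 := by
  intro m
  refine ((finite_card_le m.degree).preimage Subtype.val_injective.injOn).subset fun lam h => ?_
  exact coeff_mul_schur (Z k)⁻¹ lam.1 m h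

theorem schur_bot (e : ℕ → ℕ ⊕ ℕ) :
    schur (fun i => (MvPowerSeries.X (e i) : Scalar k)) ⊥ = 1 := by
  have huniq : ∀ T : SemistandardYoungTableau (⊥ : YoungDiagram), T = default := by
    intro T
    ext i j
    rw [T.zeros (YoungDiagram.notMem_bot _), SemistandardYoungTableau.zeros _
      (YoungDiagram.notMem_bot _)]
  ext m
  rw [schur, coeff_formalSum, finsum_eq_single _ default fun T hT => absurd (huniq T) hT]
  simp

/-- `Z` has constant term `1`, hence it is invertible. -/
theorem constantCoeff_Z : MvPowerSeries.constantCoeff (Z k) = 1 := by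
  rw [← MvPowerSeries.coeff_zero_eq_constantCoeff_apply, Z, coeff_formalSum,
    finsum_eq_single _ ⊥]
  · have h1 : schur (xvar k) ⊥ = 1 := schur_bot Sum.inl
    have h2 : schur (yvar k) ⊥ = 1 := schur_bot Sum.inr
    rw [h1, h2]
    simp
  · intro lam hlam
    by_contra hne
    rw [← one_mul (_ * _)] at hne
    have h := coeff_mul_schur 1 lam 0 hne
    rw [map_zero, Nat.le_zero, YoungDiagram.card, Finset.card_eq_zero] at h
    exact hlam (YoungDiagram.ext (by simpa using h))

theorem coeff_miwa_term (e : ℕ → ℕ ⊕ ℕ) (n : ℕ+) (i : ℕ) (m : ℕ ⊕ ℕ →₀ ℕ)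
    (hm : MvPowerSeries.coeff m
      (((n : ℕ) : k)⁻¹ • (MvPowerSeries.X (e i) : Scalar k) ^ (n : ℕ)) ≠ 0) :
    m = Finsupp.single (e i) (n : ℕ) := by
  rw [coeff_ksmul, MvPowerSeries.coeff_X_pow] at hm
  by_contra h
  simp [h] at hm

theorem summable_miwa (e : ℕ → ℕ ⊕ ℕ) (he : Function.Injective e) (n : ℕ+) :
    LocallyFinite fun i : ℕ => ((n : ℕ) : k)⁻¹ • (MvPowerSeries.X (e i) : Scalar k) ^ (n : ℕ) := by
  intro m
  refine ((Finset.finite_toSet m.support).preimage he.injOn).subset fun i hi => ?_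
  have h := coeff_miwa_term e n i m hi
  rw [Set.mem_preimage, Finset.mem_coe, h, Finsupp.mem_support_iff]
  simp

theorem coeff_miwa (e : ℕ → ℕ ⊕ ℕ) (n : ℕ+) (m : ℕ ⊕ ℕ →₀ ℕ)
    (hm : MvPowerSeries.coeff m
      (miwa (fun i => (MvPowerSeries.X (e i) : Scalar k)) n) ≠ 0) : m.degree = n := by
  rw [miwa, coeff_formalSum] at hm
  obtain ⟨i, hi⟩ : ∃ i : ℕ, MvPowerSeries.coeff m
      (((n : ℕ) : k)⁻¹ • (MvPowerSeries.X (e i) : Scalar k) ^ (n : ℕ)) ≠ 0 := by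
    by_contra h
    push Not at h
    exact hm (finsum_eq_zero_of_forall_eq_zero h)
  rw [coeff_miwa_term e n i m hi]
  simp

/-- The sums `∑ t_n α_{±n}` and `∑ t'_n α_{±n}` are locally finite. -/
theorem summable_boson (e : ℕ → ℕ ⊕ ℕ) (B : ℕ+ → Module.End k (Wedge k)) :
    LocallyFinite fun n : ℕ+ =>
      scalarMul (miwa (fun i => (MvPowerSeries.X (e i) : Scalar k)) n) (B n) := by
  intro m
  refine ((Set.finite_singleton m.degree).preimage PNat.coe_injective.injOn).subset fun n hn => ?_
  refine (coeff_miwa (k := k) e n m fun h => hn ?_).symm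
  change MvPowerSeries.coeff m (miwa (fun i => (MvPowerSeries.X (e i) : Scalar k)) n) • B n = 0
  rw [h, zero_smul]

theorem constantCoeff_boson (e : ℕ → ℕ ⊕ ℕ) (B : ℕ+ → Module.End k (Wedge k)) :
    MvPowerSeries.constantCoeff (formalSum fun n : ℕ+ =>
      scalarMul (miwa (fun i => (MvPowerSeries.X (e i) : Scalar k)) n) (B n)) = 0 := by
  rw [← MvPowerSeries.coeff_zero_eq_constantCoeff_apply, coeff_formalSum]
  apply finsum_eq_zero_of_forall_eq_zero
  intro n
  change MvPowerSeries.coeff 0 (miwa (fun i => (MvPowerSeries.X (e i) : Scalar k)) n) • B n = 0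
  by_cases h : MvPowerSeries.coeff 0 (miwa (fun i => (MvPowerSeries.X (e i) : Scalar k)) n) = 0
  · rw [h, zero_smul]
  · have := coeff_miwa e n 0 h
    rw [map_zero] at this
    exact absurd this.symm n.ne_zero

theorem isUnit_formalExp_operator (F : Operator k) (hF : MvPowerSeries.constantCoeff F = 0) :
    IsUnit (formalExp k F) :=
  isUnit_formalExp k F hF

theorem isUnit_GammaPlus_tx : IsUnit (GammaPlus (tx k)) := by
  have h : MvPowerSeries.constantCoeff (bosonPlus (tx k)) = 0 :=
    constantCoeff_boson Sum.inl fun n : ℕ+ => alpha k (((n : ℕ) : ℤ))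
  exact isUnit_formalExp_operator _ h

theorem isUnit_GammaMinus_ty : IsUnit (GammaMinus (ty k)) := by
  have h : MvPowerSeries.constantCoeff (bosonMinus (ty k)) = 0 :=
    constantCoeff_boson Sum.inr fun n : ℕ+ => alpha k (-((n : ℕ) : ℤ))
  exact isUnit_formalExp_operator _ h

theorem isUnit_G : IsUnit (G k) :=
  isUnit_GammaPlus_tx.mul isUnit_GammaMinus_ty.ringInverse

end Main

end SchurMeasure

/-!
The proof follows the boson-fermion correspondence.

The coefficients of `Γ_+` in one variable are the operators `h_j^⊥`. They satisfy
`h_j^⊥ ψ_r = ∑_i ψ_{r - i} h_{j - i}^⊥`, from which one reads off the Pieri rule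
(`removeStrip_vec_rowMaya`): they remove horizontal strips. Since semistandard tableaux satisfy the
same branching rule, the matrix elements of `Γ_+` between `v_λ` and the vacuum are the Schur
functions (`coeff_schur_eq_vertex`), and those of the adjoint `Γ_-` are too. By conservation of
charge no other basis vector contributes, so `Z = (Γ_+ Γ_- v_∅, v_∅)`, and inserting the projection
`∏ ψ_x ψ*_x` onto the span of the `v_S` with `X ⊂ S` gives `Z ρ(X)` (`vev_projection`).

The operators `Γ_±` commute up to a scalar factor, `Γ_+` fixes the vacuum, and the vacuum is a fixed
vector of the transpose of `Γ_-`. Hence `Z ρ(X) = Z (G ∏ ψ_x ψ*_x G⁻¹ v_∅, v_∅)` (`vev_conj_G`),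
that is, `ρ(X) = (∏ Ψ_x Ψ*_x v_∅, v_∅)`.

The commutator of `α_n` with `ψ_r` is `ψ_{r - n}`, and the one with `ψ*_r` is `-ψ*_{r + n}`, so the
coefficients of `Ψ_r` are combinations of the `ψ_s`, and those of `Ψ*_r` of the `ψ*_s`
(`coeff_Psi_mem`, `coeff_PsiStar_mem`). Such combinations anticommute up to scalars and split into
creation and annihilation operators; Wick's theorem (`wick`) then yields the determinant.

Identities between exponentials of operators are obtained without the Baker-Campbell-Hausdorff
formula: `e ^ F * B = (B + [F, B]) * e ^ F` for a central commutator (`formalExp_mul_of_commutator`)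
follows from the chain rule for derivations, and the coefficients of the vertex operators from
Newton's recursion (`smul_coeff_vertex`). That commutators of the `α_n` are scalars follows from
the irreducibility of the wedge space under the fermions (`exists_scalar_of_commute`).
-/

namespace SchurMeasure

/-! ### Half-integers and semi-infinite sets -/

/-- The half-integer `n + 1/2`; this is an order isomorphism of `ℤ` onto `HalfInt`. -/
def hi (n : ℤ) : HalfInt := ⟨(n : ℚ) + 1 / 2, n, rfl⟩

theorem hi_surjective (r : HalfInt) : ∃ n, r = hi n := by
  obtain ⟨q, n, rfl⟩ := r
  exact ⟨n, rfl⟩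

theorem hi_lt {m n : ℤ} : hi m < hi n ↔ m < n := by
  rw [← Subtype.coe_lt_coe]
  simp [hi]

theorem hi_inj {m n : ℤ} : hi m = hi n ↔ m = n := by
  rw [Subtype.ext_iff]
  simp [hi]

theorem shift_hi (m n : ℤ) : (hi m).shift n = hi (m + n) := by
  apply Subtype.ext
  simp only [HalfInt.shift, hi]
  push_cast
  ring

theorem hi_mem_negHalf {n : ℤ} : hi n ∈ negHalf ↔ n < 0 := by
  change (n : ℚ) + 1 / 2 < 0 ↔ n < 0
  constructor
  · intro h
    have : (n : ℚ) < 0 := by linarith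
    exact_mod_cast this
  · intro h
    have : (n : ℚ) ≤ ((-1 : ℤ) : ℚ) := Int.cast_le.mpr (by omega)
    push_cast at this
    linarith

theorem shift_shift (r : HalfInt) (m n : ℤ) : (r.shift m).shift n = r.shift (m + n) := by
  obtain ⟨a, rfl⟩ := hi_surjective r
  rw [shift_hi, shift_hi, shift_hi, add_assoc]

theorem shift_zero (r : HalfInt) : r.shift 0 = r := by
  obtain ⟨a, rfl⟩ := hi_surjective r
  rw [shift_hi, add_zero]

/-- Translation by `n`, as a permutation of the half-integers. -/
def shiftEquiv (n : ℤ) : HalfInt ≃ HalfInt where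
  toFun r := r.shift n
  invFun r := r.shift (-n)
  left_inv r := by simp only [shift_shift, add_neg_cancel, shift_zero]
  right_inv r := by simp only [shift_shift, neg_add_cancel, shift_zero]

namespace Maya

theorem mem_insert {S : Maya} {r s : HalfInt} : s ∈ (S.insert r).1 ↔ s = r ∨ s ∈ S.1 := Iff.rfl

theorem mem_erase {S : Maya} {r s : HalfInt} : s ∈ (S.erase r).1 ↔ s ∈ S.1 ∧ s ≠ r := Iff.rfl

theorem ext' {S T : Maya} (h : ∀ s, s ∈ S.1 ↔ s ∈ T.1) : S = T := Subtype.ext (Set.ext h)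

theorem insert_erase {S : Maya} {r : HalfInt} (h : r ∈ S.1) : (S.erase r).insert r = S := by
  refine ext' fun s => ?_
  rw [mem_insert, mem_erase]
  by_cases hs : s = r <;> simp [hs, h]

theorem erase_insert {S : Maya} {r : HalfInt} (h : r ∉ S.1) : (S.insert r).erase r = S := by
  refine ext' fun s => ?_
  rw [mem_erase, mem_insert]
  by_cases hs : s = r <;> simp [hs, h]

theorem insert_comm (S : Maya) (r s : HalfInt) :
    (S.insert r).insert s = (S.insert s).insert r :=
  ext' fun t => by simp only [mem_insert]; tauto

theorem erase_insert_comm (S : Maya) {r s : HalfInt} (h : r ≠ s) :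
    (S.erase s).insert r = (S.insert r).erase s := by
  refine ext' fun t => ?_
  simp only [mem_insert, mem_erase]
  by_cases ht : t = r
  · simp [ht, h]
  · simp [ht]

theorem above_insert {S : Maya} {r : HalfInt} (h : r ∉ S.1) (s : HalfInt) :
    (S.insert r).above s = S.above s + if s < r then 1 else 0 := by
  unfold above
  split_ifs with hs
  · rw [← Set.ncard_insert_of_notMem (a := r) (fun h' => h h'.1) (S.finite_above s)]
    congr 1
    ext t
    simp only [mem_insert, Set.mem_insert_iff, Set.mem_ofPred_eq]
    by_cases ht : t = r <;> simp [ht, hs]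
  · congr 1
    ext t
    simp only [mem_insert, Set.mem_ofPred_eq]
    by_cases ht : t = r
    · simp [ht, hs]
    · simp [ht]

theorem above_eq_erase {S : Maya} {r : HalfInt} (h : r ∈ S.1) (s : HalfInt) :
    S.above s = (S.erase r).above s + if s < r then 1 else 0 := by
  have := above_insert (S := S.erase r) (r := r) (fun h' => (mem_erase.1 h').2 rfl) s
  rwa [insert_erase h] at this

end Maya

/-- The ring structure on the operators, with the semiring structure of `Module.End` as its literal
first component, so that unification recognizes it. -/
noncomputable instance instRingEndWedge (k : Type*) [Field k] : Ring (Module.End k (Wedge k)) :=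
  { (inferInstance : Semiring (Module.End k (Wedge k))) with
    neg := fun A => -A
    sub := fun A B => A - B
    sub_eq_add_neg := fun A B => sub_eq_add_neg A B
    neg_add_cancel := fun A => neg_add_cancel A
    intCast := fun n => n • 1
    intCast_ofNat := fun n => by rw [natCast_zsmul, nsmul_one]
    intCast_negSucc := fun n => by rw [negSucc_zsmul, nsmul_one]
    zsmul := fun n A => n • A
    zsmul_zero' := fun A => zero_smul ℤ A
    zsmul_succ' := fun n A => SubNegMonoid.zsmul_succ' n A
    zsmul_neg' := fun n A => SubNegMonoid.zsmul_neg' n A }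

/-! ### The canonical anticommutation relations -/

section Fermions

variable {k : Type*} [Field k]

theorem psi_vec_of_mem {r : HalfInt} {S : Maya} (h : r ∈ S.1) : psi k r (vec k S) = 0 := by
  rw [psi_vec, if_pos h]

theorem psi_vec_of_notMem {r : HalfInt} {S : Maya} (h : r ∉ S.1) :
    psi k r (vec k S) = (-1 : k) ^ S.above r • vec k (S.insert r) := by
  rw [psi_vec, if_neg h]

theorem psiStar_vec_of_mem {r : HalfInt} {S : Maya} (h : r ∈ S.1) :
    psiStar k r (vec k S) = (-1 : k) ^ S.above r • vec k (S.erase r) := by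
  rw [psiStar_vec, if_pos h]

theorem psiStar_vec_of_notMem {r : HalfInt} {S : Maya} (h : r ∉ S.1) :
    psiStar k r (vec k S) = 0 := by
  rw [psiStar_vec, if_neg h]

theorem end_ext {A B : Module.End k (Wedge k)} (h : ∀ S, A (vec k S) = B (vec k S)) : A = B := by
  refine Finsupp.lhom_ext' fun S => LinearMap.ext_ring ?_
  exact h S

theorem neg_one_pow_mul_self (n : ℕ) : (-1 : k) ^ n * (-1 : k) ^ n = 1 := by
  rw [← mul_pow]; simp

open Classical in
theorem psi_psiStar_vec (r : HalfInt) (S : Maya) :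
    psi k r (psiStar k r (vec k S)) = if r ∈ S.1 then vec k S else 0 := by
  split_ifs with h
  · rw [psiStar_vec_of_mem h, map_smul, psi_vec_of_notMem (fun h1 => (Maya.mem_erase.1 h1).2 rfl),
      smul_smul,
      Maya.insert_erase h, Maya.above_eq_erase h r]
    simp [neg_one_pow_mul_self]
  · rw [psiStar_vec_of_notMem h, map_zero]

open Classical in
theorem psiStar_psi_vec (r : HalfInt) (S : Maya) :
    psiStar k r (psi k r (vec k S)) = if r ∈ S.1 then 0 else vec k S := by
  split_ifs with h
  · rw [psi_vec_of_mem h, map_zero]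
  · rw [psi_vec_of_notMem h, map_smul, psiStar_vec_of_mem (Or.inl rfl), smul_smul,
      Maya.erase_insert h, Maya.above_insert h r]
    simp [neg_one_pow_mul_self]

theorem psi_mul_psi (r s : HalfInt) : psi k r * psi k s + psi k s * psi k r = 0 := by
  refine end_ext fun S => ?_
  simp only [LinearMap.add_apply, Module.End.mul_apply, LinearMap.zero_apply]
  by_cases hr : r ∈ S.1
  · rw [psi_vec_of_mem hr, map_zero, add_zero]
    by_cases hs : s ∈ S.1
    · rw [psi_vec_of_mem hs, map_zero]
    · rw [psi_vec_of_notMem hs, map_smul, psi_vec_of_mem (Or.inr hr), smul_zero]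
  by_cases hs : s ∈ S.1
  · rw [psi_vec_of_mem hs, map_zero, zero_add, psi_vec_of_notMem hr, map_smul,
      psi_vec_of_mem (Or.inr hs), smul_zero]
  rw [psi_vec_of_notMem hs, psi_vec_of_notMem hr, map_smul, map_smul]
  rcases eq_or_ne r s with rfl | hne
  · rw [psi_vec_of_mem (Or.inl rfl), smul_zero, add_zero]
  have h1 : r ∉ (S.insert s).1 := by rw [Maya.mem_insert]; tauto
  have h2 : s ∉ (S.insert r).1 := by rw [Maya.mem_insert]; tauto
  rw [psi_vec_of_notMem h1, psi_vec_of_notMem h2, Maya.insert_comm S r s, smul_smul, smul_smul,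
    ← add_smul, Maya.above_insert hs, Maya.above_insert hr]
  rcases lt_or_gt_of_ne hne with h | h
  · rw [if_pos h, if_neg (not_lt_of_gt h)]
    convert zero_smul k _
    ring
  · rw [if_pos h, if_neg (not_lt_of_gt h)]
    convert zero_smul k _
    ring

theorem psi_mul_psiStar_of_ne {r s : HalfInt} (hne : r ≠ s) :
    psi k r * psiStar k s + psiStar k s * psi k r = 0 := by
  refine end_ext fun S => ?_
  simp only [LinearMap.add_apply, Module.End.mul_apply, LinearMap.zero_apply]
  by_cases hs : s ∈ S.1
  · rw [psiStar_vec_of_mem hs, map_smul]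
    by_cases hr : r ∈ S.1
    · rw [psi_vec_of_mem hr, map_zero, psi_vec_of_mem (Maya.mem_erase.2 ⟨hr, hne⟩), smul_zero,
        add_zero]
    · have h1 : r ∉ (S.erase s).1 := fun h => hr h.1
      rw [psi_vec_of_notMem hr, map_smul, psi_vec_of_notMem h1, psiStar_vec_of_mem (Or.inr hs),
        smul_smul, smul_smul, Maya.erase_insert_comm S hne, ← add_smul, Maya.above_insert hr s,
        Maya.above_eq_erase hs r]
      rcases lt_or_gt_of_ne hne with h | h
      · rw [if_pos h, if_neg (not_lt_of_gt h)]
        convert zero_smul k _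
        ring
      · rw [if_pos h, if_neg (not_lt_of_gt h)]
        convert zero_smul k _
        ring
  · rw [psiStar_vec_of_notMem hs, map_zero, zero_add]
    by_cases hr : r ∈ S.1
    · rw [psi_vec_of_mem hr, map_zero]
    · rw [psi_vec_of_notMem hr, map_smul, psiStar_vec_of_notMem, smul_zero]
      rw [Maya.mem_insert]
      tauto

theorem psi_mul_psiStar_self (r : HalfInt) :
    psi k r * psiStar k r + psiStar k r * psi k r = 1 := by
  classical
  refine end_ext fun S => ?_
  simp only [LinearMap.add_apply, Module.End.mul_apply, Module.End.one_apply]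
  rw [psi_psiStar_vec, psiStar_psi_vec]
  split_ifs <;> simp

/-! ### Adjoint operators -/

theorem innerProd_vec_left (S : Maya) (f : Wedge k) : innerProd k (vec k S) f = f S := by
  simp [innerProd, vec]

theorem innerProd_add_left (a b c : Wedge k) :
    innerProd k (a + b) c = innerProd k a c + innerProd k b c :=
  Finsupp.sum_add_index' (by simp) (by intros; ring)

theorem innerProd_smul_left (t : k) (a b : Wedge k) :
    innerProd k (t • a) b = t * innerProd k a b := by
  unfold innerProd
  rw [Finsupp.sum_smul_index (by simp), Finsupp.mul_sum]
  simp [mul_assoc]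

theorem innerProd_comm (a b : Wedge k) : innerProd k a b = innerProd k b a := by
  unfold innerProd
  rw [Finsupp.sum_of_support_subset a (Finset.subset_union_left (s₂ := b.support)) _ (by simp),
    Finsupp.sum_of_support_subset b (Finset.subset_union_right (s₁ := a.support)) _ (by simp)]
  exact Finset.sum_congr rfl fun _ _ => mul_comm _ _

theorem innerProd_vec_right (f : Wedge k) (S : Maya) : innerProd k f (vec k S) = f S := by
  rw [innerProd_comm, innerProd_vec_left]

/-- The inner product, as a linear map in the first variable. -/
noncomputable def innerLeft (w : Wedge k) : Wedge k →ₗ[k] k where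
  toFun v := innerProd k v w
  map_add' a b := innerProd_add_left a b w
  map_smul' t a := innerProd_smul_left t a w

theorem innerLeft_apply (v w : Wedge k) : innerLeft w v = innerProd k v w := rfl

/-- `B` is the adjoint of `A` with respect to the bilinear form of the wedge space. -/
def IsAdj (A B : Module.End k (Wedge k)) : Prop :=
  ∀ v w, innerProd k (A v) w = innerProd k v (B w)

namespace IsAdj

variable {A B C D : Module.End k (Wedge k)}

theorem symm (h : IsAdj A B) : IsAdj B A := fun v w => by
  rw [innerProd_comm, ← h, innerProd_comm]

theorem mul (h : IsAdj A B) (h' : IsAdj C D) : IsAdj (A * C) (D * B) := fun v w => by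
  rw [Module.End.mul_apply, Module.End.mul_apply, h, h']

theorem add (h : IsAdj A B) (h' : IsAdj C D) : IsAdj (A + C) (B + D) := fun v w => by
  rw [LinearMap.add_apply, LinearMap.add_apply, innerProd_add_left, h, h', innerProd_comm v,
    innerProd_comm v, innerProd_comm v, innerProd_add_left]

theorem smul (c : k) (h : IsAdj A B) : IsAdj (c • A) (c • B) := fun v w => by
  rw [LinearMap.smul_apply, LinearMap.smul_apply, innerProd_smul_left, h, innerProd_comm v,
    innerProd_comm v, innerProd_smul_left]

theorem sub (h : IsAdj A B) (h' : IsAdj C D) : IsAdj (A - C) (B - D) := by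
  have := h.add (h'.smul (-1))
  rwa [neg_one_smul k C, neg_one_smul k D, ← sub_eq_add_neg, ← sub_eq_add_neg] at this

theorem one : IsAdj (1 : Module.End k (Wedge k)) 1 := fun _ _ => rfl

theorem zero : IsAdj (0 : Module.End k (Wedge k)) 0 := by
  simpa using (one (k := k)).smul 0

theorem sum {ι : Type*} (s : Finset ι) {f g : ι → Module.End k (Wedge k)}
    (h : ∀ i ∈ s, IsAdj (f i) (g i)) : IsAdj (∑ i ∈ s, f i) (∑ i ∈ s, g i) := by
  classical
  induction s using Finset.induction_on with
  | empty => simpa using zero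
  | insert a s ha ih =>
    rw [Finset.sum_insert ha, Finset.sum_insert ha]
    exact (h a (Finset.mem_insert_self a s)).add
      (ih fun i hi' => h i (Finset.mem_insert_of_mem hi'))

theorem unique (h : IsAdj A B) (h' : IsAdj A C) : B = C := by
  refine LinearMap.ext fun w => Finsupp.ext fun S => ?_
  rw [← innerProd_vec_left, ← innerProd_vec_left, ← h, ← h']

end IsAdj

theorem isAdj_psi (r : HalfInt) : IsAdj (psi k r) (psiStar k r) := innerProd_psi_left r

/-! ### The bosonic operators -/

theorem wedge_induction {p : Wedge k → Prop} (f : Wedge k) (zero : p 0)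
    (add : ∀ a b, p a → p b → p (a + b)) (smul : ∀ (c : k) a, p a → p (c • a))
    (vec : ∀ S, p (vec k S)) : p f := by
  induction f using Finsupp.induction_linear with
  | zero => exact zero
  | add a b ha hb => exact add a b ha hb
  | single S c => simpa [SchurMeasure.vec] using smul c _ (vec S)

theorem finite_alpha_apply {n : ℤ} (hn : n ≠ 0) (f : Wedge k) :
    (Function.support fun r : HalfInt => psi k (r.shift (-n)) (psiStar k r f)).Finite := by
  induction f using wedge_induction with
  | zero => simp
  | add a b ha hb =>
    simp only [map_add]
    exact (ha.union hb).subset (Function.support_add _ _)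
  | smul c a ha =>
    simp only [map_smul]
    exact ha.subset (Function.support_const_smul_subset c _)
  | vec S => exact finite_alpha n hn S

theorem alpha_apply {n : ℤ} (hn : n ≠ 0) (f : Wedge k) :
    alpha k n f = ∑ᶠ r : HalfInt, psi k (r.shift (-n)) (psiStar k r f) := by
  induction f using wedge_induction with
  | zero => simp
  | add a b ha hb =>
    rw [map_add, ha, hb, ← finsum_add_distrib (finite_alpha_apply hn a) (finite_alpha_apply hn b)]
    simp only [map_add]
  | smul c a ha =>
    rw [map_smul, ha, smul_finsum' c (finite_alpha_apply hn a)]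
    simp only [map_smul]
  | vec S => simp [alpha, vec]

theorem isAdj_alpha {n : ℤ} (hn : n ≠ 0) : IsAdj (alpha k n) (alpha k (-n)) := by
  intro v w
  have hterm : ∀ r : HalfInt, innerProd k (psi k (r.shift (-n)) (psiStar k r v)) w =
      innerProd k v (psi k r (psiStar k (r.shift (-n)) w)) := fun r =>
    (isAdj_psi (r.shift (-n))).mul (isAdj_psi r).symm v w
  rw [alpha_apply hn, alpha_apply (neg_ne_zero.2 hn), innerProd_comm v, ← innerLeft_apply,
    ← innerLeft_apply, map_finsum _ (finite_alpha_apply hn v),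
    map_finsum _ (finite_alpha_apply (neg_ne_zero.2 hn) w)]
  simp only [innerLeft_apply, hterm]
  refine finsum_eq_of_bijective (shiftEquiv (-n)) (shiftEquiv (-n)).bijective fun r => ?_
  rw [innerProd_comm]
  simp only [shiftEquiv, Equiv.coe_fn_mk, shift_shift, neg_neg, neg_add_cancel, shift_zero]

/-- `[α_n, ψ_r] = ψ_{r - n}`. -/
theorem alpha_mul_psi {n : ℤ} (hn : n ≠ 0) (r : HalfInt) :
    alpha k n * psi k r = psi k r * alpha k n + psi k (r.shift (-n)) := by
  classical
  refine LinearMap.ext fun f => ?_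
  simp only [LinearMap.add_apply, Module.End.mul_apply]
  have hfin : (Function.support fun s : HalfInt =>
      if s = r then psi k (r.shift (-n)) f else 0).Finite :=
    (Set.finite_singleton r).subset fun s hs => by
      by_contra h
      exact hs (if_neg h)
  have hsingle : ∑ᶠ s : HalfInt, (if s = r then psi k (r.shift (-n)) f else 0) =
      psi k (r.shift (-n)) f := by
    rw [finsum_eq_single _ r fun s hs => if_neg hs, if_pos rfl]
  rw [alpha_apply hn, alpha_apply hn, map_finsum _ (finite_alpha_apply hn f),
    ← hsingle, ← finsum_add_distrib _ hfin]
  · refine finsum_congr fun s => ?_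
    have h1 : ∀ g, psi k (s.shift (-n)) (psi k r g) = - psi k r (psi k (s.shift (-n)) g) :=
      fun g => eq_neg_of_add_eq_zero_left (LinearMap.congr_fun (psi_mul_psi (s.shift (-n)) r) g)
    split_ifs with hs
    · subst hs
      have h2 : psiStar k s (psi k s f) = f - psi k s (psiStar k s f) :=
        eq_sub_of_add_eq' (LinearMap.congr_fun (psi_mul_psiStar_self s) f)
      rw [h2, map_sub, h1, sub_neg_eq_add, add_comm]
    · have h2 : psiStar k s (psi k r f) = - psi k r (psiStar k s f) :=
        eq_neg_of_add_eq_zero_right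
          (LinearMap.congr_fun (psi_mul_psiStar_of_ne (Ne.symm hs)) f)
      rw [h2, map_neg, h1, neg_neg, add_zero]
  · exact (finite_alpha_apply hn f).subset fun s hs h => hs (by simp only [h, map_zero])

/-- `[α_n, ψ*_r] = -ψ*_{r + n}`. -/
theorem alpha_mul_psiStar {n : ℤ} (hn : n ≠ 0) (r : HalfInt) :
    alpha k n * psiStar k r = psiStar k r * alpha k n - psiStar k (r.shift n) := by
  have h1 : IsAdj (alpha k (-n)) (alpha k n) := (isAdj_alpha hn).symm
  have h := (h1.mul (isAdj_psi r)).sub ((isAdj_psi r).mul h1)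
  have h2 : alpha k (-n) * psi k r - psi k r * alpha k (-n) = psi k (r.shift n) := by
    rw [alpha_mul_psi (neg_ne_zero.2 hn), neg_neg]; abel
  rw [h2] at h
  rw [← (h.unique (isAdj_psi _))]
  abel

/-- The vacuum of charge `-c`: the set of half-integers smaller than `-c`. -/
def Maya.base (c : ℕ) : Maya :=
  ⟨{r | r.1 < -(c : ℚ)}, by
    refine Set.Finite.subset (Set.finite_empty) ?_
    rintro r ⟨h, h'⟩
    exact h' (show r.1 < 0 from lt_of_lt_of_le h (neg_nonpos.2 (Nat.cast_nonneg c))), by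
    refine (HalfInt.finite_Ico (-(c : ℚ)) 0).subset ?_
    rintro r ⟨h, h'⟩
    exact ⟨not_lt.1 h', h⟩⟩

theorem Maya.hi_mem_base {c : ℕ} {n : ℤ} : hi n ∈ (Maya.base c).1 ↔ n < -(c : ℤ) := by
  have : hi n ∈ (Maya.base c).1 ↔ hi (n + c) ∈ negHalf := by
    change (n : ℚ) + 1 / 2 < -(c : ℚ) ↔ ((n + c : ℤ) : ℚ) + 1 / 2 < 0
    push_cast
    constructor <;> intro h <;> linarith
  rw [this, hi_mem_negHalf]
  omega

theorem Maya.base_zero : Maya.base 0 = Maya.vac := by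
  refine Maya.ext' fun r => ?_
  obtain ⟨n, rfl⟩ := hi_surjective r
  rw [Maya.hi_mem_base]
  exact (by simp : n < -((0 : ℕ) : ℤ) ↔ n < 0).trans hi_mem_negHalf.symm

theorem alpha_base {n : ℤ} (hn : 0 < n) (c : ℕ) : alpha k n (vec k (Maya.base c)) = 0 := by
  rw [alpha_apply hn.ne']
  refine finsum_eq_zero_of_forall_eq_zero fun r => ?_
  obtain ⟨m, rfl⟩ := hi_surjective r
  by_cases h : hi m ∈ (Maya.base c).1
  · rw [psiStar_vec_of_mem h, map_smul, shift_hi, psi_vec_of_mem, smul_zero]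
    rw [Maya.mem_erase, Ne, hi_inj, Maya.hi_mem_base]
    rw [Maya.hi_mem_base] at h
    omega
  · rw [psiStar_vec_of_notMem h, map_zero]

theorem alpha_vac {n : ℤ} (hn : 0 < n) : alpha k n (vec k Maya.vac) = 0 := by
  rw [← Maya.base_zero]
  exact alpha_base hn 0

/-! ### Operators commuting with all fermions -/

theorem mul_psi_psiStar_comm {T : Module.End k (Wedge k)}
    (h1 : ∀ r, T * psi k r = psi k r * T) (h2 : ∀ r, T * psiStar k r = psiStar k r * T)
    (r : HalfInt) (f : Wedge k) : T (psi k r (psiStar k r f)) = psi k r (psiStar k r (T f)) := by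
  have e1 := LinearMap.congr_fun (h1 r) (psiStar k r f)
  have e2 := LinearMap.congr_fun (h2 r) f
  simp only [Module.End.mul_apply] at e1 e2
  rw [e1, e2]

theorem psi_psiStar_apply (r : HalfInt) (f : Wedge k) (S : Maya) :
    (psi k r (psiStar k r f)) S = innerProd k f (psi k r (psiStar k r (vec k S))) := by
  rw [← innerProd_vec_right, ← Module.End.mul_apply, (isAdj_psi r).mul (isAdj_psi r).symm]
  rfl

/-- The Clifford algebra acts irreducibly, so an operator commuting with it is a scalar. -/
theorem exists_scalar_of_commute {T : Module.End k (Wedge k)}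
    (h1 : ∀ r, T * psi k r = psi k r * T) (h2 : ∀ r, T * psiStar k r = psiStar k r * T) :
    ∃ c : k, T = c • 1 := by
  classical
  have key : ∀ S T' : Maya, T' ≠ S → (T (vec k S)) T' = 0 := by
    intro S T' hne
    have hex : ∃ r, ¬ (r ∈ S.1 ↔ r ∈ T'.1) := by
      by_contra h
      push Not at h
      exact hne (Maya.ext' fun r => (h r).symm)
    obtain ⟨r, hr⟩ := hex
    -- The projection `ψ_r ψ*_r` commutes with `T` and separates `v_S` from `v_T'`.
    have h := congrArg (fun f : Wedge k => f T') (mul_psi_psiStar_comm h1 h2 r (vec k S))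
    simp only [psi_psiStar_apply] at h
    rw [psi_psiStar_vec, psi_psiStar_vec] at h
    by_cases hS : r ∈ S.1
    · have hT : r ∉ T'.1 := fun hT => hr (by simp [hS, hT])
      rw [if_pos hS, if_neg hT] at h
      rw [h, innerProd_comm]
      simp [innerProd]
    · have hT : r ∈ T'.1 := by
        by_contra hT
        exact hr (by simp [hS, hT])
      rw [if_neg hS, if_pos hT, innerProd_vec_right] at h
      rw [← h]
      simp
  -- hence every `v_S` is an eigenvector, and the eigenvalues agree for `S` and `S ∪ {r}`
  have hdiag : ∀ S, T (vec k S) = (T (vec k S)) S • vec k S := by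
    intro S
    refine Finsupp.ext fun T' => ?_
    by_cases h : T' = S
    · subst h; simp [vec]
    · rw [key S T' h]
      simp [vec, Ne.symm h]
  have hstep : ∀ (S : Maya) (r : HalfInt), r ∉ S.1 →
      (T (vec k (S.insert r))) (S.insert r) = (T (vec k S)) S := by
    intro S r hr
    have e := LinearMap.congr_fun (h1 r) (vec k S)
    simp only [Module.End.mul_apply] at e
    rw [hdiag S, map_smul, psi_vec_of_notMem hr, map_smul, hdiag (S.insert r)] at e
    have e' := congrArg (fun f : Wedge k => f (S.insert r)) e
    simp only [vec, Finsupp.smul_apply, Finsupp.single_eq_same, smul_eq_mul, mul_one] at e'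
    have hne : ((-1 : k) ^ S.above r) ≠ 0 := by simp
    exact mul_left_cancel₀ hne (e'.trans (mul_comm _ _))
  have hup : ∀ (F : Finset HalfInt) (S S' : Maya), (∀ r, r ∈ S'.1 ↔ r ∈ S.1 ∨ r ∈ F) →
      (T (vec k S')) S' = (T (vec k S)) S := by
    intro F
    induction F using Finset.induction_on with
    | empty =>
      intro S S' h
      rw [Maya.ext' (S := S') (T := S) fun r => by simp [h r]]
    | insert a F ha ih =>
      intro S S' h
      by_cases haS : a ∈ S.1
      · refine ih S S' fun r => ?_
        rw [h, Finset.mem_insert]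
        by_cases hra : r = a
        · simp [hra, haS]
        · simp [hra]
      · rw [ih (S.insert a) S' fun r => by rw [h, Finset.mem_insert, Maya.mem_insert]; tauto,
          hstep S a haS]
  refine ⟨(T (vec k Maya.vac)) Maya.vac, end_ext fun S => ?_⟩
  rw [hdiag S, LinearMap.smul_apply, Module.End.one_apply]
  congr 1
  -- compare both `S` and the vacuum with their union
  let U : Maya := ⟨S.1 ∪ Maya.vac.1, by
    rw [Set.union_sdiff_distrib]
    exact S.2.1.union Maya.vac.2.1, S.2.2.subset fun r hr => ⟨hr.1, fun h => hr.2 (Or.inl h)⟩⟩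
  have hU : ∀ r, r ∈ U.1 ↔ r ∈ S.1 ∨ r ∈ negHalf := fun r => Iff.rfl
  rw [← hup S.2.2.toFinset S U fun r => by
      rw [hU, Set.Finite.mem_toFinset, Set.mem_sdiff]; tauto,
    ← hup S.2.1.toFinset Maya.vac U fun r => by
      rw [hU, Set.Finite.mem_toFinset, Set.mem_sdiff]
      change _ ↔ r ∈ negHalf ∨ _
      tauto]

theorem commutator_mul_comm {R : Type*} [Ring R] {a b x p q w : R} (ha : a * x = x * a + p)
    (hb : b * x = x * b + q) (haq : a * q = q * a + w) (hbp : b * p = p * b + w) :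
    (a * b - b * a) * x = x * (a * b - b * a) := by
  rw [sub_mul, mul_assoc, mul_assoc, hb, ha, mul_add, mul_add, haq, hbp, ← mul_assoc, ← mul_assoc,
    ha, hb, add_mul, add_mul, mul_sub, mul_assoc, mul_assoc]
  abel

theorem neg_sub_mul_comm {R : Type*} [Ring R] {a b x : R} (h : (b - a) * x = x * (b - a)) :
    (a - b) * x = x * (a - b) := by
  rw [← neg_sub, neg_mul, h, mul_neg]

/-- The Heisenberg relation, up to the value of the scalar: the commutator of two bosonic operators
commutes with all fermions. -/
theorem exists_alpha_commutator {m n : ℤ} (hm : m ≠ 0) (hn : n ≠ 0) :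
    ∃ c : k, alpha k m * alpha k n - alpha k n * alpha k m = c • 1 := by
  have key : ∀ {m n : ℤ}, m ≠ 0 → n ≠ 0 → ∀ r,
      (alpha k m * alpha k n - alpha k n * alpha k m) * psi k r =
        psi k r * (alpha k m * alpha k n - alpha k n * alpha k m) := by
    intro m n hm hn r
    refine commutator_mul_comm (R := Module.End k (Wedge k)) (alpha_mul_psi hm r)
      (alpha_mul_psi hn r) (alpha_mul_psi hm _) ?_
    rw [alpha_mul_psi hn, shift_shift, shift_shift, add_comm (-m)]
  apply exists_scalar_of_commute (key hm hn)
  intro r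
  -- the relation with `ψ*_r` is the adjoint of the relation with `ψ_r` for `-m` and `-n`
  have h1 := isAdj_alpha (k := k) hm
  have h2 := isAdj_alpha (k := k) hn
  have h3 := ((h2.mul h1).sub (h1.mul h2))
  have h4 := h3.symm.mul (isAdj_psi r)
  have h5 := (isAdj_psi r).mul h3.symm
  rw [key (neg_ne_zero.2 hm) (neg_ne_zero.2 hn) r] at h4
  have h6 := (h4.unique h5)
  exact neg_sub_mul_comm (R := Module.End k (Wedge k)) h6.symm

theorem alpha_commute_pos {m n : ℤ} (hm : 0 < m) (hn : 0 < n) :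
    Commute (alpha k m) (alpha k n) := by
  obtain ⟨c, hc⟩ := exists_alpha_commutator (k := k) hm.ne' hn.ne'
  have h := LinearMap.congr_fun hc (vec k Maya.vac)
  simp only [LinearMap.sub_apply, Module.End.mul_apply, alpha_vac hm, alpha_vac hn, map_zero,
    sub_zero, LinearMap.smul_apply, Module.End.one_apply] at h
  -- both operators kill the vacuum, so the scalar commutator is zero
  have hc0 : c = 0 := by
    have := congrArg (fun f : Wedge k => f Maya.vac) h
    simpa [vec] using this.symm
  rw [hc0, zero_smul] at hc
  exact sub_eq_zero.1 hc

theorem alpha_commute_neg {m n : ℤ} (hm : m < 0) (hn : n < 0) :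
    Commute (alpha k m) (alpha k n) := by
  have h := (isAdj_alpha (k := k) (neg_ne_zero.2 hm.ne)).mul (isAdj_alpha (neg_ne_zero.2 hn.ne))
  have h' := (isAdj_alpha (k := k) (neg_ne_zero.2 hn.ne)).mul (isAdj_alpha (neg_ne_zero.2 hm.ne))
  rw [neg_neg, neg_neg] at h h'
  rw [(alpha_commute_pos (neg_pos.2 hm) (neg_pos.2 hn)).eq] at h
  exact h'.unique h

end Fermions

/-! ### Local derivations and the formal exponential -/

section Exponential

open MvPowerSeries

variable {σ k A : Type*} [Field k] [Ring A] [Algebra k A]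

/-- A map on formal power series is local if the coefficient of its value at `m` depends only on
the coefficients of the argument at the exponents `p ≤ m`. -/
def IsLocal (δ : MvPowerSeries σ A →ₗ[k] MvPowerSeries σ A) : Prop :=
  ∀ m F, (∀ p ≤ m, coeff p F = 0) → coeff m (δ F) = 0

theorem coeff_mul_eq_zero_right {m : σ →₀ ℕ} {F : MvPowerSeries σ A} (H : MvPowerSeries σ A)
    (h : ∀ p ≤ m, coeff p F = 0) : coeff m (H * F) = 0 := by
  classical
  rw [coeff_mul]
  refine Finset.sum_eq_zero fun p hp => ?_
  rw [h p.2 (Finset.HasAntidiagonal.mem_antidiagonal.1 hp ▸ le_add_self), mul_zero]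

theorem coeff_mul_eq_zero_left {m : σ →₀ ℕ} {F : MvPowerSeries σ A} (H : MvPowerSeries σ A)
    (h : ∀ p ≤ m, coeff p F = 0) : coeff m (F * H) = 0 := by
  classical
  rw [coeff_mul]
  refine Finset.sum_eq_zero fun p hp => ?_
  rw [h p.1 (Finset.HasAntidiagonal.mem_antidiagonal.1 hp ▸ le_self_add), zero_mul]

theorem coeff_pow_eq_zero {F : MvPowerSeries σ A} (hF : constantCoeff F = 0) {m : σ →₀ ℕ} {j : ℕ}
    (h : m.degree < j) : coeff m (F ^ j) = 0 := by
  apply coeff_of_lt_order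
  exact lt_of_lt_of_le (by exact_mod_cast h) (le_order_pow_of_constantCoeff_eq_zero j hF)

theorem coeff_formalExp {F : MvPowerSeries σ A} (hF : constantCoeff F = 0) {m : σ →₀ ℕ} {N : ℕ}
    (h : m.degree < N) : coeff m (formalExp k F) =
      coeff m (∑ j ∈ Finset.range N, ((j.factorial : k)⁻¹) • F ^ j) := by
  rw [formalExp, coeff_formalSum, map_sum]
  refine finsum_eq_sum_of_support_subset _ fun j hj => ?_
  by_contra hlt
  refine hj ?_
  rw [Finset.mem_coe, Finset.mem_range, not_lt] at hlt
  change coeff m (((j.factorial : k)⁻¹) • F ^ j) = 0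
  rw [coeff_ksmul, coeff_pow_eq_zero hF (h.trans_le hlt), smul_zero]

theorem coeff_formalExp_sub {F : MvPowerSeries σ A} (hF : constantCoeff F = 0) {m : σ →₀ ℕ} {N : ℕ}
    (h : m.degree < N) : ∀ p ≤ m, coeff p (formalExp k F -
      ∑ j ∈ Finset.range N, ((j.factorial : k)⁻¹) • F ^ j) = 0 := by
  intro p hp
  rw [map_sub, coeff_formalExp hF ((Finsupp.degree_mono hp).trans_lt h), sub_self]

theorem derivation_pow {R : Type*} [Ring R] (δ : R → R)
    (leib : ∀ a b, δ (a * b) = δ a * b + a * δ b)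
    {F : R} (hcomm : Commute F (δ F)) (j : ℕ) : δ (F ^ (j + 1)) = (j + 1) • (δ F * F ^ j) := by
  induction j with
  | zero => simp
  | succ j ih =>
    rw [pow_succ, leib, ih, (hcomm.pow_left (j + 1)).eq, smul_mul_assoc, mul_assoc, ← pow_succ,
      succ_nsmul _ (j + 1)]

/-- The chain rule for the exponential: `δ (e ^ F) = δ F * e ^ F` for a local derivation `δ` such
that `F` and `δ F` commute. -/
theorem derivation_formalExp [CharZero k] {δ : MvPowerSeries σ A →ₗ[k] MvPowerSeries σ A}
    (hloc : IsLocal δ) (leib : ∀ a b, δ (a * b) = δ a * b + a * δ b) {F : MvPowerSeries σ A}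
    (hF : constantCoeff F = 0) (hcomm : Commute F (δ F)) :
    δ (formalExp k F) = δ F * formalExp k F := by
  have hone : δ 1 = 0 := by
    have := leib 1 1
    simpa using this
  have hpart : ∀ N, δ (∑ j ∈ Finset.range (N + 1), ((j.factorial : k)⁻¹) • F ^ j) =
      δ F * ∑ j ∈ Finset.range N, ((j.factorial : k)⁻¹) • F ^ j := by
    intro N
    rw [Finset.sum_range_succ', map_add, map_smul, pow_zero, hone, smul_zero, add_zero, map_sum,
      Finset.mul_sum]
    refine Finset.sum_congr rfl fun j _ => ?_
    rw [map_smul, derivation_pow δ leib hcomm, mul_smul_comm, ← Nat.cast_smul_eq_nsmul k, smul_smul]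
    congr 1
    have h1 : ((j + 1 : ℕ) : k) ≠ 0 := Nat.cast_ne_zero.2 (Nat.succ_ne_zero j)
    have h2 : ((j.factorial : ℕ) : k) ≠ 0 := Nat.cast_ne_zero.2 (Nat.factorial_ne_zero j)
    rw [Nat.factorial_succ]
    push_cast at h1 ⊢
    field_simp
  ext m
  have h1 := hloc m _ (coeff_formalExp_sub (k := k) hF (m := m) (N := m.degree + 1 + 1) (by omega))
  have h2 := coeff_mul_eq_zero_right (δ F)
    (coeff_formalExp_sub (k := k) hF (m := m) (N := m.degree + 1) (by omega))
  rw [map_sub, map_sub, sub_eq_zero, hpart] at h1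
  rw [mul_sub, map_sub, sub_eq_zero] at h2
  rw [h1, h2]

/-- The Euler derivation `z_i ∂/∂z_i`. -/
noncomputable def euler (i : σ) : MvPowerSeries σ A →ₗ[k] MvPowerSeries σ A where
  toFun F := fun m => m i • coeff m F
  map_add' F H := by
    ext m
    exact smul_add _ _ _
  map_smul' c F := by
    ext m
    exact smul_comm _ _ _

theorem coeff_euler (i : σ) (F : MvPowerSeries σ A) (m : σ →₀ ℕ) :
    coeff m (euler (k := k) i F) = m i • coeff m F := rfl

theorem isLocal_euler (i : σ) : IsLocal (euler (k := k) (A := A) i) := by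
  intro m F h
  rw [coeff_euler, h m le_rfl, smul_zero]

theorem euler_mul (i : σ) (F H : MvPowerSeries σ A) :
    euler (k := k) i (F * H) = euler (k := k) i F * H + F * euler (k := k) i H := by
  classical
  ext m
  rw [coeff_euler, map_add, coeff_mul, coeff_mul, coeff_mul, Finset.smul_sum,
    ← Finset.sum_add_distrib]
  refine Finset.sum_congr rfl fun p hp => ?_
  rw [coeff_euler, coeff_euler, ← Finset.HasAntidiagonal.mem_antidiagonal.1 hp, Finsupp.add_apply,
    add_smul, smul_mul_assoc, mul_smul_comm]

theorem euler_one (i : σ) : euler (k := k) i (1 : MvPowerSeries σ A) = 0 := by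
  have := euler_mul (k := k) i (1 : MvPowerSeries σ A) 1
  simpa using this

theorem euler_C (i : σ) (a : A) : euler (k := k) i (C a : MvPowerSeries σ A) = 0 := by
  classical
  ext m
  rw [coeff_euler, coeff_C]
  split_ifs with h
  · rw [h]; simp
  · simp

theorem euler_inverse (i : σ) {T T' : MvPowerSeries σ A} (h : T' * T = 1) (h' : T * T' = 1) :
    euler (k := k) i T' = -(T' * euler (k := k) i T * T') := by
  have h1 := euler_mul (k := k) i T' T
  rw [h, euler_one] at h1
  have h2 : euler (k := k) i T' * T * T' = -(T' * euler (k := k) i T * T') := by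
    rw [eq_neg_of_add_eq_zero_left h1.symm, neg_mul]
  rwa [mul_assoc, h', mul_one] at h2

/-- If `[F, B] = z` commutes with `F`, then `e ^ F * B = (B + z) * e ^ F`. -/
theorem formalExp_mul_of_commutator [CharZero k] {F B z : MvPowerSeries σ A}
    (hF : constantCoeff F = 0) (hz : F * B = B * F + z) (hcomm : Commute F z) :
    formalExp k F * B = (B + z) * formalExp k F := by
  have hz' : B * F - F * B = -z := by rw [hz]; abel
  let δ : MvPowerSeries σ A →ₗ[k] MvPowerSeries σ A :=
    LinearMap.mulLeft k B - LinearMap.mulRight k B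
  have hδ : ∀ H, δ H = B * H - H * B := fun H => rfl
  have h := derivation_formalExp (δ := δ) (F := F) ?_ ?_ hF ?_
  · rw [hδ, hδ, hz', neg_mul, sub_eq_iff_eq_add] at h
    rw [add_mul, h]
    abel
  · intro m H hH
    rw [hδ, map_sub, coeff_mul_eq_zero_right B hH, coeff_mul_eq_zero_left B hH, sub_zero]
  · intro a b
    rw [hδ, hδ, hδ]
    noncomm_ring
  · rw [hδ, hz']
    exact hcomm.neg_right

/-! ### Scalar power series inside operator-valued power series -/

variable (A) in
/-- The embedding of the scalar power series as central elements. -/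
noncomputable def scalarHom : MvPowerSeries σ k →+* MvPowerSeries σ A :=
  MvPowerSeries.map (algebraMap k A)

theorem coeff_scalarHom (s : MvPowerSeries σ k) (m : σ →₀ ℕ) :
    coeff m (scalarHom A s) = algebraMap k A (coeff m s) := rfl

theorem coeff_mul_swap (F H : MvPowerSeries σ A) (m : σ →₀ ℕ) [DecidableEq σ] :
    coeff m (F * H) = ∑ p ∈ Finset.HasAntidiagonal.antidiagonal m, coeff p.2 F * coeff p.1 H := by
  rw [coeff_mul]
  exact Finset.sum_equiv (Equiv.prodComm _ _) (fun p => by simp [add_comm]) fun p _ => rfl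

theorem scalarHom_comm (s : MvPowerSeries σ k) (F : MvPowerSeries σ A) :
    scalarHom A s * F = F * scalarHom A s := by
  classical
  ext m
  rw [coeff_mul, coeff_mul_swap]
  refine Finset.sum_congr rfl fun p _ => ?_
  rw [coeff_scalarHom, Algebra.commutes]

theorem exists_scalarHom {F : MvPowerSeries σ A} (h : ∀ m, ∃ c : k, coeff m F = c • 1) :
    ∃ s : MvPowerSeries σ k, F = scalarHom A s := by
  choose c hc using h
  let s : MvPowerSeries σ k := c
  have hs : ∀ m, coeff m s = c m := fun _ => rfl
  refine ⟨s, ?_⟩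
  ext m
  rw [hc, coeff_scalarHom, Algebra.algebraMap_eq_smul_one, hs]

/-- A commutator of series is a scalar series if the commutators of the coefficients are scalars. -/
theorem exists_scalarHom_commutator {F H : MvPowerSeries σ A}
    (h : ∀ p q, ∃ c : k, coeff p F * coeff q H = coeff q H * coeff p F + c • 1) :
    ∃ s : MvPowerSeries σ k, F * H = H * F + scalarHom A s := by
  classical
  suffices ∃ s : MvPowerSeries σ k, F * H - H * F = scalarHom A s by
    obtain ⟨s, hs⟩ := this
    exact ⟨s, by rw [← hs]; abel⟩
  apply exists_scalarHom
  intro m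
  choose c hc using h
  refine ⟨∑ p ∈ Finset.HasAntidiagonal.antidiagonal m, c p.1 p.2, ?_⟩
  rw [map_sub, coeff_mul, coeff_mul_swap H F, ← Finset.sum_sub_distrib, Finset.sum_smul]
  exact Finset.sum_congr rfl fun p _ => sub_eq_of_eq_add' (hc p.1 p.2)

/-- The same for anticommutators. -/
theorem exists_scalarHom_anticommutator {F H : MvPowerSeries σ A}
    (h : ∀ p q, ∃ c : k, coeff p F * coeff q H + coeff q H * coeff p F = c • 1) :
    ∃ s : MvPowerSeries σ k, F * H + H * F = scalarHom A s := by
  classical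
  apply exists_scalarHom
  intro m
  choose c hc using h
  refine ⟨∑ p ∈ Finset.HasAntidiagonal.antidiagonal m, c p.1 p.2, ?_⟩
  rw [map_add, coeff_mul, coeff_mul_swap H F, ← Finset.sum_add_distrib, Finset.sum_smul]
  exact Finset.sum_congr rfl fun p _ => hc p.1 p.2

theorem anticommutator_eq_zero {F H : MvPowerSeries σ A}
    (h : ∀ p q, coeff p F * coeff q H + coeff q H * coeff p F = 0) : F * H + H * F = 0 := by
  classical
  ext m
  rw [map_add, coeff_mul, coeff_mul_swap H F, ← Finset.sum_add_distrib, map_zero]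
  exact Finset.sum_eq_zero fun p _ => h p.1 p.2

theorem commute_of_coeff {F H : MvPowerSeries σ A}
    (h : ∀ p q, Commute (coeff p F) (coeff q H)) : Commute F H := by
  classical
  change F * H = H * F
  ext m
  rw [coeff_mul, coeff_mul_swap H F]
  exact Finset.sum_congr rfl fun p _ => h p.1 p.2

/-! ### Conjugation -/

/-- Suppose that every Euler derivative of `T` has the form `L * T`, where the coefficients of `L`
preserve the space `V` by commutators, the constant one acting by zero.  Then conjugation by `T`
maps the elements of `V` to series with coefficients in `V`: the series `U = T u T⁻¹` satisfies
`z_i ∂U/∂z_i = [L, U]`, which determines its coefficients recursively. -/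
theorem coeff_conj_mem [CharZero k] {V : Submodule k A} {T T' : MvPowerSeries σ A}
    (h : T' * T = 1) (h' : T * T' = 1) (h0 : constantCoeff T = 1)
    (L : σ → MvPowerSeries σ A) (hL : ∀ i, euler (k := k) i T = L i * T)
    (hL0 : ∀ i a, Commute (coeff 0 (L i)) a)
    (hLV : ∀ i p, ∀ v ∈ V, ∃ w ∈ V, coeff p (L i) * v = v * coeff p (L i) + w) {u : A} (hu : u ∈ V)
    (m : σ →₀ ℕ) : coeff m (T * C u * T') ∈ V := by
  classical
  set U := T * C u * T' with hU
  have hEU : ∀ i, euler (k := k) i U = L i * U - U * L i := by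
    intro i
    rw [hU, euler_mul, euler_mul, euler_C, mul_zero, add_zero, euler_inverse i h h', hL,
      ← mul_assoc T', mul_assoc (T' * L i), h', mul_one, mul_neg, sub_eq_add_neg]
    simp only [mul_assoc]
  induction hd : m.degree using Nat.strong_induction_on generalizing m with
  | _ d ih =>
    by_cases hm : m = 0
    · subst hm
      have h0' : constantCoeff T' = 1 := by
        have := congrArg constantCoeff h
        rwa [map_mul, h0, mul_one, map_one] at this
      rw [coeff_zero_eq_constantCoeff_apply, hU, map_mul, map_mul, h0, h0', one_mul, mul_one,
        constantCoeff_C]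
      exact hu
    · obtain ⟨i, hi'⟩ := Finsupp.ne_iff.1 hm
      have hmi : (m i : k) ≠ 0 := Nat.cast_ne_zero.2 hi'
      have e : (m i : k) • coeff m U ∈ V := by
        rw [Nat.cast_smul_eq_nsmul, ← coeff_euler (k := k), hEU, map_sub, coeff_mul,
          coeff_mul_swap U, ← Finset.sum_sub_distrib]
        refine V.sum_mem fun p hp => ?_
        have hp' := Finset.HasAntidiagonal.mem_antidiagonal.1 hp
        by_cases hp0 : p.1 = 0
        · rw [hp0, (hL0 i _).eq, sub_self]
          exact V.zero_mem
        · have hdeg : p.2.degree < d := ?_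
          · obtain ⟨w, hw, hw'⟩ := hLV i p.1 _ (ih p.2.degree hdeg p.2 rfl)
            rwa [hw', add_sub_cancel_left]
          have h1 : p.1.degree ≠ 0 := fun h => hp0 ((Finsupp.degree_eq_zero_iff _).1 h)
          have h2 : p.1.degree + p.2.degree = m.degree := by rw [← hp', map_add]
          omega
      have := V.smul_mem (m i : k)⁻¹ e
      rwa [smul_smul, inv_mul_cancel₀ hmi, one_smul] at this

end Exponential

/-! ### Vertex operators -/

section Vertex

open MvPowerSeries

variable {k : Type*} [Field k]

/-- The series `∑_{n ≥ 1} n⁻¹ (∑_i z_i ^ n) B_n`, where `z_i` is the variable with index `e i`. -/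
noncomputable def vertexLog (e : ℕ → ℕ ⊕ ℕ) (B : ℕ → Module.End k (Wedge k)) : Operator k :=
  formalSum fun n : ℕ+ => scalarMul (miwa (fun i => (X (e i) : Scalar k)) n) (B n)

/-- The exponential of `vertexLog`; both `Γ_+(t)` and `Γ_-(t')` are of this form. -/
noncomputable def vertex (e : ℕ → ℕ ⊕ ℕ) (B : ℕ → Module.End k (Wedge k)) : Operator k :=
  formalExp k (vertexLog e B)

/-- The operators `α_n`, `n ≥ 1`. -/
noncomputable def lower (n : ℕ) : Module.End k (Wedge k) := alpha k (n : ℤ)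

/-- The operators `α_{-n}`, `n ≥ 1`. -/
noncomputable def raise (n : ℕ) : Module.End k (Wedge k) := alpha k (-(n : ℤ))

theorem GammaPlus_eq : GammaPlus (tx k) = vertex Sum.inl lower := rfl

theorem GammaMinus_eq : GammaMinus (ty k) = vertex Sum.inr raise := rfl

theorem isAdj_raise {n : ℕ} (hn : n ≠ 0) : IsAdj (raise (k := k) n) (lower n) :=
  (isAdj_alpha (by omega)).symm

theorem lower_commute {m n : ℕ} (hm : m ≠ 0) (hn : n ≠ 0) :
    Commute (lower (k := k) m) (lower n) :=
  alpha_commute_pos (by omega) (by omega)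

theorem raise_commute {m n : ℕ} (hm : m ≠ 0) (hn : n ≠ 0) :
    Commute (raise (k := k) m) (raise n) :=
  alpha_commute_neg (by omega) (by omega)

variable {e : ℕ → ℕ ⊕ ℕ} {B : ℕ → Module.End k (Wedge k)}

theorem coeff_miwa_single (he : Function.Injective e) (i : ℕ) (n : ℕ+) :
    coeff (Finsupp.single (e i) (n : ℕ)) (miwa (fun i => (X (e i) : Scalar k)) n) =
      ((n : ℕ) : k)⁻¹ := by
  classical
  rw [miwa, coeff_formalSum, finsum_eq_single _ i, coeff_ksmul, coeff_X_pow, if_pos rfl,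
    smul_eq_mul, mul_one]
  intro j hj
  rw [coeff_ksmul, coeff_X_pow, if_neg, smul_zero]
  intro h
  rcases Finsupp.single_eq_single_iff _ _ _ _ |>.1 h with h | h
  · exact hj (he h.1).symm
  · exact n.ne_zero h.1

theorem coeff_vertexLog_eq_zero {m : ℕ ⊕ ℕ →₀ ℕ}
    (h : ∀ (i : ℕ) (n : ℕ+), m ≠ Finsupp.single (e i) (n : ℕ)) :
    coeff m (vertexLog e B) = 0 := by
  rw [vertexLog, coeff_formalSum]
  refine finsum_eq_zero_of_forall_eq_zero fun n => ?_
  change coeff m (miwa (fun i => (X (e i) : Scalar k)) n) • B n = 0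
  convert zero_smul k _
  rw [miwa, coeff_formalSum]
  refine finsum_eq_zero_of_forall_eq_zero fun i => ?_
  by_contra hne
  exact h i n (coeff_miwa_term e n i m hne)

theorem coeff_vertexLog_single (he : Function.Injective e) (i : ℕ) (n : ℕ+) :
    coeff (Finsupp.single (e i) (n : ℕ)) (vertexLog e B) = ((n : ℕ) : k)⁻¹ • B n := by
  rw [vertexLog, coeff_formalSum, finsum_eq_single _ n]
  · change coeff (Finsupp.single (e i) (n : ℕ)) (miwa (fun i => (X (e i) : Scalar k)) n) • B n = _
    rw [coeff_miwa_single he]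
  · intro n' hn'
    change coeff (Finsupp.single (e i) (n : ℕ)) (miwa (fun i => (X (e i) : Scalar k)) n') • B n' = 0
    by_cases h : coeff (Finsupp.single (e i) (n : ℕ)) (miwa (fun i => (X (e i) : Scalar k)) n') = 0
    · rw [h, zero_smul]
    · have := coeff_miwa e n' _ h
      rw [Finsupp.degree_single] at this
      exact absurd (PNat.coe_injective this).symm hn'

theorem coeff_vertexLog_mem (he : Function.Injective e) (m : ℕ ⊕ ℕ →₀ ℕ) :
    ∃ (c : k) (n : ℕ), n ≠ 0 ∧ coeff m (vertexLog e B) = c • B n := by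
  by_cases h : ∀ (i : ℕ) (n : ℕ+), m ≠ Finsupp.single (e i) (n : ℕ)
  · exact ⟨0, 1, one_ne_zero, by rw [coeff_vertexLog_eq_zero h, zero_smul]⟩
  · push Not at h
    obtain ⟨i, n, rfl⟩ := h
    exact ⟨_, n, n.ne_zero, coeff_vertexLog_single he i n⟩

theorem constantCoeff_vertexLog : constantCoeff (vertexLog e B) = 0 :=
  constantCoeff_boson e fun n : ℕ+ => B n

theorem constantCoeff_vertex : constantCoeff (vertex e B) = 1 :=
  constantCoeff_formalExp k _ constantCoeff_vertexLog

section Recursion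

theorem euler_vertexLog_commute (he : Function.Injective e)
    (hB : ∀ {m n : ℕ}, m ≠ 0 → n ≠ 0 → Commute (B m) (B n)) (a : ℕ ⊕ ℕ) :
    Commute (vertexLog e B) (euler (k := k) a (vertexLog e B)) := by
  refine commute_of_coeff fun p q => ?_
  obtain ⟨c, n, hn, hc⟩ := coeff_vertexLog_mem (B := B) he p
  obtain ⟨d, l, hl, hd⟩ := coeff_vertexLog_mem (B := B) he q
  rw [coeff_euler, hc, hd]
  exact ((((hB hn hl).smul_left c).smul_right d).smul_right (q a))

theorem euler_vertex [CharZero k] (he : Function.Injective e)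
    (hB : ∀ {m n : ℕ}, m ≠ 0 → n ≠ 0 → Commute (B m) (B n)) (a : ℕ ⊕ ℕ) :
    euler (k := k) a (vertex e B) = euler (k := k) a (vertexLog e B) * vertex e B :=
  derivation_formalExp (isLocal_euler a) (euler_mul a) constantCoeff_vertexLog
    (euler_vertexLog_commute he hB a)

theorem euler_vertexLog_commute_vertex [CharZero k] (he : Function.Injective e)
    (hB : ∀ {m n : ℕ}, m ≠ 0 → n ≠ 0 → Commute (B m) (B n)) (a : ℕ ⊕ ℕ) :
    vertex e B * euler (k := k) a (vertexLog e B) =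
      euler (k := k) a (vertexLog e B) * vertex e B := by
  have := formalExp_mul_of_commutator (k := k) (F := vertexLog e B)
    (B := euler (k := k) a (vertexLog e B)) (z := 0) constantCoeff_vertexLog
    ((euler_vertexLog_commute he hB a).eq.trans (add_zero _).symm) (Commute.zero_right _)
  rwa [add_zero] at this

/-- The coefficients of `z_i ∂/∂z_i` of `vertexLog` are the `B_n`, at the powers `z_i ^ n`; so its
product with another series is a finite convolution.  The function `φ` is the multiplication, in
either order. -/
theorem sum_antidiagonal_euler_vertexLog [CharZero k] [DecidableEq (ℕ ⊕ ℕ)]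
    (he : Function.Injective e) (i : ℕ) (F : Operator k) (m : ℕ ⊕ ℕ →₀ ℕ)
    (φ : Module.End k (Wedge k) → Module.End k (Wedge k) → Module.End k (Wedge k))
    (hφ : ∀ y, φ 0 y = 0) :
    ∑ p ∈ Finset.HasAntidiagonal.antidiagonal m,
        φ (coeff p.1 (euler (k := k) (e i) (vertexLog e B))) (coeff p.2 F) =
      ∑ n ∈ Finset.range (m (e i)),
        φ (B (n + 1)) (coeff (m - Finsupp.single (e i) (n + 1)) F) := by
  symm
  refine Finset.sum_of_injOn
    (fun n => (Finsupp.single (e i) (n + 1), m - Finsupp.single (e i) (n + 1))) ?_ ?_ ?_ ?_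
  · intro a _ b _ h
    have := congrArg (fun p : (ℕ ⊕ ℕ →₀ ℕ) × (ℕ ⊕ ℕ →₀ ℕ) => p.1 (e i)) h
    simpa using this
  · intro n hn
    simp only [Finset.coe_range, Set.mem_Iio] at hn
    rw [Finset.mem_coe, Finset.HasAntidiagonal.mem_antidiagonal]
    exact add_tsub_cancel_of_le (Finsupp.single_le_iff.2 (by omega))
  · intro p hp hp'
    rw [Finset.HasAntidiagonal.mem_antidiagonal] at hp
    rw [coeff_euler]
    by_cases h0 : p.1 (e i) = 0
    · rw [h0, zero_smul, hφ]
    rw [coeff_vertexLog_eq_zero, smul_zero, hφ]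
    intro j n hj
    have hij : j = i := by
      by_contra hne
      rw [hj, Finsupp.single_eq_of_ne (fun h => hne (he h).symm)] at h0
      exact h0 rfl
    subst hij
    apply hp'
    have hn := n.pos
    refine ⟨(n : ℕ) - 1, ?_, ?_⟩
    · have h1 : p.1 (e j) ≤ m (e j) := by rw [← hp]; exact Nat.le_add_right _ _
      rw [hj, Finsupp.single_eq_same] at h1
      simp only [Finset.coe_range, Set.mem_Iio]
      omega
    · have h1 : (n : ℕ) - 1 + 1 = n := by omega
      simp only [h1]
      rw [← hj, ← hp, add_tsub_cancel_left]
  · intro n _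
    have := coeff_vertexLog_single (B := B) he i ⟨n + 1, Nat.succ_pos n⟩
    simp only [PNat.mk_coe] at this
    have hne : ((n + 1 : ℕ) : k) ≠ 0 := Nat.cast_ne_zero.2 (Nat.succ_ne_zero n)
    rw [coeff_euler, this, Finsupp.single_eq_same, ← Nat.cast_smul_eq_nsmul k, smul_smul,
      mul_inv_cancel₀ hne, one_smul]

theorem coeff_euler_vertexLog_mul [CharZero k] (he : Function.Injective e) (i : ℕ) (F : Operator k)
    (m : ℕ ⊕ ℕ →₀ ℕ) : coeff m (euler (k := k) (e i) (vertexLog e B) * F) =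
      ∑ n ∈ Finset.range (m (e i)),
        B (n + 1) * coeff (m - Finsupp.single (e i) (n + 1)) F := by
  classical
  rw [coeff_mul]
  exact sum_antidiagonal_euler_vertexLog he i F m (fun x y => x * y) fun y => zero_mul y

theorem coeff_mul_euler_vertexLog [CharZero k] (he : Function.Injective e) (i : ℕ) (F : Operator k)
    (m : ℕ ⊕ ℕ →₀ ℕ) : coeff m (F * euler (k := k) (e i) (vertexLog e B)) =
      ∑ n ∈ Finset.range (m (e i)),
        coeff (m - Finsupp.single (e i) (n + 1)) F * B (n + 1) := by
  classical
  rw [coeff_mul_swap]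
  exact sum_antidiagonal_euler_vertexLog he i F m (fun x y => y * x) fun y => mul_zero y

/-- Newton's recursion for the coefficients of a vertex operator. -/
theorem smul_coeff_vertex [CharZero k] (he : Function.Injective e)
    (hB : ∀ {m n : ℕ}, m ≠ 0 → n ≠ 0 → Commute (B m) (B n)) (i : ℕ) (m : ℕ ⊕ ℕ →₀ ℕ) :
    (m (e i) : k) • coeff m (vertex e B) = ∑ n ∈ Finset.range (m (e i)),
      B (n + 1) * coeff (m - Finsupp.single (e i) (n + 1)) (vertex e B) := by
  rw [Nat.cast_smul_eq_nsmul, ← coeff_euler_vertexLog_mul he, ← euler_vertex he hB, coeff_euler]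

theorem smul_coeff_vertex' [CharZero k] (he : Function.Injective e)
    (hB : ∀ {m n : ℕ}, m ≠ 0 → n ≠ 0 → Commute (B m) (B n)) (i : ℕ) (m : ℕ ⊕ ℕ →₀ ℕ) :
    (m (e i) : k) • coeff m (vertex e B) = ∑ n ∈ Finset.range (m (e i)),
      coeff (m - Finsupp.single (e i) (n + 1)) (vertex e B) * B (n + 1) := by
  rw [Nat.cast_smul_eq_nsmul, ← coeff_mul_euler_vertexLog he,
    euler_vertexLog_commute_vertex he hB, ← euler_vertex he hB, coeff_euler]

theorem coeff_vertex_eq_zero [CharZero k] (he : Function.Injective e)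
    (hB : ∀ {m n : ℕ}, m ≠ 0 → n ≠ 0 → Commute (B m) (B n)) {a : ℕ ⊕ ℕ} (ha : ∀ i, e i ≠ a)
    {m : ℕ ⊕ ℕ →₀ ℕ} (hm : m a ≠ 0) : coeff m (vertex e B) = 0 := by
  have h0 : euler (k := k) a (vertexLog e B) = 0 := by
    ext p
    rw [coeff_euler, map_zero]
    by_cases h : ∀ (i : ℕ) (n : ℕ+), p ≠ Finsupp.single (e i) (n : ℕ)
    · rw [coeff_vertexLog_eq_zero h, smul_zero]
    · push Not at h
      obtain ⟨i, n, rfl⟩ := h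
      rw [Finsupp.single_eq_of_ne (ha i).symm, zero_smul]
  have h1 : m a • coeff m (vertex e B) = 0 := by
    rw [← coeff_euler (k := k), euler_vertex he hB, h0, zero_mul, map_zero]
  rw [← Nat.cast_smul_eq_nsmul k] at h1
  exact (smul_eq_zero.1 h1).resolve_left (Nat.cast_ne_zero.2 hm)

theorem degree_sub_single_lt {m : ℕ ⊕ ℕ →₀ ℕ} {a : ℕ ⊕ ℕ} {n : ℕ} (h : n + 1 ≤ m a) :
    (m - Finsupp.single a (n + 1)).degree < m.degree := by
  have h1 : m - Finsupp.single a (n + 1) + Finsupp.single a (n + 1) = m :=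
    tsub_add_cancel_of_le (Finsupp.single_le_iff.2 h)
  have h2 := congrArg Finsupp.degree h1
  rw [map_add, Finsupp.degree_single] at h2
  omega

theorem isAdj_of_smul {c : k} (hc : c ≠ 0) {A D : Module.End k (Wedge k)}
    (h : IsAdj (c • A) (c • D)) : IsAdj A D := by
  have := h.smul c⁻¹
  rwa [smul_smul, smul_smul, inv_mul_cancel₀ hc, one_smul, one_smul] at this

/-- `Γ_-` is the adjoint of `Γ_+` with the same variables. -/
theorem isAdj_coeff_vertex [CharZero k] (he : Function.Injective e) (m : ℕ ⊕ ℕ →₀ ℕ) :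
    IsAdj (coeff m (vertex (k := k) e raise)) (coeff m (vertex e lower)) := by
  induction hd : m.degree using Nat.strong_induction_on generalizing m with
  | _ d ih =>
    by_cases hm : m = 0
    · rw [hm, coeff_zero_eq_constantCoeff_apply, coeff_zero_eq_constantCoeff_apply,
        constantCoeff_vertex, constantCoeff_vertex]
      exact IsAdj.one
    · obtain ⟨a, ha⟩ := Finsupp.ne_iff.1 hm
      by_cases hr : ∃ i, e i = a
      · obtain ⟨i, rfl⟩ := hr
        refine isAdj_of_smul (c := (m (e i) : k)) (Nat.cast_ne_zero.2 ha) ?_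
        rw [smul_coeff_vertex he raise_commute, smul_coeff_vertex' he lower_commute]
        refine IsAdj.sum _ fun n hn => (isAdj_raise (Nat.succ_ne_zero n)).mul (ih _ ?_ _ rfl)
        rw [← hd]
        exact degree_sub_single_lt (Finset.mem_range.1 hn)
      · push Not at hr
        rw [coeff_vertex_eq_zero he raise_commute hr ha,
          coeff_vertex_eq_zero he lower_commute hr ha]
        exact IsAdj.zero

theorem lower_base {n : ℕ} (hn : n ≠ 0) (c : ℕ) : lower n (vec k (Maya.base c)) = 0 :=
  alpha_base (by omega) c

theorem coeff_vertex_base [CharZero k] (he : Function.Injective e) (c : ℕ)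
    {m : ℕ ⊕ ℕ →₀ ℕ} (hm : m ≠ 0) :
    coeff m (vertex e lower) (vec k (Maya.base c)) = 0 := by
  obtain ⟨a, ha⟩ := Finsupp.ne_iff.1 hm
  by_cases hr : ∃ i, e i = a
  · obtain ⟨i, rfl⟩ := hr
    have h := LinearMap.congr_fun (smul_coeff_vertex' he (lower_commute (k := k)) i m)
      (vec k (Maya.base c))
    rw [LinearMap.smul_apply, LinearMap.sum_apply, Finset.sum_eq_zero] at h
    · exact (smul_eq_zero.1 h).resolve_left (Nat.cast_ne_zero.2 ha)
    · intro n _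
      rw [Module.End.mul_apply, lower_base (Nat.succ_ne_zero n), map_zero]
  · push Not at hr
    rw [coeff_vertex_eq_zero he lower_commute hr ha]
    rfl

/-- The operators `h_j^⊥`, the coefficients of `Γ_+` in a single variable. -/
noncomputable def removeStrip (j : ℕ) : Module.End k (Wedge k) :=
  coeff (Finsupp.single (Sum.inl 0) j) (vertex Sum.inl lower)

theorem removeStrip_zero : removeStrip (k := k) 0 = 1 := by
  rw [removeStrip, Finsupp.single_zero, coeff_zero_eq_constantCoeff_apply, constantCoeff_vertex]

theorem smul_removeStrip [CharZero k] (j : ℕ) : (j : k) • removeStrip (k := k) j =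
    ∑ n ∈ Finset.range j, removeStrip (j - (n + 1)) * lower (n + 1) := by
  have h := smul_coeff_vertex' (k := k) Sum.inl_injective lower_commute 0
    (Finsupp.single (Sum.inl 0) j)
  rw [Finsupp.single_eq_same] at h
  rw [removeStrip, h]
  refine Finset.sum_congr rfl fun n _ => ?_
  rw [removeStrip, Finsupp.single_tsub]

/-- The coefficients of `Γ_+` split off one variable at a time. -/
theorem coeff_vertex_add_single [CharZero k] (he : Function.Injective e) {i : ℕ} {m : ℕ ⊕ ℕ →₀ ℕ}
    (hm : m (e i) = 0) (j : ℕ) : coeff (m + Finsupp.single (e i) j) (vertex (k := k) e lower) =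
      coeff m (vertex e lower) * removeStrip j := by
  induction j using Nat.strong_induction_on with
  | _ j ih =>
    rcases Nat.eq_zero_or_pos j with rfl | hj
    · rw [Finsupp.single_zero, add_zero, removeStrip_zero, mul_one]
    · have hj' : (j : k) ≠ 0 := Nat.cast_ne_zero.2 hj.ne'
      have h := smul_coeff_vertex' (k := k) he lower_commute i (m + Finsupp.single (e i) j)
      rw [Finsupp.add_apply, hm, Finsupp.single_eq_same, zero_add] at h
      have h2 : (j : k) • (coeff m (vertex (k := k) e lower) * removeStrip j) =
          (j : k) • coeff (m + Finsupp.single (e i) j) (vertex (k := k) e lower) := by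
        rw [h, ← mul_smul_comm, smul_removeStrip, Finset.mul_sum]
        refine Finset.sum_congr rfl fun n hn => ?_
        have hn' := Finset.mem_range.1 hn
        rw [add_tsub_assoc_of_le (Finsupp.single_le_iff.2 (by
            rw [Finsupp.single_eq_same]; omega)), ← Finsupp.single_tsub,
          ih (j - (n + 1)) (by omega), mul_assoc]
      have h3 := congrArg (fun T => (j : k)⁻¹ • T) h2
      simp only [smul_smul, inv_mul_cancel₀ hj', one_smul] at h3
      exact h3.symm

theorem sum_range_sum_range_add {M : Type*} [AddCommMonoid M] (f : ℕ → M) (j : ℕ) :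
    ∑ n ∈ Finset.range j, ∑ i ∈ Finset.range (j - n), f (n + 1 + i) =
      ∑ b ∈ Finset.range (j + 1), b • f b := by
  induction j with
  | zero => simp
  | succ j ih =>
    have h : ∀ n ∈ Finset.range (j + 1), ∑ i ∈ Finset.range (j + 1 - n), f (n + 1 + i) =
        ∑ i ∈ Finset.range (j - n), f (n + 1 + i) + f (j + 1) := by
      intro n hn
      have hn' := Finset.mem_range.1 hn
      rw [show j + 1 - n = j - n + 1 by omega, Finset.sum_range_succ,
        show n + 1 + (j - n) = j + 1 by omega]
    rw [Finset.sum_congr rfl h, Finset.sum_add_distrib, Finset.sum_range_succ _ j, ih,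
      Nat.sub_self, Finset.range_zero, Finset.sum_empty, add_zero, Finset.sum_const,
      Finset.card_range, Finset.sum_range_succ _ (j + 1)]

/-- `h_j^⊥ ψ_r = ∑_i ψ_{r - i} h_{j - i}^⊥`. -/
theorem removeStrip_mul_psi [CharZero k] (j : ℕ) (r : HalfInt) : removeStrip j * psi k r =
    ∑ i ∈ Finset.range (j + 1), psi k (r.shift (-(i : ℤ))) * removeStrip (j - i) := by
  induction j using Nat.strong_induction_on generalizing r with
  | _ j ih =>
    rcases Nat.eq_zero_or_pos j with rfl | hj
    · simp [removeStrip_zero, shift_zero]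
    · have hj' : (j : k) ≠ 0 := Nat.cast_ne_zero.2 hj.ne'
      have key : (j : k) • (removeStrip j * psi k r) =
          (j : k) • ∑ i ∈ Finset.range (j + 1),
            psi k (r.shift (-(i : ℤ))) * removeStrip (j - i) := by
        have h1 : ∀ n ∈ Finset.range j, removeStrip (j - (n + 1)) * lower (n + 1) * psi k r =
            ∑ i ∈ Finset.range (j - n), psi k (r.shift (-(i : ℤ))) *
              (removeStrip (j - i - (n + 1)) * lower (n + 1)) +
            ∑ i ∈ Finset.range (j - n), psi k (r.shift (-((n + 1 + i : ℕ) : ℤ))) *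
              removeStrip (j - (n + 1 + i)) := by
          intro n hn
          have hn' := Finset.mem_range.1 hn
          rw [mul_assoc, lower, alpha_mul_psi (by omega), mul_add, ← mul_assoc,
            ih _ (by omega), ih _ (by omega), Finset.sum_mul,
            show j - (n + 1) + 1 = j - n by omega]
          refine congrArg₂ _ (Finset.sum_congr rfl fun i _ => ?_)
            (Finset.sum_congr rfl fun i _ => ?_)
          · rw [mul_assoc, show j - (n + 1) - i = j - i - (n + 1) by omega]
          · rw [shift_shift, show j - (n + 1) - i = j - (n + 1 + i) by omega]
            congr 3
            push_cast
            ring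
        rw [← smul_mul_assoc, smul_removeStrip, Finset.sum_mul, Finset.sum_congr rfl h1,
          Finset.sum_add_distrib,
          sum_range_sum_range_add (fun b => psi k (r.shift (-(b : ℤ))) * removeStrip (j - b)),
          Finset.sum_comm' (s' := fun i => Finset.range (j - i)) (t' := Finset.range (j + 1))
            (by simp only [Finset.mem_range]; omega), ← Finset.sum_add_distrib, Finset.smul_sum]
        refine Finset.sum_congr rfl fun i hi' => ?_
        have hi'' := Finset.mem_range.1 hi'
        rw [← Finset.mul_sum, ← smul_removeStrip, mul_smul_comm, ← Nat.cast_smul_eq_nsmul k,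
          ← add_smul, ← Nat.cast_add, Nat.sub_add_cancel (by omega)]
      have h3 := congrArg (fun T => (j : k)⁻¹ • T) key
      simpa only [smul_smul, inv_mul_cancel₀ hj', one_smul] using h3

end Recursion

end Vertex

/-! ### Wick's theorem -/

section Wick

variable {A : Type*} [Ring A]

/-- The product `u_0 u_1 ⋯ u_{n-1}`. -/
def ascProd : (n : ℕ) → (Fin n → A) → A
  | 0, _ => 1
  | n + 1, u => u 0 * ascProd n (Fin.tail u)

/-- The product `w_{n-1} ⋯ w_1 w_0`. -/
def descProd : (n : ℕ) → (Fin n → A) → A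
  | 0, _ => 1
  | n + 1, w => descProd n (Fin.tail w) * w 0

theorem mul_ascProd_of_anticommute {a : A} (n : ℕ) (u : Fin n → A)
    (h : ∀ i, a * u i + u i * a = 0) : a * ascProd n u = (-1) ^ n * (ascProd n u * a) := by
  induction n with
  | zero => simp [ascProd]
  | succ n ih =>
    have h1 := ih (Fin.tail u) fun i => h i.succ
    have h2 := eq_neg_of_add_eq_zero_left (h 0)
    have h3 : u 0 * (-1) ^ n = (-1) ^ n * u 0 := ((Commute.one_left (u 0)).neg_left.pow_left n).symm
    rw [ascProd, ← mul_assoc, h2, neg_mul, mul_assoc, h1, ← mul_assoc, h3, pow_succ]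
    noncomm_ring

/-- Moving `a` to the right through the product `w_n ⋯ w_0`, when its anticommutators with the
factors are the central elements `c_j`. -/
theorem mul_descProd_of_anticommute {a : A} (n : ℕ) (w c : Fin (n + 1) → A)
    (hc : ∀ j x, c j * x = x * c j) (h : ∀ j, a * w j + w j * a = c j) :
    a * descProd (n + 1) w = (-1) ^ (n + 1) * (descProd (n + 1) w * a) +
      ∑ j : Fin (n + 1), (-1) ^ (n + j : ℕ) * (c j * descProd n (fun i => w (j.succAbove i))) := by
  induction n with
  | zero =>
    rw [Fin.sum_univ_one, ← h 0]
    simp [descProd]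
  | succ n ih =>
    have h1 := ih (Fin.tail w) (Fin.tail c) (fun j => hc j.succ) fun j => h j.succ
    have h2 : a * w 0 = c 0 - w 0 * a := eq_sub_of_add_eq (h 0)
    rw [Fin.sum_univ_succ, descProd, ← mul_assoc, h1, add_mul, mul_assoc, mul_assoc, h2,
      Finset.sum_mul]
    have h3 : ∀ j : Fin (n + 1), (-1) ^ (n + 1 + (j.succ : Fin (n + 2)) : ℕ) *
        (c j.succ * descProd (n + 1) (fun i => w (j.succ.succAbove i))) =
        (-1) ^ (n + j : ℕ) * (Fin.tail c j *
          descProd n (fun i => Fin.tail w (j.succAbove i))) * w 0 := by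
      intro j
      rw [descProd, Fin.succ_succAbove_zero, Fin.val_succ,
        show n + 1 + ((j : ℕ) + 1) = n + j + 2 by ring, pow_add, neg_one_sq, mul_one, mul_assoc,
        mul_assoc]
      congr 4
      funext i
      simp only [Fin.tail, Fin.succ_succAbove_succ]
    rw [Finset.sum_congr rfl fun j _ => h3 j, mul_sub, ← hc 0]
    simp only [Fin.val_zero, add_zero, Fin.zero_succAbove]
    rw [show (fun i : Fin (n + 1) => w i.succ) = Fin.tail w from rfl, mul_sub, ← add_assoc,
      sub_eq_neg_add, pow_succ (-1 : A) (n + 1)]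
    congr 2
    noncomm_ring

/-- Wick's theorem.  Let `φ` be a functional with values in a commutative ring `R` acting centrally
through `ι`.  If `u i = up i + um i`, where `φ` vanishes on `up i * A` and on `A * um i`, the `um i`
anticommute with the `u j`, and their anticommutators with the `w j` are central scalars, then
`φ (u_0 ⋯ u_{n-1} w_{n-1} ⋯ w_0)` is the determinant of the two-point functions: moving `um 0` to
the right expands both sides along the first row. -/
theorem wick {R : Type*} [CommRing R] (ι : R →+* A) (hι : ∀ s a, ι s * a = a * ι s) (φ : A →+ R)
    (hφι : ∀ s a, φ (ι s * a) = s * φ a) (hφ1 : φ 1 = 1) (n : ℕ) (u up um w : Fin n → A)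
    (c : Fin n → Fin n → R) (hu : ∀ i, u i = up i + um i) (hup : ∀ i a, φ (up i * a) = 0)
    (hum : ∀ i a, φ (a * um i) = 0) (huu : ∀ i j, um i * u j + u j * um i = 0)
    (huw : ∀ i j, um i * w j + w j * um i = ι (c i j)) :
    φ (ascProd n u * descProd n w) = Matrix.det (Matrix.of fun i j => φ (u i * w j)) := by
  have htwo : ∀ i j, φ (u i * w j) = c i j := by
    intro i j
    rw [hu, add_mul, map_add, hup, zero_add, eq_sub_of_add_eq (huw i j), map_sub, hum, sub_zero,
      ← mul_one (ι (c i j)), hφι, hφ1, mul_one]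
  simp only [htwo]
  clear htwo
  induction n with
  | zero => simp [ascProd, descProd, hφ1]
  | succ n ih =>
    have hneg : ∀ (j : ℕ) a, φ ((-1) ^ j * a) = (-1) ^ j * φ a := by
      intro j a
      rw [← hφι, map_pow, map_neg, map_one]
    have h1 : φ (ascProd (n + 1) u * descProd (n + 1) w) =
        φ (um 0 * ascProd n (Fin.tail u) * descProd (n + 1) w) := by
      rw [ascProd, hu 0, mul_assoc, add_mul, map_add, hup, zero_add, ← mul_assoc]
    have h2 : ∀ j : Fin (n + 1), φ (ascProd n (Fin.tail u) * ((-1) ^ (n + j : ℕ) *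
        (ι (c 0 j) * descProd n (fun i => w (j.succAbove i))))) = (-1) ^ (n + j : ℕ) *
        (c 0 j * ((Matrix.of fun i l => c i l).submatrix Fin.succ j.succAbove).det) := by
      intro j
      have h3 := ih (Fin.tail u) (Fin.tail up) (Fin.tail um) (fun i => w (j.succAbove i))
        (fun i l => c i.succ (j.succAbove l)) (fun i => hu _) (fun i => hup _) (fun i => hum _)
        (fun i l => huu _ _) (fun i l => huw _ _)
      have h4 : ∀ x y : A, x * ((-1) ^ (n + j : ℕ) * (ι (c 0 j) * y)) =
          (-1) ^ (n + j : ℕ) * (ι (c 0 j) * (x * y)) := by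
        intro x y
        rw [← mul_assoc, ← ((Commute.one_left x).neg_left.pow_left (n + j : ℕ)).eq, mul_assoc,
          ← mul_assoc x, ← hι, mul_assoc]
      rw [h4, hneg, hφι, h3]
      rfl
    have h5 : φ (ascProd n (Fin.tail u) * ((-1) ^ (n + 1) * (descProd (n + 1) w * um 0))) = 0 := by
      rw [← mul_assoc, ← mul_assoc, hum]
    rw [h1, mul_ascProd_of_anticommute n (Fin.tail u) fun i => huu 0 i.succ, mul_assoc, hneg,
      mul_assoc, mul_descProd_of_anticommute n w (fun j => ι (c 0 j)) (fun j x => hι _ _) (huw 0),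
      mul_add, map_add, h5, zero_add, Finset.mul_sum, map_sum, Finset.sum_congr rfl fun j _ => h2 j,
      Finset.mul_sum, Matrix.det_succ_row_zero]
    refine Finset.sum_congr rfl fun j _ => ?_
    rw [← mul_assoc, ← mul_assoc, ← pow_add, ← add_assoc, ← two_mul, pow_add, pow_mul, neg_one_sq,
      one_pow, one_mul]
    rfl

end Wick

/-! ### Vacuum expectations -/

section Vacuum

open MvPowerSeries

variable {k : Type*} [Field k]

/-- The vacuum expectation `(F v_∅, v_∅)`. -/
noncomputable def vev : Operator k →+ Scalar k where
  toFun F := matrixElement F (vec k Maya.vac) (vec k Maya.vac)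
  map_zero' := by
    ext m
    change innerProd k ((coeff m (0 : Operator k)) (vec k Maya.vac)) (vec k Maya.vac) = 0
    rw [map_zero, LinearMap.zero_apply, innerProd_vec_right]
    rfl
  map_add' F H := by
    ext m
    change innerProd k ((coeff m (F + H)) (vec k Maya.vac)) (vec k Maya.vac) =
      innerProd k ((coeff m F) (vec k Maya.vac)) (vec k Maya.vac) +
        innerProd k ((coeff m H) (vec k Maya.vac)) (vec k Maya.vac)
    rw [map_add, LinearMap.add_apply, innerProd_add_left]

theorem coeff_vev (F : Operator k) (m : ℕ ⊕ ℕ →₀ ℕ) :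
    coeff m (vev F) = innerProd k (coeff m F (vec k Maya.vac)) (vec k Maya.vac) := rfl

theorem vev_scalarHom_mul (s : Scalar k) (F : Operator k) :
    vev (scalarHom (Module.End k (Wedge k)) s * F) = s * vev F := by
  classical
  ext m
  rw [coeff_vev, coeff_mul, coeff_mul, LinearMap.sum_apply, ← innerLeft_apply, map_sum]
  refine Finset.sum_congr rfl fun p _ => ?_
  rw [innerLeft_apply, coeff_vev, coeff_scalarHom, Module.End.mul_apply,
    Module.algebraMap_end_apply, innerProd_smul_left]

theorem vev_one : vev (1 : Operator k) = 1 := by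
  classical
  ext m
  rw [coeff_vev, coeff_one, coeff_one]
  split_ifs
  · rw [Module.End.one_apply, innerProd_vec_right]
    simp [vec]
  · rw [LinearMap.zero_apply, innerProd_vec_right]
    rfl

theorem vev_mul_eq_zero {T : Operator k} (h : ∀ m, coeff m T (vec k Maya.vac) = 0)
    (F : Operator k) : vev (F * T) = 0 := by
  classical
  ext m
  rw [coeff_vev, coeff_mul, LinearMap.sum_apply, Finset.sum_eq_zero, innerProd_vec_right]
  · rfl
  · intro p _
    rw [Module.End.mul_apply, h, map_zero]

theorem vev_mul_eq_zero' {T : Operator k}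
    (h : ∀ m f, innerProd k (coeff m T f) (vec k Maya.vac) = 0) (F : Operator k) :
    vev (T * F) = 0 := by
  classical
  ext m
  rw [coeff_vev, coeff_mul, LinearMap.sum_apply, ← innerLeft_apply, map_sum, map_zero]
  refine Finset.sum_eq_zero fun p _ => ?_
  rw [innerLeft_apply, Module.End.mul_apply, h]

theorem vev_vertexLog_raise_mul {e : ℕ → ℕ ⊕ ℕ} (he : Function.Injective e) (F : Operator k) :
    vev (vertexLog e raise * F) = 0 := by
  refine vev_mul_eq_zero' (fun m f => ?_) F
  obtain ⟨c, n, hn, hc⟩ := coeff_vertexLog_mem (B := raise (k := k)) he m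
  rw [hc, LinearMap.smul_apply, innerProd_smul_left, isAdj_raise hn, ← Maya.base_zero,
    lower_base hn, innerProd_comm]
  simp [innerProd]

theorem vev_mul_vertex_lower [CharZero k] {e : ℕ → ℕ ⊕ ℕ} (he : Function.Injective e)
    (F : Operator k) : vev (F * vertex e lower) = vev F := by
  classical
  have h : vev (F * (vertex e lower - 1)) = 0 := by
    refine vev_mul_eq_zero (fun m => ?_) F
    rw [map_sub, coeff_one]
    split_ifs with hm
    · rw [hm, coeff_zero_eq_constantCoeff_apply, constantCoeff_vertex, sub_self]
      rfl
    · rw [sub_zero, ← Maya.base_zero, coeff_vertex_base he 0 hm]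
  rw [mul_sub, mul_one, map_sub, sub_eq_zero] at h
  exact h

theorem exists_vertexLog_commutator {e e' : ℕ → ℕ ⊕ ℕ} (he : Function.Injective e)
    (he' : Function.Injective e') (p q : ℕ ⊕ ℕ →₀ ℕ) :
    ∃ c : k, coeff p (vertexLog e lower) * coeff q (vertexLog e' raise) =
      coeff q (vertexLog e' raise) * coeff p (vertexLog e lower) +
        c • (1 : Module.End k (Wedge k)) := by
  obtain ⟨c, n, hn, hc⟩ := coeff_vertexLog_mem (B := lower (k := k)) he p
  obtain ⟨d, l, hl, hd⟩ := coeff_vertexLog_mem (B := raise (k := k)) he' q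
  obtain ⟨a, ha⟩ := exists_alpha_commutator (k := k) (m := (n : ℤ)) (n := -(l : ℤ)) (by omega)
    (by omega)
  refine ⟨c * d * a, ?_⟩
  have h : lower n * raise l = raise l * lower n + a • (1 : Module.End k (Wedge k)) :=
    eq_add_of_sub_eq' ha
  rw [hc, hd, smul_mul_smul_comm, smul_mul_smul_comm, h, smul_add, smul_smul, mul_comm d c]

theorem exists_vertex_mul_vertexLog [CharZero k] {e e' : ℕ → ℕ ⊕ ℕ} (he : Function.Injective e)
    (he' : Function.Injective e') : ∃ s : Scalar k, vertex e lower * vertexLog e' raise =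
      (vertexLog e' raise + scalarHom (Module.End k (Wedge k)) s) * vertex e lower := by
  obtain ⟨s, hs⟩ := exists_scalarHom_commutator (exists_vertexLog_commutator (k := k) he he')
  exact ⟨s, formalExp_mul_of_commutator constantCoeff_vertexLog hs (scalarHom_comm s _).symm⟩

theorem exists_vertex_mul_euler [CharZero k] {e e' : ℕ → ℕ ⊕ ℕ} (he : Function.Injective e)
    (he' : Function.Injective e') (a : ℕ ⊕ ℕ) : ∃ s : Scalar k,
    vertex e lower * euler (k := k) a (vertexLog e' raise) =
      (euler (k := k) a (vertexLog e' raise) + scalarHom (Module.End k (Wedge k)) s) *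
        vertex e lower := by
  have h : ∀ p q, ∃ c : k, coeff p (vertexLog e lower) *
      coeff q (euler (k := k) a (vertexLog e' raise)) =
      coeff q (euler (k := k) a (vertexLog e' raise)) * coeff p (vertexLog e lower) +
        c • (1 : Module.End k (Wedge k)) := by
    intro p q
    obtain ⟨c, hc⟩ := exists_vertexLog_commutator (k := k) he he' p q
    refine ⟨q a • c, ?_⟩
    rw [coeff_euler, mul_smul_comm, hc, smul_add, smul_mul_assoc, smul_assoc]
  obtain ⟨s, hs⟩ := exists_scalarHom_commutator h
  exact ⟨s, formalExp_mul_of_commutator constantCoeff_vertexLog hs (scalarHom_comm s _).symm⟩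

/-- `Γ_+ Γ_-` acts on the left vacuum as a multiple of `Γ_+`: commuting `Γ_+` to the right turns the
exponent `∑ t'_n α_{-n}` of `Γ_-` into itself plus a scalar, and the left vacuum is annihilated by
the `α_{-n}`. -/
theorem vev_vertex_mul_vertex_mul [CharZero k] {e e' : ℕ → ℕ ⊕ ℕ} (he : Function.Injective e)
    (he' : Function.Injective e') (F : Operator k) :
    vev (vertex e lower * vertex e' raise * F) =
      vev (vertex e lower * vertex e' raise) * vev (vertex e lower * F) := by
  obtain ⟨s, hs⟩ := exists_vertex_mul_vertexLog (k := k) he he'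
  set P : Operator k := vertex e lower with hP
  set R : Operator k := vertexLog e' raise with hR
  have hpow : ∀ (j : ℕ) (F : Operator k), vev (P * R ^ j * F) = s ^ j * vev (P * F) := by
    intro j
    induction j with
    | zero => intro F; rw [pow_zero, pow_zero, mul_one, one_mul]
    | succ j ih =>
      intro F
      have h1 : ∀ j : ℕ, P * R ^ j =
          (R + scalarHom (Module.End k (Wedge k)) s) ^ j * P := by
        intro j
        induction j with
        | zero => rw [pow_zero, pow_zero, mul_one, one_mul]
        | succ j ihj => rw [pow_succ, ← mul_assoc, ihj, mul_assoc, hs, ← mul_assoc, ← pow_succ]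
      rw [h1, pow_succ', mul_assoc, mul_assoc, add_mul, map_add, vev_vertexLog_raise_mul he',
        zero_add, vev_scalarHom_mul, ← mul_assoc, ← h1, ih, ← mul_assoc, ← pow_succ']
  have hvP : vev P = 1 := by
    rw [← one_mul P, vev_mul_vertex_lower he, vev_one]
  have hsmul : ∀ (c : k) (F : Operator k), vev (c • F) = c • vev F := by
    intro c F
    ext m
    rw [coeff_ksmul, coeff_vev, coeff_vev, smul_eq_mul, ← innerProd_smul_left]
    rfl
  ext m
  have hR0 : constantCoeff R = 0 := constantCoeff_vertexLog
  set Q : Operator k := ∑ j ∈ Finset.range (m.degree + 1), ((j.factorial : k)⁻¹) • R ^ j with hQ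
  -- both sides depend only on a partial sum of the exponential series
  have hdiff := coeff_formalExp_sub (k := k) hR0 (m := m) (N := m.degree + 1) (by omega)
  rw [← hQ, show formalExp k R = vertex e' raise from rfl] at hdiff
  have hpart : ∀ F : Operator k, vev (P * Q * F) =
      (∑ j ∈ Finset.range (m.degree + 1), ((j.factorial : k)⁻¹) • s ^ j) * vev (P * F) := by
    intro F
    rw [hQ, Finset.mul_sum, Finset.sum_mul, map_sum, Finset.sum_mul]
    refine Finset.sum_congr rfl fun j _ => ?_
    rw [mul_smul_comm, smul_mul_assoc, hsmul, hpow, smul_mul_assoc]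
  have hzero : ∀ (F : Operator k) (p : ℕ ⊕ ℕ →₀ ℕ), p ≤ m →
      coeff p (vev (P * vertex e' raise * F) - vev (P * Q * F)) = 0 := by
    intro F p hp
    rw [← map_sub, ← sub_mul, ← mul_sub, coeff_vev, coeff_mul_eq_zero_left]
    · rw [LinearMap.zero_apply, innerProd_vec_right]
      rfl
    · intro q hq
      exact coeff_mul_eq_zero_right P fun l hl => hdiff l ((hl.trans hq).trans hp)
  have h1 := hzero F m le_rfl
  have h2 := coeff_mul_eq_zero_left (vev (P * F)) (hzero 1)
  rw [map_sub, sub_eq_zero] at h1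
  rw [sub_mul, map_sub, sub_eq_zero, hpart, mul_one, mul_one, hvP, mul_one] at h2
  rw [h1, h2, hpart]

theorem inverse_GammaMinus_mul : Ring.inverse (GammaMinus (ty k)) * GammaMinus (ty k) = 1 :=
  Ring.inverse_mul_cancel _ isUnit_GammaMinus_ty

theorem GammaMinus_mul_inverse : GammaMinus (ty k) * Ring.inverse (GammaMinus (ty k)) = 1 :=
  Ring.mul_inverse_cancel _ isUnit_GammaMinus_ty

theorem inverse_G_mul : Ring.inverse (G k) * G k = 1 := Ring.inverse_mul_cancel _ isUnit_G

theorem G_mul_inverse : G k * Ring.inverse (G k) = 1 := Ring.mul_inverse_cancel _ isUnit_G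

theorem inverse_G_mul_GammaPlus :
    Ring.inverse (G k) * GammaPlus (tx k) = GammaMinus (ty k) := by
  have h : GammaPlus (tx k) = G k * GammaMinus (ty k) := by
    rw [G, mul_assoc, inverse_GammaMinus_mul, mul_one]
  rw [h, ← mul_assoc, inverse_G_mul, one_mul]

/-- Conjugation by `G` inside a vacuum expectation.  As `Γ_+` fixes the vacuum, `G⁻¹` may be
replaced by `G⁻¹ Γ_+ = Γ_-`; by `vev_vertex_mul_vertex_mul`, the factor `G = Γ_+ Γ_-⁻¹` on the left
may be replaced by `Γ_+`, up to the scalar `(Γ_+ Γ_- v_∅, v_∅)`. -/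
theorem vev_conj_G [CharZero k] (M : Operator k) :
    vev (GammaPlus (tx k) * GammaMinus (ty k)) * vev (G k * M * Ring.inverse (G k)) =
      vev (GammaPlus (tx k) * M * GammaMinus (ty k)) := by
  rw [← vev_mul_vertex_lower Sum.inl_injective (G k * M * Ring.inverse (G k)), ← GammaPlus_eq,
    mul_assoc (G k * M), inverse_G_mul_GammaPlus, G, mul_assoc (GammaPlus (tx k)),
    mul_assoc (GammaPlus (tx k))]
  have h := vev_vertex_mul_vertex_mul (k := k) Sum.inl_injective Sum.inr_injective
    (Ring.inverse (GammaMinus (ty k)) * M * GammaMinus (ty k))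
  rw [← GammaPlus_eq, ← GammaMinus_eq] at h
  rw [← h, mul_assoc (GammaPlus (tx k)), ← mul_assoc (GammaMinus (ty k)),
    ← mul_assoc (GammaMinus (ty k)), GammaMinus_mul_inverse, one_mul, mul_assoc (GammaPlus (tx k))]

end Vacuum

/-! ### The conjugated fermions -/

section Conjugation

open MvPowerSeries

variable {k : Type*} [Field k]

variable (k) in
/-- The span of the operators `ψ_r`. -/
noncomputable def psiSpan : Submodule k (Module.End k (Wedge k)) :=
  Submodule.span k (Set.range (psi k))

variable (k) in
/-- The span of the operators `ψ*_r`. -/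
noncomputable def psiStarSpan : Submodule k (Module.End k (Wedge k)) :=
  Submodule.span k (Set.range (psiStar k))

theorem psi_mem (r : HalfInt) : psi k r ∈ psiSpan k := Submodule.subset_span ⟨r, rfl⟩

theorem psiStar_mem (r : HalfInt) : psiStar k r ∈ psiStarSpan k := Submodule.subset_span ⟨r, rfl⟩

theorem psiSpan_anticommute {f g : Module.End k (Wedge k)} (hf : f ∈ psiSpan k)
    (hg : g ∈ psiSpan k) : f * g + g * f = 0 := by
  induction hf, hg using Submodule.span_induction₂ with
  | mem_mem x y hx hy =>
    obtain ⟨r, rfl⟩ := hx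
    obtain ⟨s, rfl⟩ := hy
    exact psi_mul_psi r s
  | zero_left y _ => rw [zero_mul, mul_zero, add_zero]
  | zero_right y _ => rw [zero_mul, mul_zero, add_zero]
  | add_left x y z _ _ _ h1 h2 => rw [add_mul, mul_add, add_add_add_comm, h1, h2, add_zero]
  | add_right x y z _ _ _ h1 h2 => rw [add_mul, mul_add, add_add_add_comm, h1, h2, add_zero]
  | smul_left c x y _ _ h => rw [smul_mul_assoc, mul_smul_comm, ← smul_add, h, smul_zero]
  | smul_right c x y _ _ h => rw [smul_mul_assoc, mul_smul_comm, ← smul_add, h, smul_zero]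

theorem psiSpan_anticommutator {f g : Module.End k (Wedge k)} (hf : f ∈ psiSpan k)
    (hg : g ∈ psiStarSpan k) : ∃ c : k, f * g + g * f = c • 1 := by
  induction hf, hg using Submodule.span_induction₂ with
  | mem_mem x y hx hy =>
    obtain ⟨r, rfl⟩ := hx
    obtain ⟨s, rfl⟩ := hy
    rcases eq_or_ne r s with rfl | h
    · exact ⟨1, by rw [psi_mul_psiStar_self, one_smul]⟩
    · exact ⟨0, by rw [psi_mul_psiStar_of_ne h, zero_smul]⟩
  | zero_left y _ => exact ⟨0, by rw [zero_mul, mul_zero, add_zero, zero_smul]⟩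
  | zero_right y _ => exact ⟨0, by rw [zero_mul, mul_zero, add_zero, zero_smul]⟩
  | add_left x y z _ _ _ h1 h2 =>
    obtain ⟨c, hc⟩ := h1
    obtain ⟨d, hd⟩ := h2
    exact ⟨c + d, by rw [add_mul, mul_add, add_add_add_comm, hc, hd, add_smul]⟩
  | add_right x y z _ _ _ h1 h2 =>
    obtain ⟨c, hc⟩ := h1
    obtain ⟨d, hd⟩ := h2
    exact ⟨c + d, by rw [add_mul, mul_add, add_add_add_comm, hc, hd, add_smul]⟩
  | smul_left a x y _ _ h =>
    obtain ⟨c, hc⟩ := h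
    exact ⟨a * c, by rw [smul_mul_assoc, mul_smul_comm, ← smul_add, hc, smul_smul]⟩
  | smul_right a x y _ _ h =>
    obtain ⟨c, hc⟩ := h
    exact ⟨a * c, by rw [smul_mul_assoc, mul_smul_comm, ← smul_add, hc, smul_smul]⟩

/-- Every combination of the `ψ_r` splits into creation operators (`r > 0`), which are invisible to
the left vacuum, and annihilation operators (`r < 0`), which kill the vacuum. -/
theorem exists_psiSpan_split {f : Module.End k (Wedge k)} (hf : f ∈ psiSpan k) :
    ∃ p q : Module.End k (Wedge k), f = p + q ∧ q ∈ psiSpan k ∧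
      (∀ v, innerProd k (p v) (vec k Maya.vac) = 0) ∧ q (vec k Maya.vac) = 0 := by
  induction hf using Submodule.span_induction with
  | mem x hx =>
    obtain ⟨r, rfl⟩ := hx
    by_cases hr : r ∈ Maya.vac.1
    · refine ⟨0, psi k r, (zero_add _).symm, psi_mem r, fun v => ?_, psi_vec_of_mem hr⟩
      rw [LinearMap.zero_apply, innerProd_vec_right]
      rfl
    · refine ⟨psi k r, 0, (add_zero _).symm, Submodule.zero_mem _, fun v => ?_, rfl⟩
      rw [innerProd_psi_left, psiStar_vec_of_notMem hr, innerProd_comm]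
      simp [innerProd]
  | zero =>
    refine ⟨0, 0, (add_zero _).symm, Submodule.zero_mem _, fun v => ?_, rfl⟩
    rw [LinearMap.zero_apply, innerProd_vec_right]
    rfl
  | add x y _ _ hx hy =>
    obtain ⟨p, q, rfl, h1, h2, h3⟩ := hx
    obtain ⟨p', q', rfl, h1', h2', h3'⟩ := hy
    refine ⟨p + p', q + q', add_add_add_comm _ _ _ _, Submodule.add_mem _ h1 h1', fun v => ?_, ?_⟩
    · rw [LinearMap.add_apply, innerProd_add_left, h2, h2', add_zero]
    · rw [LinearMap.add_apply, h3, h3', add_zero]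
  | smul c x _ hx =>
    obtain ⟨p, q, rfl, h1, h2, h3⟩ := hx
    refine ⟨c • p, c • q, smul_add _ _ _, Submodule.smul_mem _ _ h1, fun v => ?_, ?_⟩
    · rw [LinearMap.smul_apply, innerProd_smul_left, h2, mul_zero]
    · rw [LinearMap.smul_apply, h3, smul_zero]

/-- The elements of an algebra whose commutators preserve the subspace `V`. -/
def bracketStabilizer {A : Type*} [Ring A] [Algebra k A] (V : Submodule k A) : Submodule k A where
  carrier := {a | ∀ v ∈ V, a * v - v * a ∈ V}
  zero_mem' := fun v _ => by rw [zero_mul, mul_zero, sub_zero]; exact V.zero_mem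
  add_mem' := fun {a b} ha hb v hv => by
    rw [add_mul, mul_add, add_sub_add_comm]
    exact V.add_mem (ha v hv) (hb v hv)
  smul_mem' := fun c a ha v hv => by
    rw [smul_mul_assoc, mul_smul_comm, ← smul_sub]
    exact V.smul_mem c (ha v hv)

theorem mem_bracketStabilizer_span {A : Type*} [Ring A] [Algebra k A] {s : Set A} {a : A}
    (h : ∀ v ∈ s, a * v - v * a ∈ Submodule.span k s) :
    a ∈ bracketStabilizer (Submodule.span k s) := by
  intro v hv
  induction hv using Submodule.span_induction with
  | mem x hx => exact h x hx
  | zero => rw [zero_mul, mul_zero, sub_zero]; exact Submodule.zero_mem _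
  | add x y _ _ hx hy =>
    rw [add_mul, mul_add, add_sub_add_comm]
    exact Submodule.add_mem _ hx hy
  | smul c x _ hx =>
    rw [smul_mul_assoc, mul_smul_comm, ← smul_sub]
    exact Submodule.smul_mem _ c hx

theorem alpha_mem_bracketStabilizer {n : ℤ} (hn : n ≠ 0) :
    alpha k n ∈ bracketStabilizer (psiSpan k) := by
  refine mem_bracketStabilizer_span ?_
  rintro _ ⟨r, rfl⟩
  rw [alpha_mul_psi hn, add_sub_cancel_left]
  exact psi_mem _

theorem alpha_mem_bracketStabilizer' {n : ℤ} (hn : n ≠ 0) :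
    alpha k n ∈ bracketStabilizer (psiStarSpan k) := by
  refine mem_bracketStabilizer_span ?_
  rintro _ ⟨r, rfl⟩
  rw [alpha_mul_psiStar hn, sub_sub_cancel_left]
  exact Submodule.neg_mem _ (psiStar_mem _)

/-- The logarithmic derivatives of `G` are combinations of the `α_n`, up to scalars. -/
theorem exists_euler_G [CharZero k] (a : ℕ ⊕ ℕ) : ∃ s : Scalar k, euler (k := k) a (G k) =
    (euler (k := k) a (vertexLog Sum.inl lower) - (euler (k := k) a (vertexLog Sum.inr raise) +
      scalarHom (Module.End k (Wedge k)) s)) * G k := by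
  obtain ⟨s, hs⟩ := exists_vertex_mul_euler (k := k) Sum.inl_injective Sum.inr_injective a
  refine ⟨s, ?_⟩
  have h1 := euler_vertex (k := k) Sum.inl_injective lower_commute a
  have h2 := euler_vertex (k := k) Sum.inr_injective raise_commute a
  have h3 := euler_vertexLog_commute_vertex (k := k) Sum.inr_injective raise_commute a
  rw [← GammaPlus_eq] at hs h1
  rw [← GammaMinus_eq] at h2 h3
  have h4 := euler_inverse (k := k) a (inverse_GammaMinus_mul (k := k))
    GammaMinus_mul_inverse
  rw [h2, ← h3, ← mul_assoc, inverse_GammaMinus_mul, one_mul] at h4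
  rw [G, euler_mul, h1, h4, mul_neg, ← mul_assoc, hs, sub_mul, ← sub_eq_add_neg, mul_assoc,
    mul_assoc]

/-- Conjugation by `G` preserves every space of operators that is stable under commutators with the
`α_n`. -/
theorem coeff_conj_G_mem [CharZero k] {V : Submodule k (Module.End k (Wedge k))}
    (hV : ∀ n : ℤ, n ≠ 0 → alpha k n ∈ bracketStabilizer V) {u : Module.End k (Wedge k)}
    (hu : u ∈ V) (m : ℕ ⊕ ℕ →₀ ℕ) : coeff m (G k * C u * Ring.inverse (G k)) ∈ V := by
  choose s hs using exists_euler_G (k := k)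
  have hone : (1 : Module.End k (Wedge k)) ∈ bracketStabilizer V := fun v _ => by
    rw [one_mul, mul_one, sub_self]
    exact V.zero_mem
  refine coeff_conj_mem inverse_G_mul G_mul_inverse ?_ _ hs ?_ ?_ hu m
  · have h := congrArg constantCoeff (inverse_GammaMinus_mul (k := k))
    rw [map_mul, map_one, GammaMinus_eq, constantCoeff_vertex, mul_one] at h
    rw [G, map_mul, GammaPlus_eq, constantCoeff_vertex, one_mul, GammaMinus_eq, h]
  · intro i a
    rw [map_sub, map_add, coeff_euler, coeff_euler, coeff_scalarHom, Finsupp.zero_apply, zero_smul,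
      zero_smul, zero_add, zero_sub]
    exact ((Algebra.commute_algebraMap_left _ a)).neg_left
  · intro i p v hv
    refine ⟨_, ?_, (add_sub_cancel _ _).symm⟩
    revert v
    change _ ∈ bracketStabilizer V
    obtain ⟨c, n, hn, hc⟩ := coeff_vertexLog_mem (B := lower (k := k)) Sum.inl_injective p
    obtain ⟨d, l, hl, hd⟩ := coeff_vertexLog_mem (B := raise (k := k)) Sum.inr_injective p
    rw [map_sub, map_add, coeff_euler, coeff_euler, hc, hd, coeff_scalarHom,
      Algebra.algebraMap_eq_smul_one]
    refine Submodule.sub_mem _ (Submodule.smul_of_tower_mem _ _ (Submodule.smul_mem _ _ (hV _ ?_)))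
      (Submodule.add_mem _ (Submodule.smul_of_tower_mem _ _ (Submodule.smul_mem _ _ (hV _ ?_)))
        (Submodule.smul_mem _ _ hone))
    · omega
    · omega

theorem coeff_Psi_mem [CharZero k] (r : HalfInt) (m : ℕ ⊕ ℕ →₀ ℕ) :
    coeff m (Psi k r) ∈ psiSpan k :=
  coeff_conj_G_mem (fun _ hn => alpha_mem_bracketStabilizer hn) (psi_mem r) m

theorem coeff_PsiStar_mem [CharZero k] (r : HalfInt) (m : ℕ ⊕ ℕ →₀ ℕ) :
    coeff m (PsiStar k r) ∈ psiStarSpan k :=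
  coeff_conj_G_mem (fun _ hn => alpha_mem_bracketStabilizer' hn) (psiStar_mem r) m

/-- Wick's theorem for the conjugated fermions, which are split coefficientwise into creation and
annihilation operators. -/
theorem vev_Psi_PsiStar [CharZero k] (n : ℕ) (x : Fin n → HalfInt) :
    vev (ascProd n (fun i => Psi k (x i)) * descProd n (fun i => PsiStar k (x i))) =
      Matrix.det (Matrix.of fun i j => K k (x i) (x j)) := by
  choose p q hpq hq hp0 hq0 using fun (i : Fin n) m =>
    exists_psiSpan_split (coeff_Psi_mem (k := k) (x i) m)
  let P : Fin n → Operator k := p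
  let Q : Fin n → Operator k := q
  have hQ : ∀ i m, coeff m (Q i) = q i m := fun _ _ => rfl
  have hP : ∀ i m, coeff m (P i) = p i m := fun _ _ => rfl
  choose c hc using fun i j => exists_scalarHom_anticommutator (F := Q i) (H := PsiStar k (x j))
    fun l m => psiSpan_anticommutator (by rw [hQ]; exact hq i l) (coeff_PsiStar_mem (x j) m)
  refine wick (scalarHom (Module.End k (Wedge k))) scalarHom_comm vev vev_scalarHom_mul vev_one n _
    P Q _ c (fun i => ?_) (fun i a => ?_) (fun i a => ?_) (fun i j => ?_) hc
  · ext1 m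
    rw [map_add, hP, hQ, ← hpq]
  · exact vev_mul_eq_zero' (fun m f => by rw [hP, hp0]) a
  · exact vev_mul_eq_zero (fun m => by rw [hQ, hq0]) a
  · exact anticommutator_eq_zero fun l m =>
      psiSpan_anticommute (by rw [hQ]; exact hq i l) (coeff_Psi_mem (x j) m)

theorem conj_ascProd_mul_descProd {A : Type*} [Ring A] {g g' : A} (h : g' * g = 1) (h' : g * g' = 1)
    (n : ℕ) (u w : Fin n → A) :
    ascProd n (fun i => g * u i * g') * descProd n (fun i => g * w i * g') =
      g * (ascProd n u * descProd n w) * g' := by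
  induction n with
  | zero => simp [ascProd, descProd, h']
  | succ n ih =>
    have := ih (Fin.tail u) (Fin.tail w)
    simp only [ascProd, descProd]
    change g * u 0 * g' * ascProd n (fun i => g * Fin.tail u i * g') *
      (descProd n (fun i => g * Fin.tail w i * g') * (g * w 0 * g')) = _
    have e : ∀ a b c d : A, a * b * (c * d) = a * (b * c) * d := fun a b c d => by
      simp only [mul_assoc]
    rw [e, this]
    calc g * u 0 * g' * (g * (ascProd n (Fin.tail u) * descProd n (Fin.tail w)) * g') *
        (g * w 0 * g') = g * u 0 * (g' * g) * (ascProd n (Fin.tail u) * descProd n (Fin.tail w)) *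
          (g' * g) * w 0 * g' := by simp only [mul_assoc]
      _ = _ := by rw [h, mul_one, mul_one]; simp only [mul_assoc]

theorem ascProd_mul_descProd_C (n : ℕ) (u w : Fin n → Module.End k (Wedge k)) :
    ascProd n (fun i => (C (u i) : Operator k)) * descProd n (fun i => (C (w i) : Operator k)) =
      C (ascProd n u * descProd n w) := by
  induction n with
  | zero => simp [ascProd, descProd]
  | succ n ih =>
    have := ih (Fin.tail u) (Fin.tail w)
    simp only [ascProd, descProd]
    have e : ∀ {R : Type _} [Ring R] (a b c d : R), a * b * (c * d) = a * (b * c) * d :=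
      fun a b c d => by simp only [mul_assoc]
    rw [e, e, map_mul, map_mul, ← this]
    rfl

open Classical in
/-- `∏ ψ_x ψ*_x` is the projection onto the span of the `v_S` with `X ⊂ S`. -/
theorem ascProd_mul_descProd_vec (n : ℕ) (x : Fin n → HalfInt) (hx : Function.Injective x)
    (S : Maya) : (ascProd n (fun i => psi k (x i)) * descProd n (fun i => psiStar k (x i)))
      (vec k S) = if ∀ i, x i ∈ S.1 then vec k S else 0 := by
  induction n generalizing S with
  | zero => simp [ascProd, descProd]
  | succ n ih =>
    have h1 := ih (Fin.tail x) (hx.comp (Fin.succ_injective n))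
    change (psi k (x 0) * ascProd n (fun i => psi k (Fin.tail x i)) *
      (descProd n (fun i => psiStar k (Fin.tail x i)) * psiStar k (x 0))) (vec k S) = _
    rw [mul_assoc, ← mul_assoc (ascProd _ _), Module.End.mul_apply, Module.End.mul_apply]
    by_cases h0 : x 0 ∈ S.1
    · have h2 : (∀ i, Fin.tail x i ∈ (S.erase (x 0)).1) ↔ ∀ i, x i ∈ S.1 := by
        rw [Fin.forall_fin_succ]
        constructor
        · exact fun h => ⟨h0, fun i => (h i).1⟩
        · exact fun h i => ⟨h.2 i, fun e => Fin.succ_ne_zero i (hx e)⟩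
      rw [psiStar_vec_of_mem h0, map_smul, h1, map_smul]
      simp only [h2]
      split_ifs
      · rw [← map_smul, ← psiStar_vec_of_mem h0, psi_psiStar_vec, if_pos h0]
      · rw [map_zero, smul_zero]
    · rw [psiStar_vec_of_notMem h0, map_zero, map_zero, if_neg fun h => h0 (h 0)]

end Conjugation

/-! ### Removing horizontal strips -/

section Pieri

variable {k : Type*} [Field k]

/-- The set `{g_0 - 1/2, g_1 - 3/2, …, g_{l-1} - l + 1/2} ∪ {-l - 1/2, -l - 3/2, …}`, translated
by `-c`. -/
def rowMaya : (c l : ℕ) → (Fin l → ℕ) → Maya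
  | c, 0, _ => Maya.base c
  | c, l + 1, g => (rowMaya (c + 1) l (Fin.tail g)).insert (hi ((g 0 : ℤ) - c - 1))

theorem mem_rowMaya {c l : ℕ} {g : Fin l → ℕ} {n : ℤ} : hi n ∈ (rowMaya c l g).1 ↔
    (∃ i : Fin l, n = (g i : ℤ) - (i : ℕ) - c - 1) ∨ n < -((c + l : ℕ) : ℤ) := by
  induction l generalizing c with
  | zero => simp [rowMaya, Maya.hi_mem_base]
  | succ l ih =>
    rw [rowMaya, Maya.mem_insert, ih, Fin.exists_fin_succ, hi_inj, or_assoc]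
    refine or_congr (by simp) (or_congr (exists_congr fun i => ?_) ?_)
    · rw [Fin.val_succ]
      push_cast
      constructor <;> intro h <;> simp only [Fin.tail] at h ⊢ <;> linarith
    · push_cast
      constructor <;> intro h <;> linarith

/-- Adding a first row: the new element is the largest one, so that no sign appears. -/
theorem psi_vec_rowMaya {c l a : ℕ} {g : Fin l → ℕ} (h : ∀ i, g i ≤ a) :
    psi k (hi ((a : ℤ) - c - 1)) (vec k (rowMaya (c + 1) l g)) =
      vec k (rowMaya c (l + 1) (Fin.cons a g : Fin (l + 1) → ℕ)) := by
  have hlt : ∀ n, hi n ∈ (rowMaya (c + 1) l g).1 → n < (a : ℤ) - c - 1 := by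
    intro n hn
    rw [mem_rowMaya] at hn
    rcases hn with ⟨i, rfl⟩ | hn
    · have := h i
      push_cast
      omega
    · push_cast at hn
      omega
  have habove : (rowMaya (c + 1) l g).above (hi ((a : ℤ) - c - 1)) = 0 := by
    unfold Maya.above
    convert Set.ncard_empty HalfInt
    rw [Set.eq_empty_iff_forall_notMem]
    rintro r ⟨h1, h2⟩
    obtain ⟨n, rfl⟩ := hi_surjective r
    have := hlt n h1
    rw [hi_lt] at h2
    omega
  rw [psi_vec_of_notMem fun h => lt_irrefl _ (hlt _ h), habove, pow_zero, one_smul]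
  rfl

/-- If `ψ_{r - d} w = 0`, the expansion of `h_j^⊥ ψ_r w` stops before `ψ_{r - d}`: its tail is
`h_{j - d}^⊥ ψ_{r - d} w`. -/
theorem removeStrip_psi_apply [CharZero k] {r : HalfInt} {d : ℕ} {w : Wedge k}
    (hw : psi k (r.shift (-(d : ℤ))) w = 0) (j : ℕ) : removeStrip j (psi k r w) =
      ∑ i ∈ Finset.range d,
        if i ≤ j then psi k (r.shift (-(i : ℤ))) (removeStrip (j - i) w) else 0 := by
  have h := fun j r => LinearMap.congr_fun (removeStrip_mul_psi (k := k) j r) w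
  simp only [Module.End.mul_apply, LinearMap.sum_apply] at h
  rw [h]
  rcases le_or_gt (j + 1) d with hd | hd
  · rw [← Finset.sum_filter]
    refine Finset.sum_congr ?_ fun _ _ => rfl
    ext i
    simp only [Finset.mem_filter, Finset.mem_range]
    omega
  · obtain ⟨b, hjb⟩ := Nat.exists_eq_add_of_lt hd
    have htail := h b (r.shift (-(d : ℤ)))
    rw [hw, map_zero] at htail
    have hb : ∀ i : ℕ, psi k ((r.shift (-(d : ℤ))).shift (-(i : ℤ))) (removeStrip (b - i) w) =
        psi k (r.shift (-((d + i : ℕ) : ℤ))) (removeStrip (j - (d + i)) w) := by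
      intro i
      rw [shift_shift, show b - i = j - (d + i) by omega]
      congr 3
      push_cast
      ring
    rw [Finset.sum_congr rfl fun i _ => hb i] at htail
    rw [show j + 1 = d + (b + 1) by omega, Finset.sum_range_add, ← htail, add_zero]
    refine Finset.sum_congr rfl fun i hi' => ?_
    have := Finset.mem_range.1 hi'
    rw [if_pos (by omega)]

theorem sum_piFinset_succ {M : Type*} [AddCommMonoid M] {l : ℕ} (s : Fin (l + 1) → Finset ℕ)
    (F : (Fin (l + 1) → ℕ) → M) : ∑ g ∈ Fintype.piFinset s, F g =
      ∑ a ∈ s 0, ∑ g ∈ Fintype.piFinset (Fin.tail s), F (Fin.cons a g : Fin (l + 1) → ℕ) := by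
  rw [← Finset.sum_product']
  refine Finset.sum_bij' (fun g _ => (g 0, Fin.tail g))
    (fun p _ => (Fin.cons p.1 p.2 : Fin (l + 1) → ℕ)) ?_ ?_ ?_ ?_ ?_
  · intro g hg
    rw [Fintype.mem_piFinset] at hg
    rw [Finset.mem_product, Fintype.mem_piFinset]
    exact ⟨hg 0, fun i => hg i.succ⟩
  · intro p hp
    rw [Finset.mem_product, Fintype.mem_piFinset] at hp
    rw [Fintype.mem_piFinset]
    intro i
    refine Fin.cases ?_ (fun i => ?_) i
    · exact hp.1
    · exact hp.2 i
  · intro g _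
    exact Fin.cons_self_tail g
  · intro p _
    simp
  · intro g _
    rw [Fin.cons_self_tail]

/-- The Pieri rule: `h_j^⊥` removes horizontal strips of size `j`.  The induction is on the number
of rows: `v = ψ_r w`, where `r` is the largest element, and `removeStrip_psi_apply` for the second
largest element `r - d` gives the interlacing condition `f 1 ≤ g 0 ≤ f 0`. -/
theorem removeStrip_vec_rowMaya [CharZero k] (j c l : ℕ) (f : ℕ → ℕ) (hf : Antitone f)
    (hl : f l = 0) : removeStrip j (vec k (rowMaya c l fun i => f i)) =
      ∑ g ∈ Fintype.piFinset (fun i : Fin l => Finset.Icc (f (i + 1)) (f i)),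
        if ∑ i, g i + j = ∑ i : Fin l, f i then vec k (rowMaya c l g) else 0 := by
  induction l generalizing j c f with
  | zero =>
    rw [Fintype.piFinset_of_isEmpty, Finset.univ_unique, Finset.sum_singleton]
    simp only [Finset.univ_eq_empty, Finset.sum_empty, zero_add, rowMaya]
    split_ifs with h
    · rw [h, removeStrip_zero]
      rfl
    · exact coeff_vertex_base Sum.inl_injective c fun h0 => h (Finsupp.single_eq_zero.1 h0)
  | succ l ih =>
    have hf' : Antitone fun i => f (i + 1) := fun a b hab => hf (Nat.succ_le_succ hab)
    have hvec : vec k (rowMaya c (l + 1) fun i => f i) =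
        psi k (hi ((f 0 : ℤ) - c - 1)) (vec k (rowMaya (c + 1) l fun i => f (i + 1))) := by
      rw [psi_vec_rowMaya fun i => hf (Nat.zero_le _)]
      congr 2
      funext i
      refine Fin.cases ?_ (fun i => ?_) i
      · rfl
      · rfl
    have hw : psi k ((hi ((f 0 : ℤ) - c - 1)).shift (-((f 0 - f 1 + 1 : ℕ) : ℤ)))
        (vec k (rowMaya (c + 1) l fun i => f (i + 1))) = 0 := by
      apply psi_vec_of_mem
      have h10 := hf (Nat.zero_le 1)
      rw [shift_hi, mem_rowMaya]
      rcases Nat.eq_zero_or_pos l with rfl | hpos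
      · right
        rw [zero_add] at hl
        push_cast
        omega
      · left
        refine ⟨⟨0, hpos⟩, ?_⟩
        simp only [zero_add]
        push_cast
        omega
    rw [hvec, removeStrip_psi_apply hw, sum_piFinset_succ]
    refine Finset.sum_bij' (fun i _ => f 0 - i) (fun a _ => f 0 - a) ?_ ?_ ?_ ?_ ?_
    · intro i hi'
      have := Finset.mem_range.1 hi'
      have h10 := hf (Nat.zero_le 1)
      simp only [Finset.mem_Icc, Fin.val_zero, zero_add]
      omega
    · intro a ha
      simp only [Finset.mem_Icc, Fin.val_zero, zero_add] at ha
      rw [Finset.mem_range]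
      omega
    · intro i hi'
      have := Finset.mem_range.1 hi'
      have h10 := hf (Nat.zero_le 1)
      omega
    · intro a ha
      simp only [Finset.mem_Icc, Fin.val_zero, zero_add] at ha
      omega
    · intro i hi'
      have hid := Finset.mem_range.1 hi'
      have h10 := hf (Nat.zero_le 1)
      have htail : Fin.tail (fun i : Fin (l + 1) => Finset.Icc (f (i + 1)) (f i)) =
          fun i : Fin l => Finset.Icc (f (i + 1 + 1)) (f (i + 1)) := rfl
      rw [htail, Fin.sum_univ_succ]
      have hbound : ∀ g ∈ Fintype.piFinset
          (fun i : Fin l => Finset.Icc (f (i + 1 + 1)) (f (i + 1))),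
          (∀ m, g m ≤ f 0 - i) ∧ ∑ m, g m ≤ ∑ m : Fin l, f (m + 1) := by
        intro g hg
        rw [Fintype.mem_piFinset] at hg
        refine ⟨fun m => ?_, Finset.sum_le_sum fun m _ => (Finset.mem_Icc.1 (hg m)).2⟩
        have h1 := (Finset.mem_Icc.1 (hg m)).2
        have h2 := hf (show 1 ≤ (m : ℕ) + 1 by omega)
        omega
      split_ifs with hij
      · rw [ih (j - i) (c + 1) (fun i => f (i + 1)) hf' hl, map_sum]
        refine Finset.sum_congr rfl fun g hg => ?_
        obtain ⟨h1, h2⟩ := hbound g hg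
        rw [Fin.sum_univ_succ]
        simp only [Fin.cons_zero, Fin.cons_succ, Fin.val_zero, Fin.val_succ]
        have hiff : (f 0 - i + ∑ m, g m + j = f 0 + ∑ m : Fin l, f (m + 1)) ↔
            (∑ m, g m + (j - i) = ∑ m : Fin l, f (m + 1)) := by omega
        simp only [hiff]
        split_ifs
        · rw [← psi_vec_rowMaya h1, shift_hi]
          congr 3
          push_cast [show i ≤ f 0 by omega]
          ring
        · rw [map_zero]
      · symm
        refine Finset.sum_eq_zero fun g hg => if_neg ?_
        obtain ⟨h1, h2⟩ := hbound g hg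
        rw [Fin.sum_univ_succ]
        simp only [Fin.cons_zero, Fin.cons_succ, Fin.val_zero, Fin.val_succ]
        omega

end Pieri

/-! ### Partitions as semi-infinite sets -/

section Diagrams

variable {k : Type*} [Field k]

/-- The Young diagram with row lengths `f 0 ≥ f 1 ≥ …`, where `f i = 0` for `i ≥ l`. -/
def diagramOfRows (f : ℕ → ℕ) (hf : Antitone f) (l : ℕ) : YoungDiagram where
  cells := (Finset.range l ×ˢ Finset.range (f 0)).filter fun c => c.2 < f c.1
  isLowerSet := by
    rintro ⟨i, j⟩ ⟨i', j'⟩ ⟨hi', hj'⟩ h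
    simp only [Finset.coe_filter, Finset.mem_product, Finset.mem_range, Set.mem_ofPred_eq] at h ⊢
    simp only at hi' hj'
    have := hf hi'
    omega

theorem eq_of_forall_lt_iff {a b : ℕ} (h : ∀ j, j < a ↔ j < b) : a = b :=
  le_antisymm (not_lt.1 fun hlt => lt_irrefl _ ((h b).1 hlt))
    (not_lt.1 fun hlt => lt_irrefl _ ((h a).2 hlt))

theorem rowLen_diagramOfRows {f : ℕ → ℕ} (hf : Antitone f) {l : ℕ} (hl : ∀ i, l ≤ i → f i = 0)
    (i : ℕ) : (diagramOfRows f hf l).rowLen i = f i := by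
  refine eq_of_forall_lt_iff fun j => ?_
  rw [← YoungDiagram.mem_iff_lt_rowLen, ← YoungDiagram.mem_cells]
  simp only [diagramOfRows, Finset.mem_filter, Finset.mem_product, Finset.mem_range]
  have h0 := hf (Nat.zero_le i)
  constructor
  · exact fun h => h.2
  · intro h
    refine ⟨⟨?_, by omega⟩, h⟩
    by_contra hli
    rw [hl i (not_lt.1 hli)] at h
    exact Nat.not_lt_zero _ h

theorem diagram_ext {lam mu : YoungDiagram} (h : ∀ i, lam.rowLen i = mu.rowLen i) : lam = mu := by
  apply YoungDiagram.ext
  ext ⟨i, j⟩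
  rw [YoungDiagram.mem_cells, YoungDiagram.mem_cells, YoungDiagram.mem_iff_lt_rowLen,
    YoungDiagram.mem_iff_lt_rowLen, h]

theorem rowLen_eq_zero {lam : YoungDiagram} {i : ℕ} (h : lam.colLen 0 ≤ i) : lam.rowLen i = 0 := by
  by_contra hne
  have h1 : (i, 0) ∈ lam := YoungDiagram.mem_iff_lt_rowLen.2 (Nat.pos_of_ne_zero hne)
  rw [YoungDiagram.mem_iff_lt_colLen] at h1
  omega

theorem card_eq_sum_rowLen (lam : YoungDiagram) {l : ℕ} (hl : lam.rowLen l = 0) :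
    lam.card = ∑ i : Fin l, lam.rowLen i := by
  rw [Fin.sum_univ_eq_sum_range fun i => lam.rowLen i, YoungDiagram.card,
    Finset.card_eq_sum_card_fiberwise (f := Prod.fst) (t := Finset.range l)]
  · refine Finset.sum_congr rfl fun i _ => ?_
    rw [YoungDiagram.rowLen_eq_card]
    rfl
  · rintro ⟨i, j⟩ hc
    rw [Finset.mem_coe, YoungDiagram.mem_cells, YoungDiagram.mem_iff_lt_rowLen] at hc
    rw [Finset.mem_coe, Finset.mem_range]
    by_contra hli
    have := lam.rowLen_anti l i (not_lt.1 hli)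
    omega

/-- The set `𝔖(λ)`, as an element of `Maya`. -/
def diagramMaya (lam : YoungDiagram) : Maya := rowMaya 0 (lam.colLen 0) fun i => lam.rowLen i

theorem mem_rowMaya_of_antitone {c l : ℕ} {f : ℕ → ℕ} (hl : ∀ i, l ≤ i → f i = 0) {n : ℤ} :
    hi n ∈ (rowMaya c l fun i => f i).1 ↔ ∃ i : ℕ, n = (f i : ℤ) - i - c - 1 := by
  rw [mem_rowMaya]
  constructor
  · rintro (⟨i, h⟩ | h)
    · exact ⟨i, h⟩
    · refine ⟨(-n - c - 1).toNat, ?_⟩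
      rw [hl _ (by omega)]
      push_cast at h ⊢
      omega
  · rintro ⟨i, h⟩
    by_cases hil : i < l
    · exact Or.inl ⟨⟨i, hil⟩, h⟩
    · right
      rw [hl i (not_lt.1 hil)] at h
      push_cast at h ⊢
      omega

theorem mem_diagramMaya {lam : YoungDiagram} {n : ℤ} :
    hi n ∈ (diagramMaya lam).1 ↔ ∃ i : ℕ, n = (lam.rowLen i : ℤ) - i - 1 := by
  rw [diagramMaya, mem_rowMaya_of_antitone (f := lam.rowLen) fun i hi' => rowLen_eq_zero hi']
  simp

theorem rowMaya_eq_diagramMaya {lam : YoungDiagram} {l : ℕ} {g : Fin l → ℕ}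
    (hg : ∀ i : Fin l, g i = lam.rowLen i) (hl : lam.rowLen l = 0) :
    rowMaya 0 l g = diagramMaya lam := by
  refine Maya.ext' fun r => ?_
  obtain ⟨n, rfl⟩ := hi_surjective r
  obtain rfl : g = fun i : Fin l => lam.rowLen i := funext hg
  rw [mem_diagramMaya, mem_rowMaya_of_antitone (f := lam.rowLen)]
  · simp
  · intro i hi'
    have := lam.rowLen_anti l i hi'
    omega

theorem diagramMaya_val (lam : YoungDiagram) : (diagramMaya lam).1 = frakS lam := by
  ext r
  obtain ⟨n, rfl⟩ := hi_surjective r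
  rw [mem_diagramMaya]
  refine exists_congr fun i => ?_
  change _ ↔ (n : ℚ) + 1 / 2 = (lam.rowLen i : ℚ) - ((i : ℚ) + 1) + 1 / 2
  constructor
  · rintro rfl
    push_cast
    ring
  · intro h
    have : (n : ℚ) = (((lam.rowLen i : ℤ) - i - 1 : ℤ) : ℚ) := by
      push_cast
      linarith
    exact_mod_cast this

theorem rowLen_eq_of_mem_iff {f g : ℕ → ℕ} (hf : Antitone f) (hg : Antitone g)
    (h : ∀ n : ℤ, (∃ i : ℕ, n = (f i : ℤ) - i - 1) ↔ ∃ i : ℕ, n = (g i : ℤ) - i - 1) (i : ℕ) :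
    f i = g i := by
  -- the sequences `f i - i - 1` and `g i - i - 1` are strictly decreasing with the same range
  have hm : ∀ {f : ℕ → ℕ}, Antitone f → ∀ {a b : ℕ}, a < b →
      (f b : ℤ) - b - 1 < (f a : ℤ) - a - 1 := by
    intro f hf a b hab
    have := hf hab.le
    omega
  induction i using Nat.strong_induction_on with
  | _ i ih =>
    obtain ⟨a, ha⟩ := (h _).1 ⟨i, rfl⟩
    obtain ⟨b, hb⟩ := (h _).2 ⟨i, rfl⟩
    have h1 : i ≤ a := by
      by_contra hlt
      have := hm hf (not_le.1 hlt)
      rw [ih a (not_le.1 hlt)] at this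
      omega
    have h2 : i ≤ b := by
      by_contra hlt
      have := hm hg (not_le.1 hlt)
      rw [← ih b (not_le.1 hlt)] at this
      omega
    rcases h1.eq_or_lt with rfl | h1
    · omega
    rcases h2.eq_or_lt with rfl | h2
    · omega
    have := hm hf h2
    have := hm hg h1
    omega

theorem diagramMaya_injective : Function.Injective diagramMaya := by
  intro lam mu h
  refine diagram_ext (rowLen_eq_of_mem_iff (fun a b => lam.rowLen_anti a b)
    (fun a b => mu.rowLen_anti a b) fun n => ?_)
  rw [← mem_diagramMaya, ← mem_diagramMaya, h]

theorem diagramMaya_bot : diagramMaya ⊥ = Maya.vac := by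
  refine Maya.ext' fun r => ?_
  obtain ⟨n, rfl⟩ := hi_surjective r
  have h0 : ∀ i, (⊥ : YoungDiagram).rowLen i = 0 := by
    intro i
    by_contra hne
    exact YoungDiagram.notMem_bot _
      (YoungDiagram.mem_iff_lt_rowLen.2 (Nat.pos_of_ne_zero hne))
  rw [mem_diagramMaya]
  change _ ↔ hi n ∈ negHalf
  rw [hi_mem_negHalf]
  simp only [h0]
  constructor
  · rintro ⟨i, h⟩
    push_cast at h
    omega
  · intro h
    exact ⟨(-n - 1).toNat, by push_cast; omega⟩

/-- `lam / mu` is a horizontal strip of size `j`. -/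
def IsStrip (lam mu : YoungDiagram) (j : ℕ) : Prop :=
  (∀ i, lam.rowLen (i + 1) ≤ mu.rowLen i ∧ mu.rowLen i ≤ lam.rowLen i) ∧ mu.card + j = lam.card

theorem finite_strips (lam : YoungDiagram) (j : ℕ) : {mu | IsStrip lam mu j}.Finite :=
  (finite_card_le lam.card).subset fun mu h => by
    have := h.2
    change mu.card ≤ lam.card
    omega

/-- The diagrams obtained from `lam` by removing a horizontal strip of size `j`. -/
noncomputable def strips (lam : YoungDiagram) (j : ℕ) : Finset YoungDiagram :=
  (finite_strips lam j).toFinset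

theorem mem_strips {lam mu : YoungDiagram} {j : ℕ} : mu ∈ strips lam j ↔ IsStrip lam mu j :=
  Set.Finite.mem_toFinset _

theorem removeStrip_diagramMaya [CharZero k] (j : ℕ) (lam : YoungDiagram) :
    removeStrip j (vec k (diagramMaya lam)) = ∑ mu ∈ strips lam j, vec k (diagramMaya mu) := by
  set l := lam.colLen 0 with hl
  have hl0 : ∀ i, l ≤ i → lam.rowLen i = 0 := fun i hi' => rowLen_eq_zero hi'
  rw [diagramMaya, removeStrip_vec_rowMaya j 0 _ lam.rowLen (fun a b => lam.rowLen_anti a b)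
    (hl0 l le_rfl), ← Finset.sum_filter]
  symm
  refine Finset.sum_bij (fun mu _ => fun i : Fin l => mu.rowLen i) ?_ ?_ ?_ ?_
  · intro mu hmu
    rw [mem_strips] at hmu
    have hmul : mu.rowLen l = 0 := by
      have := (hmu.1 l).2
      rw [hl0 l le_rfl] at this
      omega
    rw [Finset.mem_filter, Fintype.mem_piFinset]
    refine ⟨fun i => Finset.mem_Icc.2 (hmu.1 i), ?_⟩
    rw [← card_eq_sum_rowLen mu hmul, ← card_eq_sum_rowLen lam (hl0 l le_rfl), hmu.2]
  · intro mu hmu nu hnu h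
    rw [mem_strips] at hmu hnu
    refine diagram_ext fun i => ?_
    by_cases hil : i < l
    · exact congrFun h ⟨i, hil⟩
    · have h1 := (hmu.1 i).2
      have h2 := (hnu.1 i).2
      rw [hl0 i (not_lt.1 hil)] at h1 h2
      omega
  · intro g hg
    rw [Finset.mem_filter, Fintype.mem_piFinset] at hg
    obtain ⟨hg1, hg2⟩ := hg
    let f : ℕ → ℕ := fun i => if h : i < l then g ⟨i, h⟩ else 0
    have hfi : ∀ i, lam.rowLen (i + 1) ≤ f i ∧ f i ≤ lam.rowLen i := by
      intro i
      by_cases h : i < l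
      · simp only [f, dif_pos h]
        exact Finset.mem_Icc.1 (hg1 ⟨i, h⟩)
      · simp only [f, dif_neg h, hl0 i (not_lt.1 h), hl0 (i + 1) (by omega)]
        omega
    have hf : Antitone f := antitone_nat_of_succ_le fun i => (hfi (i + 1)).2.trans (hfi i).1
    have hfl : ∀ i, l ≤ i → f i = 0 := fun i hi' => by simp only [f, dif_neg (not_lt.2 hi')]
    have hrow := rowLen_diagramOfRows hf hfl
    have hgf : (fun i : Fin l => (diagramOfRows f hf l).rowLen i) = g := by
      funext i
      rw [hrow]
      simp only [f, dif_pos i.2]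
    refine ⟨diagramOfRows f hf l, ?_, hgf⟩
    rw [mem_strips]
    refine ⟨fun i => by rw [hrow]; exact hfi i, ?_⟩
    rw [card_eq_sum_rowLen (diagramOfRows f hf l) ((hrow l).trans (hfl l le_rfl)),
      card_eq_sum_rowLen lam (hl0 l le_rfl), ← hg2]
    exact congrArg (fun h : Fin l → ℕ => ∑ i, h i + j) hgf
  · intro mu hmu
    rw [mem_strips] at hmu
    rw [rowMaya_eq_diagramMaya (lam := mu) fun i => rfl]
    · have := (hmu.1 l).2
      rw [hl0 l le_rfl] at this
      omega

end Diagrams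

/-! ### Schur functions and the vertex operators -/

section Tableaux

open MvPowerSeries

variable {k : Type*} [Field k]

/-- The exponent of the monomial attached to a tableau. -/
noncomputable def content (e : ℕ → ℕ ⊕ ℕ) {lam : YoungDiagram} (T : SemistandardYoungTableau lam) :
    ℕ ⊕ ℕ →₀ ℕ := ∑ c ∈ lam.cells, Finsupp.single (e (T c.1 c.2)) 1

theorem finite_content (e : ℕ → ℕ ⊕ ℕ) (he : Function.Injective e) (lam : YoungDiagram)
    (m : ℕ ⊕ ℕ →₀ ℕ) : {T : SemistandardYoungTableau lam | content e T = m}.Finite := by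
  refine (summable_schur (k := ℚ) e he lam m).subset fun T hT => ?_
  have hT' : content e T = m := hT
  rw [Function.mem_support]
  beta_reduce
  rw [prod_X e lam fun c => T c.1 c.2, coeff_monomial,
    if_pos (show m = ∑ c ∈ lam.cells, Finsupp.single (e (T c.1 c.2)) 1 from hT'.symm)]
  exact one_ne_zero

/-- The tableaux with given content. -/
noncomputable def tableaux {e : ℕ → ℕ ⊕ ℕ} (he : Function.Injective e) (lam : YoungDiagram)
    (m : ℕ ⊕ ℕ →₀ ℕ) : Finset (SemistandardYoungTableau lam) := (finite_content e he lam m).toFinset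

theorem mem_tableaux {e : ℕ → ℕ ⊕ ℕ} {he : Function.Injective e} {lam : YoungDiagram}
    {m : ℕ ⊕ ℕ →₀ ℕ} {T : SemistandardYoungTableau lam} :
    T ∈ tableaux he lam m ↔ content e T = m := Set.Finite.mem_toFinset _

theorem coeff_schur_eq_card {e : ℕ → ℕ ⊕ ℕ} (he : Function.Injective e) (lam : YoungDiagram)
    (m : ℕ ⊕ ℕ →₀ ℕ) : coeff m (schur (fun i => (X (e i) : Scalar k)) lam) =
      ((tableaux he lam m).card : k) := by
  classical
  have h : ∀ T : SemistandardYoungTableau lam,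
      coeff m (∏ c ∈ lam.cells, (X (e (T c.1 c.2)) : Scalar k)) =
        if content e T = m then 1 else 0 := by
    intro T
    rw [prod_X e lam fun c => T c.1 c.2, coeff_monomial]
    exact if_congr eq_comm rfl rfl
  rw [schur, coeff_formalSum, finsum_congr h,
    finsum_eq_sum_of_support_subset (s := tableaux he lam m), Finset.sum_congr rfl fun T hT => ?_,
    Finset.sum_const, nsmul_one]
  · exact if_pos (mem_tableaux.1 hT)
  · intro T hT
    by_contra hT'
    exact hT (if_neg fun h => hT' (mem_tableaux.2 h))

/-- The shape formed by the letters smaller than `N`. -/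
def lowerShape {lam : YoungDiagram} (T : SemistandardYoungTableau lam) (N : ℕ) : YoungDiagram where
  cells := lam.cells.filter fun c => T c.1 c.2 < N
  isLowerSet := by
    rintro ⟨i, j⟩ ⟨i', j'⟩ ⟨hi', hj'⟩ h
    simp only [Finset.coe_filter, YoungDiagram.mem_cells, Set.mem_ofPred_eq] at h ⊢
    simp only at hi' hj'
    have h1 := T.row_weak_of_le hj' (lam.up_left_mem le_rfl le_rfl h.1)
    have h2 := T.col_weak hi' (lam.up_left_mem le_rfl hj' h.1)
    exact ⟨lam.up_left_mem hi' hj' h.1, by omega⟩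

theorem mem_lowerShape {lam : YoungDiagram} {T : SemistandardYoungTableau lam} {N i j : ℕ} :
    (i, j) ∈ lowerShape T N ↔ (i, j) ∈ lam ∧ T i j < N := by
  rw [← YoungDiagram.mem_cells]
  simp [lowerShape]

/-- The restriction of a tableau to a smaller shape. -/
def restrictTableau {lam mu : YoungDiagram} (h : ∀ i j, (i, j) ∈ mu → (i, j) ∈ lam)
    (T : SemistandardYoungTableau lam) : SemistandardYoungTableau mu where
  entry i j := if (i, j) ∈ mu then T i j else 0
  row_weak' {i j1 j2} hj hc := by
    rw [if_pos hc, if_pos (mu.up_left_mem le_rfl hj.le hc)]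
    exact T.row_weak hj (h _ _ hc)
  col_strict' {i1 i2 j} hi' hc := by
    rw [if_pos hc, if_pos (mu.up_left_mem hi'.le le_rfl hc)]
    exact T.col_strict hi' (h _ _ hc)
  zeros' hc := if_neg hc

theorem restrictTableau_apply {lam mu : YoungDiagram} (h : ∀ i j, (i, j) ∈ mu → (i, j) ∈ lam)
    (T : SemistandardYoungTableau lam) {i j : ℕ} (hc : (i, j) ∈ mu) :
    restrictTableau h T i j = T i j := if_pos hc

/-- Fill the horizontal strip `lam / mu` with the letter `N`. -/
def extendTableau {lam mu : YoungDiagram} {N j : ℕ} (h : IsStrip lam mu j)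
    (T : SemistandardYoungTableau mu) (hT : ∀ a b, (a, b) ∈ mu → T a b < N) :
    SemistandardYoungTableau lam where
  entry a b := if (a, b) ∈ mu then T a b else if (a, b) ∈ lam then N else 0
  row_weak' {i j1 j2} hj hc := by
    have hc1 := lam.up_left_mem le_rfl hj.le hc
    by_cases h2 : (i, j2) ∈ mu
    · rw [if_pos h2, if_pos (mu.up_left_mem le_rfl hj.le h2)]
      exact T.row_weak hj h2
    · rw [if_neg h2, if_pos hc]
      split_ifs with h1
      · exact (hT _ _ h1).le
      · exact le_rfl
  col_strict' {i1 i2 j} hi' hc := by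
    have h1 : (i1, j) ∈ mu := by
      rw [YoungDiagram.mem_iff_lt_rowLen] at hc ⊢
      have h3 := lam.rowLen_anti (i1 + 1) i2 hi'
      have h4 := (h.1 i1).1
      omega
    rw [if_pos h1]
    by_cases h2 : (i2, j) ∈ mu
    · rw [if_pos h2]
      exact T.col_strict hi' h2
    · rw [if_neg h2, if_pos hc]
      exact hT _ _ h1
  zeros' {a b} hc := by
    have h1 : (a, b) ∉ mu := by
      rw [YoungDiagram.mem_iff_lt_rowLen] at hc ⊢
      have h4 := (h.1 a).2
      omega
    rw [if_neg h1, if_neg hc]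

theorem extendTableau_apply {lam mu : YoungDiagram} {N j : ℕ} (h : IsStrip lam mu j)
    (T : SemistandardYoungTableau mu) (hT : ∀ a b, (a, b) ∈ mu → T a b < N) (a b : ℕ) :
    extendTableau h T hT a b =
      if (a, b) ∈ mu then T a b else if (a, b) ∈ lam then N else 0 := rfl

theorem content_apply_pos {e : ℕ → ℕ ⊕ ℕ} {lam : YoungDiagram} (T : SemistandardYoungTableau lam)
    {i j : ℕ} (h : (i, j) ∈ lam) : content e T (e (T i j)) ≠ 0 := by
  rw [content, Finsupp.finsetSum_apply]
  refine (Finset.sum_pos' (fun _ _ => Nat.zero_le _) ⟨(i, j), h, ?_⟩).ne'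
  simp

theorem content_eq_zero {e : ℕ → ℕ ⊕ ℕ} (he : Function.Injective e) {lam : YoungDiagram}
    (T : SemistandardYoungTableau lam) {N : ℕ} (h : ∀ i j, (i, j) ∈ lam → T i j ≠ N) :
    content e T (e N) = 0 := by
  rw [content, Finsupp.finsetSum_apply]
  exact Finset.sum_eq_zero fun c hc =>
    Finsupp.single_eq_of_ne fun heq => h c.1 c.2 hc (he heq).symm

/-- The content of a tableau whose largest letter `N` fills the skew shape `lam / mu`. -/
theorem content_eq_add {e : ℕ → ℕ ⊕ ℕ} {lam mu : YoungDiagram}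
    (h : ∀ i j, (i, j) ∈ mu → (i, j) ∈ lam) (T : SemistandardYoungTableau lam)
    (T' : SemistandardYoungTableau mu) {N : ℕ} (h1 : ∀ i j, (i, j) ∈ mu → T' i j = T i j)
    (h2 : ∀ i j, (i, j) ∈ lam → (i, j) ∉ mu → T i j = N) :
    mu.card ≤ lam.card ∧
      content e T = content e T' + Finsupp.single (e N) (lam.card - mu.card) := by
  have hsub : mu.cells ⊆ lam.cells := fun c hc => h c.1 c.2 hc
  refine ⟨Finset.card_le_card hsub, ?_⟩
  rw [content, content, ← Finset.sum_sdiff hsub, add_comm]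
  congr 1
  · exact Finset.sum_congr rfl fun c hc => by rw [h1 c.1 c.2 hc]
  · rw [Finset.sum_congr rfl fun c hc => by
      rw [h2 c.1 c.2 (Finset.mem_sdiff.1 hc).1 (Finset.mem_sdiff.1 hc).2], Finset.sum_const,
      Finset.card_sdiff_of_subset hsub, Finsupp.smul_single, nsmul_one]
    rfl

/-- The branching rule for the number of tableaux: if `N` is the largest letter, the letters smaller
than `N` form a tableau on a shape `mu` for which `lam / mu` is a horizontal strip, because a column
contains `N` at most once. -/
theorem card_tableaux {e : ℕ → ℕ ⊕ ℕ} (he : Function.Injective e) (lam : YoungDiagram) {N : ℕ}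
    {m : ℕ ⊕ ℕ →₀ ℕ} (hm : ∀ a, m a ≠ 0 → ∃ i < N, a = e i) (j : ℕ) :
    (tableaux he lam (m + Finsupp.single (e N) j)).card =
      ∑ mu ∈ strips lam j, (tableaux he mu m).card := by
  classical
  have hmN : m (e N) = 0 := by
    by_contra hne
    obtain ⟨i, hi', h⟩ := hm _ hne
    exact hi'.ne' (he h)
  have hle : ∀ T ∈ tableaux he lam (m + Finsupp.single (e N) j), ∀ a b, (a, b) ∈ lam →
      T a b ≤ N := by
    intro T hT a b hc
    have h1 := content_apply_pos (e := e) T hc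
    rw [mem_tableaux.1 hT, Finsupp.add_apply] at h1
    by_cases h2 : m (e (T a b)) = 0
    · rw [h2, zero_add] at h1
      have h3 : e N = e (T a b) := by
        by_contra hne
        exact h1 (Finsupp.single_eq_of_ne (Ne.symm hne))
      exact (he h3).ge
    · obtain ⟨i, hi', h⟩ := hm _ h2
      rw [he h]
      exact hi'.le
  have hlt : ∀ mu, ∀ T ∈ tableaux he mu m, ∀ a b, (a, b) ∈ mu → T a b < N := by
    intro mu T hT a b hc
    have h1 := content_apply_pos (e := e) T hc
    rw [mem_tableaux.1 hT] at h1
    obtain ⟨i, hi', h⟩ := hm _ h1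
    rwa [he h]
  have hres : ∀ T ∈ tableaux he lam (m + Finsupp.single (e N) j),
      ∀ (T' : SemistandardYoungTableau (lowerShape T N)),
      (∀ a b, (a, b) ∈ lowerShape T N → T' a b = T a b) →
      content e T' = m ∧ (lowerShape T N).card + j = lam.card := by
    intro T hT T' hT'
    obtain ⟨hcard, hcont⟩ := content_eq_add (e := e) (fun a b h => (mem_lowerShape.1 h).1) T T' hT'
      (N := N) fun a b h h' => le_antisymm (hle T hT a b h)
        (not_lt.1 fun hlt' => h' (mem_lowerShape.2 ⟨h, hlt'⟩))
    rw [mem_tableaux.1 hT] at hcont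
    have hz : content e T' (e N) = 0 := content_eq_zero he T' fun a b h hN => by
      rw [hT' a b h] at hN
      exact (mem_lowerShape.1 h).2.ne hN
    have hj := congrArg (fun p : ℕ ⊕ ℕ →₀ ℕ => p (e N)) hcont
    simp only [Finsupp.add_apply, hmN, hz, Finsupp.single_eq_same, zero_add] at hj
    rw [← hj] at hcont
    exact ⟨(add_right_cancel hcont).symm, by omega⟩
  rw [Finset.card_eq_sum_card_fiberwise (f := fun T => lowerShape T N) (t := strips lam j)]
  · refine Finset.sum_congr rfl fun mu hmu => ?_
    have hstrip := mem_strips.1 hmu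
    have hsub : ∀ a b, (a, b) ∈ mu → (a, b) ∈ lam := by
      intro a b h
      rw [YoungDiagram.mem_iff_lt_rowLen] at h ⊢
      exact h.trans_le (hstrip.1 a).2
    refine Finset.card_bij (fun T _ => restrictTableau hsub T) ?_ ?_ ?_
    · intro T hT
      obtain ⟨hT0, rfl⟩ := Finset.mem_filter.1 hT
      rw [mem_tableaux]
      exact (hres T hT0 _ fun a b h => restrictTableau_apply hsub T h).1
    · intro T hT T' hT' h
      obtain ⟨hT0, rfl⟩ := Finset.mem_filter.1 hT
      obtain ⟨hT0', hmu'⟩ := Finset.mem_filter.1 hT'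
      ext a b
      by_cases hc : (a, b) ∈ lam
      · by_cases hc' : (a, b) ∈ lowerShape T N
        · rw [← restrictTableau_apply hsub T hc', h, restrictTableau_apply hsub T' hc']
        · have hc'' : (a, b) ∉ lowerShape T' N := by rwa [hmu']
          rw [le_antisymm (hle T hT0 a b hc)
              (not_lt.1 fun hlt' => hc' (mem_lowerShape.2 ⟨hc, hlt'⟩)),
            le_antisymm (hle T' hT0' a b hc)
              (not_lt.1 fun hlt' => hc'' (mem_lowerShape.2 ⟨hc, hlt'⟩))]
      · rw [T.zeros hc, T'.zeros hc]
    · intro T' hT'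
      have hlt' := hlt mu T' hT'
      refine ⟨extendTableau hstrip T' hlt', Finset.mem_filter.2 ⟨?_, ?_⟩, ?_⟩
      · obtain ⟨hcard, hcont⟩ := content_eq_add (e := e) hsub (extendTableau hstrip T' hlt') T'
          (N := N) (fun a b h => by rw [extendTableau_apply, if_pos h])
          fun a b h h' => by rw [extendTableau_apply, if_neg h', if_pos h]
        rw [mem_tableaux, hcont, mem_tableaux.1 hT']
        have := hstrip.2
        rw [show lam.card - mu.card = j by omega]
      · apply YoungDiagram.ext
        ext ⟨a, b⟩
        rw [YoungDiagram.mem_cells, YoungDiagram.mem_cells, mem_lowerShape, extendTableau_apply]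
        split_ifs with h1 h2
        · exact ⟨fun _ => h1, fun _ => ⟨hsub a b h1, hlt' a b h1⟩⟩
        · exact ⟨fun h => absurd h.2 (lt_irrefl _), fun h => absurd h h1⟩
        · exact ⟨fun h => absurd h.1 h2, fun h => absurd h h1⟩
      · ext a b
        by_cases hc : (a, b) ∈ mu
        · rw [restrictTableau_apply hsub _ hc, extendTableau_apply, if_pos hc]
        · rw [T'.zeros hc, SemistandardYoungTableau.zeros _ hc]
  · intro T hT
    rw [Finset.mem_coe] at hT
    rw [Finset.mem_coe, mem_strips]
    refine ⟨fun i => ⟨?_, ?_⟩, (hres T hT (restrictTableau (fun a b h => (mem_lowerShape.1 h).1) T)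
      fun a b h => restrictTableau_apply _ T h).2⟩
    · by_contra hlt'
      rw [not_le] at hlt'
      have h1 : (i + 1, (lowerShape T N).rowLen i) ∈ lam := YoungDiagram.mem_iff_lt_rowLen.2 hlt'
      have h2 := T.col_strict (show i < i + 1 by omega) h1
      have h3 := hle T hT _ _ h1
      have h4 : (i, (lowerShape T N).rowLen i) ∈ lowerShape T N :=
        mem_lowerShape.2 ⟨lam.up_left_mem (Nat.le_succ i) le_rfl h1, h2.trans_le h3⟩
      exact lt_irrefl _ (YoungDiagram.mem_iff_lt_rowLen.1 h4)
    · by_contra hlt'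
      rw [not_le] at hlt'
      have h1 := (mem_lowerShape.1 (YoungDiagram.mem_iff_lt_rowLen.2 hlt')).1
      exact lt_irrefl _ (YoungDiagram.mem_iff_lt_rowLen.1 h1)

/-- The matrix elements of `Γ_+` between `v_λ` and the vacuum are the Schur functions: both satisfy
the same branching rule. -/
theorem coeff_schur_eq_vertex [CharZero k] {e : ℕ → ℕ ⊕ ℕ} (he : Function.Injective e)
    (lam : YoungDiagram) (m : ℕ ⊕ ℕ →₀ ℕ) :
    coeff m (schur (fun i => (X (e i) : Scalar k)) lam) =
      (coeff m (vertex e lower) (vec k (diagramMaya lam))) Maya.vac := by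
  classical
  by_cases hr : ∀ a, m a ≠ 0 → ∃ i, a = e i
  · have hN : ∃ N, ∀ a, m a ≠ 0 → ∃ i < N, a = e i := by
      obtain ⟨N, hN⟩ := ((Finset.finite_toSet m.support).preimage he.injOn).bddAbove
      refine ⟨N + 1, fun a ha => ?_⟩
      obtain ⟨i, rfl⟩ := hr a ha
      exact ⟨i, Nat.lt_succ_of_le (hN (by simpa using ha)), rfl⟩
    obtain ⟨N, hN⟩ := hN
    clear hr
    induction N generalizing m lam with
    | zero =>
      have hm : m = 0 := by
        ext a
        by_contra hne
        obtain ⟨i, hi', -⟩ := hN a hne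
        exact Nat.not_lt_zero _ hi'
      subst hm
      rw [coeff_zero_eq_constantCoeff_apply (vertex e lower), constantCoeff_vertex,
        Module.End.one_apply]
      by_cases hlam : lam = ⊥
      · rw [hlam, schur_bot, diagramMaya_bot]
        simp [vec]
      · have hne : diagramMaya lam ≠ Maya.vac := by
          rw [← diagramMaya_bot]
          exact fun h => hlam (diagramMaya_injective h)
        rw [vec, Finsupp.single_eq_of_ne hne.symm]
        by_contra h
        have h1 := coeff_schur e lam 0 h
        rw [map_zero, eq_comm, YoungDiagram.card, Finset.card_eq_zero] at h1
        exact hlam (YoungDiagram.ext (by simpa using h1))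
    | succ N ih =>
      obtain ⟨m', j, hm', rfl⟩ : ∃ (m' : ℕ ⊕ ℕ →₀ ℕ) (j : ℕ), (∀ a, m' a ≠ 0 → ∃ i < N, a = e i) ∧
          m = m' + Finsupp.single (e N) j := by
        refine ⟨m.erase (e N), m (e N), fun a ha => ?_, (Finsupp.erase_add_single _ _).symm⟩
        have hne : a ≠ e N := by
          rintro rfl
          exact ha Finsupp.erase_same
        rw [Finsupp.erase_ne hne] at ha
        obtain ⟨i, hi', rfl⟩ := hN a ha
        refine ⟨i, ?_, rfl⟩
        have : i ≠ N := fun h => hne (by rw [h])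
        omega
      have hm'N : m' (e N) = 0 := by
        by_contra hne
        obtain ⟨i, hi', h⟩ := hm' _ hne
        exact hi'.ne' (he h)
      rw [coeff_schur_eq_card he, card_tableaux he lam hm', coeff_vertex_add_single he hm'N,
        Module.End.mul_apply, removeStrip_diagramMaya, map_sum, Nat.cast_sum,
        Finsupp.finsetSum_apply]
      refine Finset.sum_congr rfl fun mu _ => ?_
      rw [← ih mu m' hm', coeff_schur_eq_card he]
  · push Not at hr
    obtain ⟨a, ha, hea⟩ := hr
    rw [coeff_vertex_eq_zero he lower_commute (fun i h => hea i h.symm) ha, LinearMap.zero_apply,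
      coeff_schur_eq_card he, Finset.card_eq_zero.2]
    · simp
    · rw [Finset.eq_empty_iff_forall_notMem]
      intro T hT
      rw [mem_tableaux] at hT
      rw [← hT, content, Finsupp.finsetSum_apply] at ha
      exact ha (Finset.sum_eq_zero fun c _ => Finsupp.single_eq_of_ne (hea _))

end Tableaux

/-! ### Conservation of charge -/

section Charge

open MvPowerSeries

variable {k : Type*} [Field k]

/-- `S` consists of the half-integers smaller than `-c` and of `l` larger ones; its charge is then
`l - c`. -/
def HasCharge (c l : ℕ) (S : Maya) : Prop :=
  ∃ F : Finset ℤ, F.card = l ∧ (∀ n ∈ F, -(c : ℤ) ≤ n) ∧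
    ∀ n, hi n ∈ S.1 ↔ n ∈ F ∨ n < -(c : ℤ)

theorem hi_injective : Function.Injective hi := fun _ _ h => hi_inj.1 h

theorem exists_hasCharge (S : Maya) : ∃ c l, HasCharge c l S := by
  classical
  have hneg : {n : ℤ | hi n ∈ negHalf \ S.1}.Finite := S.2.2.preimage hi_injective.injOn
  have hpos : {n : ℤ | hi n ∈ S.1 \ negHalf}.Finite := S.2.1.preimage hi_injective.injOn
  obtain ⟨b, hb⟩ := hneg.bddBelow
  refine ⟨b.natAbs, _, hpos.toFinset ∪
      (Finset.Ico (-(b.natAbs : ℤ)) 0).filter (fun n => hi n ∈ S.1),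
    rfl, ?_, ?_⟩
  · intro n hn
    rw [Finset.mem_union, Set.Finite.mem_toFinset, Finset.mem_filter, Finset.mem_Ico] at hn
    rcases hn with hn | hn
    · have h1 : ¬ n < 0 := fun h => hn.2 (hi_mem_negHalf.2 h)
      omega
    · exact hn.1.1
  · intro n
    rw [Finset.mem_union, Set.Finite.mem_toFinset, Finset.mem_filter, Finset.mem_Ico]
    constructor
    · intro hn
      by_cases h0 : n < 0
      · by_cases hc : n < -(b.natAbs : ℤ)
        · exact Or.inr hc
        · exact Or.inl (Or.inr ⟨⟨not_lt.1 hc, h0⟩, hn⟩)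
      · exact Or.inl (Or.inl ⟨hn, fun h => h0 (hi_mem_negHalf.1 h)⟩)
    · rintro ((hn | hn) | hn)
      · exact hn.1
      · exact hn.2
      · by_contra hS
        have := hb (show hi n ∈ negHalf \ S.1 from ⟨hi_mem_negHalf.2 (by omega), hS⟩)
        omega

/-- A set of `l` integers `≥ -(c + l)` consists of the numbers `f i - i - c - 1`, `i < l`, for a
partition `f`. -/
theorem exists_rows (l c : ℕ) (F : Finset ℤ) (hF : F.card = l)
    (hle : ∀ n ∈ F, -((c + l : ℕ) : ℤ) ≤ n) : ∃ f : ℕ → ℕ, Antitone f ∧ (∀ i, l ≤ i → f i = 0) ∧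
      ∀ n, n ∈ F ↔ ∃ i < l, n = (f i : ℤ) - i - c - 1 := by
  induction l generalizing c F with
  | zero =>
    rw [Finset.card_eq_zero] at hF
    exact ⟨fun _ => 0, fun _ _ _ => le_rfl, fun _ _ => rfl, by simp [hF]⟩
  | succ l ih =>
    have hne : F.Nonempty := Finset.card_pos.1 (by omega)
    set a := F.max' hne with ha
    have haF : a ∈ F := F.max'_mem hne
    obtain ⟨f, hf, hfl, hfF⟩ := ih (c + 1) (F.erase a) (by rw [Finset.card_erase_of_mem haF]; omega)
      fun n hn => by
        have := hle n (Finset.mem_of_mem_erase hn)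
        push_cast at this ⊢
        linarith
    have hlt : ∀ n ∈ F.erase a, n < a := fun n hn =>
      lt_of_le_of_ne (F.le_max' n (Finset.mem_of_mem_erase hn)) (Finset.ne_of_mem_erase hn)
    have hfa : (f 0 : ℤ) ≤ a + c + 1 := by
      rcases Nat.eq_zero_or_pos l with rfl | hpos
      · have := hle a haF
        rw [hfl 0 le_rfl]
        push_cast at this ⊢
        linarith
      · have := hlt _ ((hfF _).2 ⟨0, hpos, rfl⟩)
        push_cast at this
        linarith
    obtain ⟨b, hb⟩ := Int.eq_ofNat_of_zero_le (a := a + c + 1) (by omega)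
    refine ⟨fun i => Nat.casesOn i b f, antitone_nat_of_succ_le fun i => ?_, fun i hi' => ?_,
      fun n => ?_⟩
    · cases i with
      | zero => exact_mod_cast (hb ▸ hfa : (f 0 : ℤ) ≤ b)
      | succ i => exact hf (Nat.le_succ i)
    · cases i with
      | zero => omega
      | succ i => exact hfl i (by omega)
    · have hsplit : n ∈ F ↔ n = a ∨ n ∈ F.erase a := by
        rw [Finset.mem_erase]
        by_cases h : n = a
        · simp [h, haF]
        · simp [h]
      rw [hsplit, hfF]
      constructor
      · rintro (rfl | ⟨i, hi', rfl⟩)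
        · refine ⟨0, Nat.succ_pos l, ?_⟩
          change a = (b : ℤ) - (0 : ℕ) - c - 1
          push_cast
          omega
        · refine ⟨i + 1, by omega, ?_⟩
          simp only
          push_cast
          ring
      · rintro ⟨i, hi', rfl⟩
        cases i with
        | zero =>
          left
          change (b : ℤ) - (0 : ℕ) - c - 1 = a
          push_cast
          omega
        | succ i =>
          right
          refine ⟨i, by omega, ?_⟩
          simp only
          push_cast
          ring

theorem exists_diagramMaya {c : ℕ} {S : Maya} (h : HasCharge c c S) :
    ∃ lam, diagramMaya lam = S := by
  obtain ⟨F, hF, hle, hS⟩ := h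
  obtain ⟨f, hf, hfl, hfF⟩ := exists_rows c 0 F hF fun n hn => by
    rw [zero_add]
    exact hle n hn
  have hrow := rowLen_diagramOfRows hf hfl
  refine ⟨diagramOfRows f hf c, Maya.ext' fun r => ?_⟩
  obtain ⟨n, rfl⟩ := hi_surjective r
  rw [← rowMaya_eq_diagramMaya (lam := diagramOfRows f hf c) (l := c) (g := fun i => f i)
    (fun i => (hrow i).symm) ((hrow c).trans (hfl c le_rfl)), mem_rowMaya, hS, hfF, zero_add]
  refine or_congr ⟨?_, ?_⟩ Iff.rfl
  · rintro ⟨i, h⟩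
    exact ⟨i, i.2, h⟩
  · rintro ⟨i, hi', h⟩
    exact ⟨⟨i, hi'⟩, h⟩

variable (k) in
/-- The span of the `v_S` with `HasCharge c l S`. -/
noncomputable def chargeSpace (c l : ℕ) : Submodule k (Wedge k) :=
  Submodule.span k (vec k '' {S | HasCharge c l S})

theorem alpha_mem_chargeSpace {n : ℤ} (hn : 0 < n) {c l : ℕ} {f : Wedge k}
    (hf : f ∈ chargeSpace k c l) : alpha k n f ∈ chargeSpace k c l := by
  classical
  induction hf using Submodule.span_induction with
  | mem x hx =>
    obtain ⟨S, ⟨F, hF, hle, hS⟩, rfl⟩ := hx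
    rw [alpha_apply hn.ne']
    refine finsum_induction (fun f => f ∈ chargeSpace k c l) (Submodule.zero_mem _)
      (fun _ _ => Submodule.add_mem _) fun r => ?_
    obtain ⟨m, rfl⟩ := hi_surjective r
    by_cases hm : hi m ∈ S.1
    · rw [psiStar_vec_of_mem hm, map_smul, shift_hi]
      refine Submodule.smul_mem _ _ ?_
      by_cases hm' : hi (m + -n) ∈ (S.erase (hi m)).1
      · rw [psi_vec_of_mem hm']
        exact Submodule.zero_mem _
      · rw [psi_vec_of_notMem hm']
        refine Submodule.smul_mem _ _ (Submodule.subset_span ⟨_, ?_, rfl⟩)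
        have hS' : hi (m + -n) ∉ S.1 := fun h =>
          hm' (Maya.mem_erase.2 ⟨h, fun h' => by rw [hi_inj] at h'; omega⟩)
        rw [hS] at hS'
        have hmF : m ∈ F := by
          rcases (hS m).1 hm with h | h
          · exact h
          · exact absurd (Or.inr (by omega)) hS'
        have hnF : m + -n ∉ F.erase m := fun h => hS' (Or.inl (Finset.mem_of_mem_erase h))
        refine ⟨insert (m + -n) (F.erase m), ?_, ?_, ?_⟩
        · rw [Finset.card_insert_of_notMem hnF, Finset.card_erase_add_one hmF, hF]
        · intro a ha
          rcases Finset.mem_insert.1 ha with rfl | ha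
          · by_contra h
            exact hS' (Or.inr (not_le.1 h))
          · exact hle a (Finset.mem_of_mem_erase ha)
        · intro a
          rw [Maya.mem_insert, Maya.mem_erase, hi_inj, Ne, hi_inj, hS, Finset.mem_insert,
            Finset.mem_erase]
          have := hle m hmF
          by_cases ham : a = m
          · subst ham
            constructor
            · rintro (h | ⟨_, h⟩)
              · exact Or.inl (Or.inl h)
              · exact absurd rfl h
            · rintro ((h | ⟨h, _⟩) | h)
              · exact Or.inl h
              · exact absurd rfl h
              · omega
          · tauto
    · rw [psiStar_vec_of_notMem hm, map_zero]
      exact Submodule.zero_mem _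
  | zero => rw [map_zero]; exact Submodule.zero_mem _
  | add x y _ _ hx hy => rw [map_add]; exact Submodule.add_mem _ hx hy
  | smul a x _ hx => rw [map_smul]; exact Submodule.smul_mem _ _ hx

theorem coeff_vertex_mem_chargeSpace [CharZero k] {e : ℕ → ℕ ⊕ ℕ} (he : Function.Injective e)
    {c l : ℕ} (m : ℕ ⊕ ℕ →₀ ℕ) {f : Wedge k} (hf : f ∈ chargeSpace k c l) :
    coeff m (vertex e lower) f ∈ chargeSpace k c l := by
  induction hd : m.degree using Nat.strong_induction_on generalizing m with
  | _ d ih =>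
    by_cases hm : m = 0
    · rw [hm, coeff_zero_eq_constantCoeff_apply, constantCoeff_vertex]
      exact hf
    · obtain ⟨a, ha⟩ := Finsupp.ne_iff.1 hm
      by_cases hr : ∃ i, e i = a
      · obtain ⟨i, rfl⟩ := hr
        have hmi : (m (e i) : k) ≠ 0 := Nat.cast_ne_zero.2 ha
        have h := LinearMap.congr_fun (smul_coeff_vertex (k := k) he lower_commute i m) f
        rw [LinearMap.smul_apply, LinearMap.sum_apply] at h
        have h2 : (m (e i) : k)⁻¹ • ∑ n ∈ Finset.range (m (e i)), (lower (n + 1) *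
            coeff (m - Finsupp.single (e i) (n + 1)) (vertex e lower) : Module.End k (Wedge k)) f ∈
              chargeSpace k c l :=
          Submodule.smul_mem _ _ (Submodule.sum_mem _ fun n hn =>
            alpha_mem_chargeSpace (Int.natCast_pos.2 n.succ_pos)
              (ih _ (by rw [← hd]; exact degree_sub_single_lt (Finset.mem_range.1 hn)) _ rfl))
        have h3 := congrArg (fun v => (m (e i) : k)⁻¹ • v) h
        simp only [smul_smul, inv_mul_cancel₀ hmi, one_smul] at h3
        rw [h3]
        exact h2
      · push Not at hr
        rw [coeff_vertex_eq_zero he lower_commute hr ha]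
        exact Submodule.zero_mem _

theorem eq_of_hasCharge_vac {c l : ℕ} (h : HasCharge c l Maya.vac) : l = c := by
  obtain ⟨F, hF, hle, hS⟩ := h
  have hFI : F = Finset.Ico (-(c : ℤ)) 0 := by
    ext n
    have h1 : hi n ∈ Maya.vac.1 ↔ n < 0 := hi_mem_negHalf
    rw [hS] at h1
    rw [Finset.mem_Ico]
    constructor
    · exact fun hn => ⟨hle n hn, h1.1 (Or.inl hn)⟩
    · rintro ⟨h2, h3⟩
      exact (h1.2 h3).resolve_right (by omega)
  rw [← hF, hFI]
  simp

theorem apply_vac_eq_zero {c l : ℕ} (hlc : l ≠ c) {f : Wedge k} (hf : f ∈ chargeSpace k c l) :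
    f Maya.vac = 0 := by
  induction hf using Submodule.span_induction with
  | mem x hx =>
    obtain ⟨S, hS, rfl⟩ := hx
    have hne : S ≠ Maya.vac := by
      rintro rfl
      exact hlc (eq_of_hasCharge_vac hS)
    exact Finsupp.single_eq_of_ne hne.symm
  | zero => rfl
  | add x y _ _ hx hy => rw [Finsupp.add_apply, hx, hy, add_zero]
  | smul a x _ hx => rw [Finsupp.smul_apply, hx, smul_zero]

/-- Only the sets `𝔖(λ)` contribute: `Γ_+` preserves the charge. -/
theorem coeff_vertex_apply_vac_eq_zero [CharZero k] {e : ℕ → ℕ ⊕ ℕ} (he : Function.Injective e)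
    {S : Maya} (hS : S ∉ Set.range diagramMaya) (m : ℕ ⊕ ℕ →₀ ℕ) :
    (coeff m (vertex e lower) (vec k S)) Maya.vac = 0 := by
  obtain ⟨c, l, h⟩ := exists_hasCharge S
  have hlc : l ≠ c := by
    rintro rfl
    exact hS (exists_diagramMaya h)
  exact apply_vac_eq_zero hlc
    (coeff_vertex_mem_chargeSpace he m (Submodule.subset_span ⟨S, h, rfl⟩))

end Charge

/-! ### The correlation functions as vacuum expectations -/

section Correlation

open MvPowerSeries

variable {k : Type*} [Field k]

theorem linearMap_apply_eq_finsum (L : Wedge k →ₗ[k] k) (f : Wedge k) :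
    L f = ∑ᶠ S, f S * L (vec k S) := by
  rw [finsum_eq_sum_of_support_subset (s := f.support)]
  · conv_lhs => rw [← Finsupp.sum_single f]
    rw [Finsupp.sum, map_sum]
    refine Finset.sum_congr rfl fun S _ => ?_
    rw [vec, ← smul_eq_mul, ← map_smul, Finsupp.smul_single, smul_eq_mul, mul_one]
  · intro S hS
    rw [Finset.mem_coe, Finsupp.mem_support_iff]
    exact left_ne_zero_of_mul hS

open Classical in
/-- The pairing `(Γ_+ π Γ_- v_∅, v_∅)`, computed in the basis `v_S`.  Only the `v_S` with `S = 𝔖(λ)`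
contribute, and `π` selects those with `λ ∈ E`. -/
theorem vev_projection [CharZero k] (E : Set YoungDiagram) (π : Module.End k (Wedge k))
    (hπ : ∀ lam, π (vec k (diagramMaya lam)) = if lam ∈ E then vec k (diagramMaya lam) else 0) :
    vev (GammaPlus (tx k) * C π * GammaMinus (ty k)) =
      formalSum fun lam : E => schur (xvar k) lam.1 * schur (yvar k) lam.1 := by
  ext m
  have hterm : ∀ p q : ℕ ⊕ ℕ →₀ ℕ, innerProd k
      ((coeff p (GammaPlus (tx k) * (C π : Operator k)) : Module.End k (Wedge k))
        (coeff q (GammaMinus (ty k)) (vec k Maya.vac))) (vec k Maya.vac) =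
      ∑ᶠ lam : E, coeff p (schur (xvar k) lam.1) * coeff q (schur (yvar k) lam.1) := by
    intro p q
    rw [← innerLeft_apply, ← LinearMap.comp_apply, linearMap_apply_eq_finsum]
    have hS : ∀ S : Maya, (coeff q (GammaMinus (ty k)) (vec k Maya.vac)) S =
        (coeff q (vertex Sum.inr lower) (vec k S)) Maya.vac := by
      intro S
      rw [← innerProd_vec_right, GammaMinus_eq, isAdj_coeff_vertex Sum.inr_injective,
        innerProd_vec_left]
    have hcoeff : coeff p (GammaPlus (tx k) * (C π : Operator k)) =
        coeff p (GammaPlus (tx k)) * π :=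
      coeff_mul_C p _ _
    have hrange : ∀ g : Maya → k, (∀ S, S ∉ Set.range diagramMaya → g S = 0) →
        ∑ᶠ S, g S = ∑ᶠ lam, g (diagramMaya lam) := by
      intro g hg
      rw [← finsum_mem_range diagramMaya_injective, finsum_mem_def]
      refine finsum_congr fun S => ?_
      by_cases h : S ∈ Set.range diagramMaya
      · rw [Set.indicator_of_mem h]
      · rw [Set.indicator_of_notMem h, hg S h]
    rw [hrange]
    · rw [finsum_set_coe_eq_finsum_mem
        (f := fun lam => coeff p (schur (xvar k) lam) * coeff q (schur (yvar k) lam)) E,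
        finsum_mem_def]
      refine finsum_congr fun lam => ?_
      rw [hS, ← coeff_schur_eq_vertex Sum.inr_injective lam q, LinearMap.comp_apply, hcoeff,
        Module.End.mul_apply, hπ, innerLeft_apply, innerProd_vec_right]
      by_cases h : lam ∈ E
      · rw [if_pos h, Set.indicator_of_mem h, GammaPlus_eq,
          ← coeff_schur_eq_vertex Sum.inl_injective lam p, mul_comm]
        rfl
      · rw [if_neg h, Set.indicator_of_notMem h, map_zero, Finsupp.zero_apply, mul_zero]
    · intro S hSr
      rw [hS, coeff_vertex_apply_vac_eq_zero Sum.inr_injective hSr, zero_mul]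
  rw [coeff_vev, coeff_mul, LinearMap.sum_apply, ← innerLeft_apply, map_sum, coeff_formalSum]
  rw [Finset.sum_congr rfl fun p _ => hterm p.1 p.2, finsum_congr fun lam => coeff_mul ..]
  refine (finsum_sum_comm _ _ fun p _ => ?_).symm
  refine ((finite_card_le p.1.degree).preimage Subtype.val_injective.injOn).subset fun lam h => ?_
  exact (coeff_schur Sum.inl lam.1 p.1 (left_ne_zero_of_mul h)).ge

theorem formalSum_mul_left {σ A ι : Type*} [Semiring A] (c : MvPowerSeries σ A)
    {f : ι → MvPowerSeries σ A} (hf : LocallyFinite f) :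
    formalSum (fun i => c * f i) = c * formalSum f := by
  classical
  ext m
  rw [coeff_formalSum, coeff_mul]
  simp only [coeff_mul, coeff_formalSum]
  rw [finsum_sum_comm]
  · refine Finset.sum_congr rfl fun p _ => ?_
    exact (mul_finsum' _ _ (hf p.2)).symm
  · exact fun p _ => (hf p.2).subset fun i hi' h => hi' (by
      change coeff p.1 c * coeff p.2 (f i) = 0
      rw [show coeff p.2 (f i) = 0 from h, mul_zero])

theorem Z_eq_vev [CharZero k] : Z k = vev (GammaPlus (tx k) * GammaMinus (ty k)) := by
  have h := vev_projection (k := k) Set.univ 1 fun lam => by simp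
  rw [map_one, mul_one] at h
  rw [h]
  ext m
  rw [Z, coeff_formalSum, coeff_formalSum]
  exact (finsum_comp_equiv (Equiv.Set.univ YoungDiagram)
    (f := fun lam => coeff m (schur (xvar k) lam * schur (yvar k) lam))).symm

/-- The correlation function is a vacuum expectation, for any operator `π` that projects onto the
span of the `v_S` with `X ⊂ S`. -/
theorem rho_eq_vev [CharZero k] (X : Finset HalfInt) (π : Module.End k (Wedge k))
    (hπ : ∀ S : Maya, ((X : Set HalfInt) ⊆ S.1 → π (vec k S) = vec k S) ∧
      (¬ (X : Set HalfInt) ⊆ S.1 → π (vec k S) = 0)) :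
    rho k X = vev (G k * C π * Ring.inverse (G k)) := by
  classical
  have h1 := vev_projection {lam | (X : Set HalfInt) ⊆ frakS lam} π fun lam => by
    split_ifs with h
    · exact (hπ _).1 (by rw [diagramMaya_val]; exact h)
    · exact (hπ _).2 (by rw [diagramMaya_val]; exact h)
  have h2 : rho k X = (Z k)⁻¹ * vev (GammaPlus (tx k) * C π * GammaMinus (ty k)) := by
    rw [h1, ← formalSum_mul_left]
    · rfl
    · intro m
      exact ((summable_Z (k := k) m).preimage Subtype.val_injective.injOn)
  rw [h2, ← vev_conj_G, ← Z_eq_vev, ← mul_assoc, MvPowerSeries.inv_mul_cancel, one_mul]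
  rw [constantCoeff_Z]
  exact one_ne_zero

/-- The determinantal formula, for an enumeration `x` of the set `X`. -/
theorem rho_eq_det [CharZero k] {n : ℕ} {x : Fin n → HalfInt} (hx : Function.Injective x)
    {X : Finset HalfInt} (hX : (X : Set HalfInt) = Set.range x) :
    rho k X = Matrix.det (Matrix.of fun i j => K k (x i) (x j)) := by
  classical
  have hπ := ascProd_mul_descProd_vec (k := k) n x hx
  have hmem : ∀ S : Maya, (∀ i, x i ∈ S.1) ↔ (X : Set HalfInt) ⊆ S.1 := fun S => by
    rw [hX, Set.range_subset_iff]
  rw [rho_eq_vev X (ascProd n (fun i => psi k (x i)) * descProd n fun i => psiStar k (x i))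
    fun S => ⟨fun h => by rw [hπ, if_pos ((hmem S).2 h)],
      fun h => by rw [hπ, if_neg fun h' => h ((hmem S).1 h')]⟩,
    ← ascProd_mul_descProd_C, ← conj_ascProd_mul_descProd inverse_G_mul G_mul_inverse]
  exact vev_Psi_PsiStar n x

end Correlation

end SchurMeasure

/-- The correlation functions of the Schur measure are determinants:
`ρ(X) = det [K(a, b)]_{a, b ∈ X}` for every finite set `X` of half-integers. -/
theorem theorem1 (k : Type*) [Field k] [CharZero k] (X : Finset SchurMeasure.HalfInt) :
    SchurMeasure.rho k X =
      Matrix.det (Matrix.of fun a b : X => SchurMeasure.K k a.1 b.1) := by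
  rw [SchurMeasure.rho_eq_det (x := fun i => (X.equivFin.symm i).1)
    (Subtype.val_injective.comp X.equivFin.symm.injective)]
  · exact Matrix.det_submatrix_equiv_self X.equivFin.symm
      (Matrix.of fun a b : X => SchurMeasure.K k a.1 b.1)
  · rw [Set.range_comp' Subtype.val, X.equivFin.symm.range_eq_univ, Set.image_univ,
      Subtype.range_coe]
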